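/- Consider simple undirected graphs on the vertex set $\{1,\dots,n\}$, accessed in the general query model: a degree query on $v$ returns $\deg(v)$; a neighbor query on $(v,i)$, $i\in\{1,\dots,n\}$, returns the $i$-th neighbor of $v$ in an arbitrary but fixed ordering of its neighbors, or $\perp$ if $i>\deg(v)$; a pair query on $(u,v)$ returns whether $uv$ is an edge. A randomized algorithm is an adaptive query algorithm with real output whose random coins are drawn from a probability space independent of the input. Two graphs $G_1=(V,E_1)$, $G_2=(V,E_2)$ are edge-neighboring if $E_1\setminus\{e\}=E_2\setminus\{e\}$ for some $e$; an algorithm $\mathcal A$ is $\varepsilon$-edge differentially private if $\Pr[\mathcal A(G_1)\in S]\le e^{\varepsilon}\Pr[\mathcal A(G_2)\in S]$ for all edge-neighboring $G_1,G_2$ (with any orderings of the neighbors) and all measurable $S\subseteq\mathbb R$. For a graph $G$ let $t$ be its number of triangles and $m$ its number of edges; $\log$ is the natural logarithm. For every integer $K>0$ and every real $c>0$ there are constants $C',C>0$ and $k\in\mathbb N$, depending only on $K$ and $c$, such that for all $\varepsilon>0$ and $\alpha\in(0,1)$ there is a randomized algorithm $\mathcal A'$ (given $n\ge 1$) with the following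 properties. 1. (Privacy) $\mathcal A'$ is $\varepsilon$-edge differentially private. 2. (Accuracy) For every graph $G$ on $n$ vertices, with probability at least $1-\frac1{n^c}-\frac{1}{n^{c-3}(e^{\varepsilon}-1)/K+1}$, $$(1-\alpha')t-\frac{2c}{\varepsilon}\,n\log n-\frac1{Kn^3}\;\le\;\mathcal A'(G)\;\le\;(1+\alpha')t+\frac{2c}{\varepsilon}\,n\log n+\frac1{Kn^3},\qquad \alpha'=\alpha\Bigl(1+\frac{\varepsilon}{C'\log n}\Bigr)$$ (for $n=1$ one has $t=0$ and the value of $\alpha'$ is irrelevant). 3. (Queries) For every graph $G$ on $n$ vertices with $t\ge1$, with probability at least $1-\frac1{n^c}$, $\mathcal A'$ makes at most $$C\Bigl(\frac{n}{t^{1/3}}+\frac{m^{3/2}}{t}\Bigr)\Bigl(1+\log n+\frac1{\alpha\varepsilon}\Bigr)^{k}$$ queries. -/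

import Mathlib

open MeasureTheory

namespace TriangleDP

/-- A graph on the vertex set `Fin n` as it is presented to a query algorithm: the graph together
with an (arbitrary) ordering of the neighbours of every vertex, which gives a meaning to
"the `i`-th neighbour of `v`". -/
structure GraphInput (n : ℕ) where
  graph : SimpleGraph (Fin n)
  nbrs : Fin n → List (Fin n)
  nodup_nbrs : ∀ v, (nbrs v).Nodup
  mem_nbrs : ∀ v w, w ∈ nbrs v ↔ graph.Adj v w

open Classical in
/-- The length of the neighbour list of a vertex is its degree. -/
theorem GraphInput.length_nbrs {n : ℕ} (I : GraphInput n) (v : Fin n) :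
    (I.nbrs v).length = I.graph.degree v := by
  rw [← List.toFinset_card_of_nodup (I.nodup_nbrs v), ← SimpleGraph.card_neighborFinset_eq_degree]
  congr 1
  ext w
  simp [I.mem_nbrs]

/-- The queries of the general query model (neighbours are numbered from `0`). -/
inductive Query (n : ℕ) : Type
  | degree (v : Fin n)
  | neighbor (v : Fin n) (i : Fin n)
  | pair (u v : Fin n)

/-- The type of answers to a query. In a neighbour query, `none` stands for `⊥`. -/
def Query.Answer {n : ℕ} : Query n → Type
  | .degree _ => ℕ
  | .neighbor _ _ => Option (Fin n)
  | .pair _ _ => Bool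

open Classical in
/-- The answer of the oracle. -/
noncomputable def GraphInput.answer {n : ℕ} (I : GraphInput n) : (q : Query n) → q.Answer
  | .degree v => (I.nbrs v).length
  | .neighbor v i => (I.nbrs v)[(i : ℕ)]?
  | .pair u v => decide (I.graph.Adj u v)

/-- A deterministic adaptive query algorithm with real output: a decision tree which either stops
with an output, or asks a query and continues in a way that depends on the answer. -/
inductive DecisionTree (n : ℕ) : Type
  | output (x : ℝ) : DecisionTree n
  | ask (q : Query n) (next : q.Answer → DecisionTree n) : DecisionTree n

/-- The output of a decision tree on an input. -/
noncomputable def DecisionTree.eval {n : ℕ} : DecisionTree n → GraphInput n → ℝ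
  | .output x, _ => x
  | .ask q next, I => (next (I.answer q)).eval I

/-- The number of queries that a decision tree makes on an input. -/
noncomputable def DecisionTree.numQueries {n : ℕ} : DecisionTree n → GraphInput n → ℕ
  | .output _, _ => 0
  | .ask q next, I => (next (I.answer q)).numQueries I + 1

/-- A randomized query algorithm for `n`-vertex graphs: its random coins are drawn from a
probability space (which does not depend on the input), and for every outcome of the coins it is a
deterministic query algorithm. Its output and its number of queries are random variables. -/
structure RandomizedAlgorithm (n : ℕ) where
  Coins : Type
  [measurableSpaceCoins : MeasurableSpace Coins]
  law : Measure Coins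
  [isProbabilityMeasure_law : IsProbabilityMeasure law]
  tree : Coins → DecisionTree n
  measurable_eval : ∀ I : GraphInput n, Measurable fun r => (tree r).eval I
  measurable_numQueries : ∀ I : GraphInput n, Measurable fun r => (tree r).numQueries I

attribute [instance] RandomizedAlgorithm.measurableSpaceCoins
attribute [instance] RandomizedAlgorithm.isProbabilityMeasure_law

/-- The probability that the output of the algorithm on the input `I` lies in `S`. -/
noncomputable def RandomizedAlgorithm.probOutput {n : ℕ} (A : RandomizedAlgorithm n)
    (I : GraphInput n) (S : Set ℝ) : ℝ :=
  A.law.real {r | (A.tree r).eval I ∈ S}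

/-- The probability that the algorithm makes at most `B` queries on the input `I`. -/
noncomputable def RandomizedAlgorithm.probQueriesLE {n : ℕ} (A : RandomizedAlgorithm n)
    (I : GraphInput n) (B : ℝ) : ℝ :=
  A.law.real {r | ((A.tree r).numQueries I : ℝ) ≤ B}

/-- Two graphs on the same vertices are edge-neighbouring if they agree outside one edge. -/
def EdgeNeighboring {n : ℕ} (G₁ G₂ : SimpleGraph (Fin n)) : Prop :=
  ∃ e : Sym2 (Fin n), G₁.edgeSet \ {e} = G₂.edgeSet \ {e}

/-- Pure `ε`-edge differential privacy, whatever the orderings of the neighbours in the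
presentations of the two edge-neighbouring graphs are. -/
def RandomizedAlgorithm.IsEdgeDP {n : ℕ} (A : RandomizedAlgorithm n) (ε : ℝ) : Prop :=
  ∀ I₁ I₂ : GraphInput n, EdgeNeighboring I₁.graph I₂.graph →
    ∀ S : Set ℝ, MeasurableSet S → A.probOutput I₁ S ≤ Real.exp ε * A.probOutput I₂ S

/-- The number of edges. -/
noncomputable def numEdges {n : ℕ} (G : SimpleGraph (Fin n)) : ℕ :=
  G.edgeSet.ncard

/-- The number of triangles, i.e. of sets of three pairwise adjacent vertices. -/
noncomputable def numTriangles {n : ℕ} (G : SimpleGraph (Fin n)) : ℕ :=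
  (G.cliqueSet 3).ncard

end TriangleDP

/-!
A sublinear estimator of the number `t` of triangles is made private by noise on a logarithmic
scale.

For the estimator, order the vertices by degree, so that every triangle can be found by inspecting
the neighbours of its first vertex, of which at most `√(2 * m)` come later in the order. The
estimator samples vertices, edges at these vertices and further neighbours. Vertices in too many
triangles would spoil its variance; they are recognized by sampling, too, and a triangle is shared
among its remaining (light) vertices only. Few triangles have no light vertex, hence the expectation
hardly changes. The sampling rates depend on a guess of `t`, which is lowered until the estimate
exceeds it.

One edge lies in at most `n` triangles. Hence, on the grid of the points `N * (exp (g * j) - 1)`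
with `N = n / ν`, the index `j` of an estimate with relative error of order `ν` changes by a bounded
amount between neighbouring graphs, and moving the index by the geometric mechanism hides the
change, provided that the estimator succeeds. To hide its failures as well, mix the noise with a
little of the uniform law: every index then has a probability that exceeds that of a failure.

The number of queries depends on `α * ε` and, through the failure probability, on `log (1 / α)`. If
`ε` is so large that the noise is below `1 / (K * n ^ 3)`, lower `ε` and raise `α` with `α * ε` kept
fixed: this bounds `log (1 / α)`, and raises `α` to at most `α * (1 + ε / (c * log n))`.
-/

namespace TriangleDP

/-! ### Mixtures of measures -/

section Mixture

variable {ι : Type*} {X : ι → Type*} [∀ i, MeasurableSpace (X i)]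

theorem measurable_sigmaMk (i : ι) : Measurable (Sigma.mk (β := X) i) :=
  fun _ hs => MeasurableSpace.measurableSet_iInf.1 hs i

theorem measurable_of_comp_sigmaMk {γ : Type*} [MeasurableSpace γ] {f : (Σ i, X i) → γ}
    (hf : ∀ i, Measurable (f ∘ Sigma.mk i)) : Measurable f :=
  fun _ hs => MeasurableSpace.measurableSet_iInf.2 fun i => hf i hs

variable [Fintype ι]

/-- The mixture of the measures `μ i` with weights `w i`, on the disjoint union of their spaces. -/
noncomputable def mixture (w : ι → ℝ) (μ : ∀ i, Measure (X i)) : Measure (Σ i, X i) :=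
  ∑ i, ENNReal.ofReal (w i) • (μ i).map (Sigma.mk i)

theorem mixture_apply (w : ι → ℝ) (μ : ∀ i, Measure (X i)) {s : Set (Σ i, X i)}
    (hs : MeasurableSet s) :
    mixture w μ s = ∑ i, ENNReal.ofReal (w i) * μ i (Sigma.mk i ⁻¹' s) := by
  simp only [mixture, Measure.coe_finsetSum, Finset.sum_apply, Measure.smul_apply, smul_eq_mul,
    Measure.map_apply (measurable_sigmaMk _) hs]

variable (w : stdSimplex ℝ ι) (μ : ∀ i, Measure (X i)) [∀ i, IsProbabilityMeasure (μ i)]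

instance isProbabilityMeasure_mixture : IsProbabilityMeasure (mixture w μ) := ⟨by
  simp only [mixture_apply _ μ MeasurableSet.univ, Set.preimage_univ, measure_univ, mul_one]
  rw [← ENNReal.ofReal_sum_of_nonneg fun i _ => stdSimplex.zero_le w i, stdSimplex.sum_eq_one,
    ENNReal.ofReal_one]⟩

theorem mixture_real_apply {s : Set (Σ i, X i)} (hs : MeasurableSet s) :
    (mixture w μ).real s = ∑ i, w i * (μ i).real (Sigma.mk i ⁻¹' s) := by
  rw [measureReal_def, mixture_apply _ μ hs, ENNReal.toReal_sum fun i _ =>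
    ENNReal.mul_ne_top ENNReal.ofReal_ne_top (measure_ne_top _ _)]
  simp only [ENNReal.toReal_mul, ENNReal.toReal_ofReal (stdSimplex.zero_le w _),
    measureReal_def]

end Mixture

/-! ### Randomized query programs -/

/-- A randomized query program with results in `α`: it stops, asks a query, or draws an element of
`Fin k` with given probabilities. Programs are syntactic counterparts of randomized algorithms,
which can be composed, and whose finite randomness makes every expectation a finite sum. -/
inductive Program (n : ℕ) (α : Type) : Type
  | pure (a : α) : Program n α
  | ask (q : Query n) (next : q.Answer → Program n α) : Program n α
  | rand {k : ℕ} (w : stdSimplex ℝ (Fin k)) (next : Fin k → Program n α) : Program n α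

namespace Program

variable {n : ℕ} {α β : Type}

/-- Sequential composition. -/
def bind : Program n α → (α → Program n β) → Program n β
  | .pure a, g => g a
  | .ask q next, g => .ask q fun x => (next x).bind g
  | .rand w next, g => .rand w fun i => (next i).bind g

/-- The expectation, on the input `I`, of a function of the result and of the number of queries. -/
noncomputable def expect (I : GraphInput n) : Program n α → (α → ℕ → ℝ) → ℝ
  | .pure a, f => f a 0
  | .ask q next, f => (next (I.answer q)).expect I fun a c => f a (c + 1)
  | .rand w next, f => ∑ i, w i * (next i).expect I f

open Classical in
/-- The probability, on the input `I`, of an event that concerns the result and the number of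
queries. -/
noncomputable def prob (I : GraphInput n) (A : Program n α) (P : α → ℕ → Prop) : ℝ :=
  A.expect I fun a c => if P a c then 1 else 0

section Expectation

variable (I : GraphInput n) (A : Program n α)

theorem expect_bind (g : α → Program n β) (f : β → ℕ → ℝ) :
    (A.bind g).expect I f = A.expect I fun a c => (g a).expect I fun b c' => f b (c + c') := by
  induction A generalizing f with
  | pure a => simp only [bind, expect, zero_add]
  | ask q next ih => simp only [bind, expect, ih, Nat.add_right_comm]
  | rand w next ih => simp only [bind, expect, ih]

theorem expect_add (f g : α → ℕ → ℝ) :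
    (A.expect I fun a c => f a c + g a c) = A.expect I f + A.expect I g := by
  induction A generalizing f g with
  | pure a => rfl
  | ask q next ih => simp only [expect, ih]
  | rand w next ih => simp only [expect, ih, mul_add, Finset.sum_add_distrib]

theorem expect_const_mul (r : ℝ) (f : α → ℕ → ℝ) :
    (A.expect I fun a c => r * f a c) = r * A.expect I f := by
  induction A generalizing f with
  | pure a => rfl
  | ask q next ih => simp only [expect, ih]
  | rand w next ih => simp only [expect, ih, Finset.mul_sum, mul_left_comm]

theorem expect_mul_const (f : α → ℕ → ℝ) (r : ℝ) :
    (A.expect I fun a c => f a c * r) = A.expect I f * r := by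
  simp only [mul_comm _ r, expect_const_mul]

theorem expect_sub (f g : α → ℕ → ℝ) :
    (A.expect I fun a c => f a c - g a c) = A.expect I f - A.expect I g := by
  simp only [sub_eq_add_neg, ← neg_one_mul (g _ _), ← neg_one_mul (A.expect I g), expect_add,
    expect_const_mul]

theorem expect_const (r : ℝ) : (A.expect I fun _ _ => r) = r := by
  induction A with
  | pure a => rfl
  | ask q next ih => simp only [expect, ih]
  | rand w next ih => simp only [expect, ih, ← Finset.sum_mul, stdSimplex.sum_eq_one, one_mul]

variable {A}

theorem expect_mono {f g : α → ℕ → ℝ} (h : ∀ a c, f a c ≤ g a c) :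
    A.expect I f ≤ A.expect I g := by
  induction A generalizing f g with
  | pure a => exact h a 0
  | ask q _ ih => exact ih _ fun a c => h a (c + 1)
  | rand w next ih =>
    exact Finset.sum_le_sum fun i _ => mul_le_mul_of_nonneg_left (ih i h) (stdSimplex.zero_le w i)

theorem expect_nonneg {f : α → ℕ → ℝ} (h : ∀ a c, 0 ≤ f a c) : 0 ≤ A.expect I f :=
  (A.expect_const I 0).symm.le.trans (expect_mono I h)

end Expectation

section Probability

variable (I : GraphInput n) (A : Program n α)

theorem expect_ite (P : α → ℕ → Prop) [∀ a c, Decidable (P a c)] :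
    (A.expect I fun a c => if P a c then 1 else 0) = A.prob I P := by
  unfold prob; congr!

theorem prob_pure (a : α) (P : α → ℕ → Prop) [Decidable (P a 0)] :
    (pure a : Program n α).prob I P = if P a 0 then 1 else 0 := by
  unfold prob expect; congr!

theorem prob_ask (q : Query n) (next : q.Answer → Program n α) (P : α → ℕ → Prop) :
    (ask q next).prob I P = (next (I.answer q)).prob I fun a c => P a (c + 1) := rfl

theorem prob_rand {k : ℕ} (w : stdSimplex ℝ (Fin k)) (next : Fin k → Program n α)
    (P : α → ℕ → Prop) : (rand w next).prob I P = ∑ i, w i * (next i).prob I P := rfl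

theorem prob_bind (g : α → Program n β) (P : β → ℕ → Prop) :
    (A.bind g).prob I P = A.expect I fun a c => (g a).prob I fun b c' => P b (c + c') :=
  expect_bind I A g _

theorem prob_bind_pure (g : α → β) (P : β → ℕ → Prop) :
    (A.bind fun a => pure (g a)).prob I P = A.prob I fun a c => P (g a) c :=
  prob_bind I A _ P

theorem prob_not (P : α → ℕ → Prop) : (A.prob I fun a c => ¬ P a c) = 1 - A.prob I P := by
  classical
  rw [eq_sub_iff_add_eq, ← expect_ite, ← expect_ite, ← expect_add]
  refine Eq.trans ?_ (A.expect_const I 1)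
  congr! with a c
  by_cases hP : P a c <;> simp [hP]

variable {A}

theorem prob_nonneg (P : α → ℕ → Prop) : 0 ≤ A.prob I P :=
  expect_nonneg I fun _ _ => by split_ifs <;> norm_num

theorem prob_le_one (P : α → ℕ → Prop) : A.prob I P ≤ 1 :=
  (expect_mono I fun _ _ => by split_ifs <;> norm_num).trans (A.expect_const I 1).le

theorem prob_mono {P Q : α → ℕ → Prop} (h : ∀ a c, P a c → Q a c) : A.prob I P ≤ A.prob I Q :=
  expect_mono I fun a c => by
    by_cases hP : P a c
    · simp [hP, h a c hP]
    · simp only [hP, if_false]; split_ifs <;> norm_num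

theorem prob_or_le (P Q : α → ℕ → Prop) :
    (A.prob I fun a c => P a c ∨ Q a c) ≤ A.prob I P + A.prob I Q := by
  classical
  simp only [← expect_ite, ← expect_add]
  refine expect_mono I fun a c => ?_
  by_cases hP : P a c <;> by_cases hQ : Q a c <;> simp [hP, hQ]

theorem prob_le_expect_div {f : α → ℕ → ℝ} (hf : ∀ a c, 0 ≤ f a c) {r : ℝ} (hr : 0 < r)
    {P : α → ℕ → Prop} (h : ∀ a c, P a c → r ≤ f a c) : A.prob I P ≤ A.expect I f / r := by
  rw [div_eq_mul_inv, ← expect_mul_const]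
  refine expect_mono I fun a c => ?_
  split_ifs with hP
  · rw [← div_eq_mul_inv, one_le_div hr]
    exact h a c hP
  · exact mul_nonneg (hf a c) (inv_nonneg.2 hr.le)

theorem prob_bind_not_le {g : α → Program n β} {P : α → ℕ → Prop} {Q : β → ℕ → Prop}
    {δ₁ δ₂ : ℝ} (hδ₂ : 0 ≤ δ₂) (hA : (A.prob I fun a c => ¬ P a c) ≤ δ₁)
    (hg : ∀ a c, P a c → ((g a).prob I fun b c' => ¬ Q b (c + c')) ≤ δ₂) :
    ((A.bind g).prob I fun b c => ¬ Q b c) ≤ δ₁ + δ₂ := by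
  classical
  rw [prob_bind]
  calc _ ≤ A.expect I fun a c => (if ¬ P a c then 1 else 0) + δ₂ := expect_mono I fun a c => by
        by_cases hP : P a c
        · simpa [hP] using hg a c hP
        · simpa [hP] using (prob_le_one I _).trans (le_add_of_nonneg_right hδ₂)
    _ ≤ δ₁ + δ₂ := by
        rw [expect_add, expect_const, expect_ite]
        gcongr

end Probability

end Program

/-! ### Programs as randomized algorithms -/

namespace RandomizedAlgorithm

variable {n : ℕ} (A : RandomizedAlgorithm n) (I : GraphInput n)

/-- The output together with the number of queries, as a random variable. -/
noncomputable def outcome (r : A.Coins) : ℝ × ℕ := ((A.tree r).eval I, (A.tree r).numQueries I)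

theorem measurable_outcome : Measurable (A.outcome I) :=
  (A.measurable_eval I).prodMk (A.measurable_numQueries I)

end RandomizedAlgorithm

namespace Program

variable {n : ℕ}

/-- `A` realizes the program `T`: the results and the numbers of queries have the same joint law on
every input. -/
def IsRealizedBy (T : Program n ℝ) (A : RandomizedAlgorithm n) : Prop :=
  ∀ (I : GraphInput n) (S : Set (ℝ × ℕ)), MeasurableSet S →
    A.law.real (A.outcome I ⁻¹' S) = T.prob I fun x c => (x, c) ∈ S

theorem exists_isRealizedBy_pure (x : ℝ) :
    ∃ A : RandomizedAlgorithm n, (pure x).IsRealizedBy A := by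
  classical
  refine ⟨{ Coins := Unit, law := Measure.dirac (), tree := fun _ => .output x,
            measurable_eval := fun I => measurable_const
            measurable_numQueries := fun I => measurable_const }, fun I S _ => ?_⟩
  change (Measure.dirac ()).real {_r | (x, 0) ∈ S} = _
  rw [prob_pure]
  by_cases h : (x, 0) ∈ S <;> simp [h]

/-- Only one of the continuations is run on a given input, so they may draw their coins
independently. -/
theorem exists_isRealizedBy_ask {q : Query n} {next : q.Answer → Program n ℝ}
    (hnext : ∀ a, ∃ A : RandomizedAlgorithm n, (next a).IsRealizedBy A) :
    ∃ A : RandomizedAlgorithm n, (ask q next).IsRealizedBy A := by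
  choose A hA using hnext
  refine ⟨{ Coins := ∀ a, (A a).Coins
            law := Measure.infinitePi fun a => (A a).law
            tree := fun r => .ask q fun a => (A a).tree (r a)
            measurable_eval := fun I =>
              ((A (I.answer q)).measurable_eval I).comp (measurable_pi_apply _)
            measurable_numQueries := fun I =>
              (((A (I.answer q)).measurable_numQueries I).comp
                (measurable_pi_apply (I.answer q))).add_const 1 }, fun I S hS => ?_⟩
  have hS' : MeasurableSet {p : ℝ × ℕ | (p.1, p.2 + 1) ∈ S} :=
    (measurable_fst.prodMk (measurable_snd.add_const 1)) hS
  refine Eq.trans ?_ (hA (I.answer q) I _ hS')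
  rw [measureReal_def, measureReal_def,
    ← (measurePreserving_eval_infinitePi (fun a => (A a).law) (I.answer q)).measure_preimage
      ((A _).measurable_outcome I hS').nullMeasurableSet]
  rfl

theorem exists_isRealizedBy_rand {k : ℕ} (w : stdSimplex ℝ (Fin k)) {next : Fin k → Program n ℝ}
    (hnext : ∀ i, ∃ A : RandomizedAlgorithm n, (next i).IsRealizedBy A) :
    ∃ A : RandomizedAlgorithm n, (rand w next).IsRealizedBy A := by
  choose A hA using hnext
  let B : RandomizedAlgorithm n :=
    { Coins := Σ i, (A i).Coins
      law := mixture w fun i => (A i).law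
      tree := fun r => (A r.1).tree r.2
      measurable_eval := fun I => measurable_of_comp_sigmaMk fun i => (A i).measurable_eval I
      measurable_numQueries := fun I =>
        measurable_of_comp_sigmaMk fun i => (A i).measurable_numQueries I }
  refine ⟨B, fun I S hS => ?_⟩
  rw [prob_rand]
  refine (mixture_real_apply w _ (B.measurable_outcome I hS)).trans ?_
  simp only [← hA _ I S hS]
  rfl

theorem exists_isRealizedBy (T : Program n ℝ) : ∃ A : RandomizedAlgorithm n, T.IsRealizedBy A := by
  induction T with
  | pure x => exact exists_isRealizedBy_pure x
  | ask q next ih => exact exists_isRealizedBy_ask ih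
  | rand w next ih => exact exists_isRealizedBy_rand w ih

namespace IsRealizedBy

variable {T : Program n ℝ} {A : RandomizedAlgorithm n} (h : T.IsRealizedBy A) (I : GraphInput n)
include h

theorem probOutput_eq {S : Set ℝ} (hS : MeasurableSet S) :
    A.probOutput I S = T.prob I fun x _ => x ∈ S :=
  h I (Prod.fst ⁻¹' S) (measurable_fst hS)

theorem probQueriesLE_eq (B : ℝ) : A.probQueriesLE I B = T.prob I fun _ c => (c : ℝ) ≤ B :=
  h I {p | (p.2 : ℝ) ≤ B} (measurable_snd (MeasurableSet.of_discrete (s := {c : ℕ | (c : ℝ) ≤ B})))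

end IsRealizedBy

end Program

namespace Program

variable {n : ℕ} {α β ι : Type}

/-! ### Moments -/

section Moments

variable (I : GraphInput n)

/-- The expected result. -/
noncomputable def mean (A : Program n ℝ) : ℝ := A.expect I fun x _ => x

/-- The expected square of the result. -/
noncomputable def secondMoment (A : Program n ℝ) : ℝ := A.expect I fun x _ => x ^ 2

/-- The variance of the result. -/
noncomputable def variance (A : Program n ℝ) : ℝ := A.secondMoment I - A.mean I ^ 2

/-- The expected number of queries. -/
noncomputable def cost (A : Program n α) : ℝ := A.expect I fun _ c => (c : ℝ)

@[simp] theorem mean_pure (x : ℝ) : (pure x : Program n ℝ).mean I = x := rfl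

@[simp] theorem variance_pure (x : ℝ) : (pure x : Program n ℝ).variance I = 0 := sub_self _

@[simp] theorem cost_pure (a : α) : (pure a : Program n α).cost I = 0 := Nat.cast_zero

@[simp] theorem cost_ask (q : Query n) (next : q.Answer → Program n α) :
    (ask q next).cost I = 1 + (next (I.answer q)).cost I := by
  simp only [cost, expect, Nat.cast_add, Nat.cast_one]
  rw [expect_add, expect_const, add_comm]

theorem cost_bind (A : Program n α) (g : α → Program n β) :
    (A.bind g).cost I = A.cost I + A.expect I fun a _ => (g a).cost I := by
  simp only [cost, expect_bind, Nat.cast_add, expect_add, expect_const]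

theorem cost_bind_pure (A : Program n α) (g : α → β) :
    (A.bind fun a => pure (g a)).cost I = A.cost I := by
  simp [cost_bind, expect_const]

variable (A : Program n ℝ)

theorem variance_eq_expect : A.variance I = A.expect I fun x _ => (x - A.mean I) ^ 2 := by
  have expand (x : ℝ) : (x - A.mean I) ^ 2 = x ^ 2 - 2 * A.mean I * x + A.mean I ^ 2 := by ring
  simp only [expand, expect_add, expect_sub, expect_const_mul, expect_const]
  change A.secondMoment I - A.mean I ^ 2 =
    A.secondMoment I - 2 * A.mean I * A.mean I + A.mean I ^ 2
  ring

theorem prob_le_abs_sub_mean_le {r : ℝ} (hr : 0 < r) :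
    (A.prob I fun x _ => r ≤ |x - A.mean I|) ≤ A.variance I / r ^ 2 := by
  rw [variance_eq_expect]
  refine prob_le_expect_div I (fun _ _ => sq_nonneg _) (by positivity) fun x _ hx => ?_
  rw [← sq_abs (x - _)]
  exact pow_le_pow_left₀ hr.le hx 2

theorem mean_bind_div (r : ℝ) : (A.bind fun x => pure (x / r)).mean I = A.mean I / r := by
  simp only [mean, expect_bind, expect, div_eq_mul_inv, expect_mul_const]

theorem secondMoment_bind_div (r : ℝ) :
    (A.bind fun x => pure (x / r)).secondMoment I = A.secondMoment I / r ^ 2 := by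
  simp only [secondMoment, expect_bind, expect, div_eq_mul_inv, mul_pow, expect_mul_const, inv_pow]

theorem variance_bind_div (r : ℝ) :
    (A.bind fun x => pure (x / r)).variance I = A.variance I / r ^ 2 := by
  rw [variance, variance, mean_bind_div, secondMoment_bind_div, div_pow, sub_div]

end Moments

section Sum

/-- Add up the results of independent programs. -/
def sumList (l : List ι) (f : ι → Program n ℝ) : Program n ℝ :=
  match l with
  | [] => pure 0
  | i :: l => (f i).bind fun x => (sumList l f).bind fun y => pure (x + y)

variable (I : GraphInput n) (l : List ι) (f : ι → Program n ℝ)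

theorem mean_sumList : (sumList l f).mean I = (l.map fun i => (f i).mean I).sum := by
  induction l with
  | nil => rfl
  | cons i l ih =>
    rw [List.map_cons, List.sum_cons, ← ih]
    simp only [sumList, mean, expect_bind, expect, expect_add, expect_const]

theorem variance_sumList : (sumList l f).variance I = (l.map fun i => (f i).variance I).sum := by
  induction l with
  | nil => exact variance_pure I 0
  | cons i l ih =>
    have h_second : (sumList (i :: l) f).secondMoment I = (f i).secondMoment I +
        2 * (f i).mean I * (sumList l f).mean I + (sumList l f).secondMoment I := by
      simp only [sumList, secondMoment, mean, expect_bind, expect, add_sq, expect_add,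
        expect_const, expect_const_mul, expect_mul_const]
    have h_mean : (sumList (i :: l) f).mean I = (f i).mean I + (sumList l f).mean I := by
      simp only [mean_sumList, List.map_cons, List.sum_cons]
    rw [List.map_cons, List.sum_cons, ← ih, variance, h_second, h_mean, variance, variance]
    ring

theorem cost_sumList : (sumList l f).cost I = (l.map fun i => (f i).cost I).sum := by
  induction l with
  | nil => exact cost_pure I 0
  | cons i l ih =>
    simp only [sumList, List.map_cons, List.sum_cons, ← ih, cost_bind, cost_pure, expect_const,
      add_zero]

end Sum

section Average

/-- The average of the results of `R` independent runs. -/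
noncomputable def average (R : ℕ) (A : Program n ℝ) : Program n ℝ :=
  (sumList (List.range R) fun _ => A).bind fun s => pure (s / R)

variable (I : GraphInput n) {R : ℕ} (A : Program n ℝ)

theorem mean_average (hR : R ≠ 0) : (average R A).mean I = A.mean I := by
  rw [average, mean_bind_div, mean_sumList, List.map_const', List.sum_replicate, List.length_range,
    nsmul_eq_mul, mul_div_cancel_left₀ _ (Nat.cast_ne_zero.2 hR)]

theorem variance_average (hR : R ≠ 0) : (average R A).variance I = A.variance I / R := by
  rw [average, variance_bind_div, variance_sumList, List.map_const', List.sum_replicate,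
    List.length_range, nsmul_eq_mul, sq, mul_div_mul_left _ _ (Nat.cast_ne_zero.2 hR)]

theorem cost_average : (average R A).cost I = R * A.cost I := by
  rw [average, cost_bind_pure, cost_sumList, List.map_const', List.sum_replicate,
    List.length_range, nsmul_eq_mul]

end Average

section Thin

/-- With probability `p` run the program and divide its result by `p`; otherwise return `0`. -/
noncomputable def thin (p : Set.Ioc (0 : ℝ) 1) (A : Program n ℝ) : Program n ℝ :=
  .rand ⟨![(p : ℝ), 1 - p],
      by simp [Fin.forall_fin_two, p.2.1.le, p.2.2], by simp⟩
    ![A.bind fun x => pure (x / p), pure 0]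

variable (I : GraphInput n) (p : Set.Ioc (0 : ℝ) 1) (A : Program n ℝ)

theorem expect_thin (f : ℝ → ℕ → ℝ) :
    (thin p A).expect I f = p * (A.expect I fun x c => f (x / p) c) + (1 - p) * f 0 0 := by
  rw [thin, expect, Fin.sum_univ_two]
  exact congrArg (_ * · + _) (expect_bind I A _ _)

theorem mean_thin : (thin p A).mean I = A.mean I := by
  simp only [mean, expect_thin, div_eq_mul_inv, expect_mul_const, mul_zero, add_zero]
  exact mul_div_cancel₀ _ p.2.1.ne'

theorem secondMoment_thin : (thin p A).secondMoment I = A.secondMoment I / p := by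
  have hp := p.2.1.ne'
  simp only [secondMoment, expect_thin, div_eq_mul_inv, mul_pow, expect_mul_const]
  field_simp
  ring

theorem variance_thin :
    (thin p A).variance I = A.variance I / p + (1 / p - 1) * A.mean I ^ 2 := by
  rw [variance, variance, mean_thin, secondMoment_thin]
  ring

theorem cost_thin : (thin p A).cost I = p * A.cost I := by
  simp [cost, expect_thin]

end Thin

/-! ### Aborting -/

section Truncate

/-- Run a program, but stop with the result `d` when more than `b` queries would be made. -/
def truncate (d : α) : ℕ → Program n α → Program n α
  | _, .pure a => .pure a
  | 0, .ask _ _ => .pure d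
  | b + 1, .ask q next => .ask q fun x => truncate d b (next x)
  | b, .rand w next => .rand w fun i => truncate d b (next i)

variable (I : GraphInput n) (d : α) (b : ℕ) (A : Program n α)

theorem prob_truncate_le (P : α → ℕ → Prop) :
    (truncate d b A).prob I P ≤ A.prob I fun a c => P a c ∨ b < c := by
  induction A generalizing b P with
  | pure a => exact prob_mono I fun a c => Or.inl
  | ask q next ih =>
    cases b with
    | zero =>
      refine (prob_le_one I _).trans ?_
      simp [prob, expect, expect_const]
    | succ b =>
      simp only [truncate, prob_ask, Nat.add_lt_add_iff_right]
      exact ih (I.answer q) b fun a c => P a (c + 1)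
  | rand w next ih =>
    simp only [truncate, prob_rand]
    exact Finset.sum_le_sum fun i _ =>
      mul_le_mul_of_nonneg_left (ih i b P) (stdSimplex.zero_le w i)

theorem prob_truncate_le_of_not {P : α → Prop} (hd : ¬ P d) :
    ((truncate d b A).prob I fun a _ => P a) ≤ A.prob I fun a _ => P a := by
  induction A generalizing b with
  | pure a => simp only [truncate, le_refl]
  | ask q next ih =>
    cases b with
    | zero =>
      refine le_trans (le_of_eq ?_) (prob_nonneg I _)
      simp [truncate, prob, expect, hd]
    | succ b => exact ih (I.answer q) b
  | rand w next ih =>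
    simp only [truncate, prob_rand]
    exact Finset.sum_le_sum fun i _ => mul_le_mul_of_nonneg_left (ih i b) (stdSimplex.zero_le w i)

theorem prob_truncate_not_cost_le : ((truncate d b A).prob I fun _ c => ¬ c ≤ b) = 0 := by
  induction A generalizing b with
  | pure a => simp [truncate, prob, expect]
  | ask q next ih =>
    cases b with
    | zero => simp [truncate, prob, expect]
    | succ b => simpa only [truncate, prob_ask, Nat.add_le_add_iff_right] using ih (I.answer q) b
  | rand w next ih =>
    simp only [truncate, prob_rand]
    exact Finset.sum_eq_zero fun i _ => mul_eq_zero_of_right _ (ih i b)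

end Truncate

/-! ### Amplification by medians -/

section Replicate

/-- The results of `k` independent runs. -/
def replicate : ℕ → Program n α → Program n (List α)
  | 0, _ => pure []
  | k + 1, A => A.bind fun a => (replicate k A).bind fun l => pure (a :: l)

variable (I : GraphInput n) (k : ℕ) {A : Program n α}

theorem expect_replicate_prod (g : α → ℝ) :
    ((replicate k A).expect I fun l _ => (l.map g).prod) = (A.expect I fun a _ => g a) ^ k := by
  induction k with
  | zero => rfl
  | succ k ih =>
    simp only [replicate, expect_bind, expect, List.map_cons, List.prod_cons, expect_const_mul, ih,
      expect_mul_const]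
    ring

theorem prob_replicate_not_le {b : ℕ} (h : (A.prob I fun _ c => ¬ c ≤ b) ≤ 0) :
    ((replicate k A).prob I fun l c => ¬ (l.length = k ∧ c ≤ k * b)) ≤ 0 := by
  induction k with
  | zero => simp [replicate, prob, expect]
  | succ k ih =>
    rw [replicate, ← add_zero (0 : ℝ)]
    refine prob_bind_not_le I le_rfl h fun a c hc => ?_
    rw [prob_bind_pure]
    refine (prob_mono I fun l c' => mt fun ⟨hlen, hc'⟩ => ?_).trans ih
    rw [List.length_cons, hlen, Nat.succ_mul]
    exact ⟨rfl, (add_comm c c').trans_le (add_le_add hc' hc)⟩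

end Replicate

end Program

section Median

variable {α : Type*}

theorem pow_countP_eq_prod {M : Type*} [CommMonoid M] (r : M) (l : List α) (p : α → Bool) :
    r ^ l.countP p = (l.map fun x => if p x then r else 1).prod := by
  induction l with
  | nil => exact pow_zero r
  | cons x l ih => by_cases hx : p x <;> simp [hx, ← ih, pow_succ']

/-- A median of a list. -/
noncomputable def median [LinearOrder α] [Inhabited α] (l : List α) : α :=
  (l.insertionSort (· ≤ ·))[l.length / 2]?.getD default

open Classical in
theorem length_le_two_mul_countP_of_sortedLE [LinearOrder α] {S : Set α} (hS : S.OrdConnected)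
    {l : List α} (hl : l.Pairwise (· ≤ ·)) (h : l.length / 2 < l.length)
    (hmid : l[l.length / 2] ∉ S) : l.length ≤ 2 * l.countP (· ∉ S) := by
  have hsplit (k : ℕ) : l.countP (· ∉ S) =
      (l.take k).countP (· ∉ S) + (l.drop k).countP (· ∉ S) := by
    rw [← List.countP_append, List.take_append_drop]
  have hside : (∀ y ∈ l.take (l.length / 2 + 1), y ∉ S) ∨ ∀ y ∈ l.drop (l.length / 2), y ∉ S := by
    by_contra! hcon
    obtain ⟨⟨y, hy, hyS⟩, z, hz, hzS⟩ := hcon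
    obtain ⟨i, hi, rfl⟩ := List.mem_take_iff_getElem.1 hy
    obtain ⟨j, hj, rfl⟩ := List.mem_drop_iff_getElem.1 hz
    refine hmid (hS.out hyS hzS ⟨?_, ?_⟩)
    · exact hl.rel_get_of_le (a := ⟨i, by omega⟩) (b := ⟨_, h⟩) (Fin.mk_le_mk.2 (by omega))
    · exact hl.rel_get_of_le (a := ⟨_, h⟩) (b := ⟨_, by omega⟩) (Fin.mk_le_mk.2 (by omega))
  rcases hside with hside | hside
  · have hcount := List.countP_eq_length.2 fun y hy => decide_eq_true (hside y hy)
    have := hsplit (l.length / 2 + 1)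
    rw [List.length_take] at hcount
    omega
  · have hcount := List.countP_eq_length.2 fun y hy => decide_eq_true (hside y hy)
    have := hsplit (l.length / 2)
    rw [List.length_drop] at hcount
    omega

open Classical in
theorem median_mem [LinearOrder α] [Inhabited α] {S : Set α} (hS : S.OrdConnected) {l : List α}
    (hl : 2 * l.countP (· ∉ S) < l.length) : median l ∈ S := by
  by_contra hx
  have hperm : (l.insertionSort (· ≤ ·)).Perm l := List.perm_insertionSort _ l
  have hlt : l.length / 2 < (l.insertionSort (· ≤ ·)).length := by
    rw [hperm.length_eq]
    omega
  rw [median, List.getElem?_eq_getElem hlt, Option.getD_some] at hx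
  simp only [← hperm.length_eq] at hlt hx
  have := length_le_two_mul_countP_of_sortedLE hS (List.pairwise_insertionSort _ l) hlt hx
  rw [hperm.length_eq, hperm.countP_eq] at this
  omega

end Median

namespace Program

variable {n : ℕ} {α : Type}

section MedianOfRuns

/-- The median of the results of `k` independent runs. -/
noncomputable def medianOfRuns [LinearOrder α] [Inhabited α] (k : ℕ) (A : Program n α) :
    Program n α :=
  (replicate k A).bind fun l => pure (median l)

variable (I : GraphInput n) {k b : ℕ} {A : Program n α} {S : Set α}

open Classical in
theorem prob_replicate_half_le (h : (A.prob I fun x _ => x ∉ S) ≤ 1 / 16) :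
    ((replicate k A).prob I fun l _ => k ≤ 2 * l.countP (· ∉ S)) ≤ (1 / 2) ^ k := by
  have hmean : (A.expect I fun x _ => if x ∉ S then (16 : ℝ) else 1) ≤ 2 := by
    have split_ite (x : α) :
        (if x ∉ S then (16 : ℝ) else 1) = 15 * (if x ∉ S then 1 else 0) + 1 := by
      split_ifs <;> norm_num
    simp only [split_ite]
    rw [expect_add, expect_const_mul, expect_const, expect_ite]
    linarith
  calc _ ≤ ((replicate k A).expect I fun l _ => (16 : ℝ) ^ l.countP (· ∉ S)) / 4 ^ k := by
        refine prob_le_expect_div I (fun l _ => by positivity) (by positivity) fun l _ hl => ?_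
        rw [show (16 : ℝ) = 4 ^ 2 by norm_num, ← pow_mul]
        exact pow_le_pow_right₀ (by norm_num) hl
    _ ≤ 2 ^ k / 4 ^ k := by
        simp only [pow_countP_eq_prod, expect_replicate_prod, decide_eq_true_eq]
        gcongr
        exact expect_nonneg I fun x _ => by split_ifs <;> norm_num
    _ = (1 / 2) ^ k := by rw [← div_pow]; norm_num

theorem prob_medianOfRuns_not_le [LinearOrder α] [Inhabited α]
    (hc : (A.prob I fun _ c => ¬ c ≤ b) ≤ 0) (hS : S.OrdConnected)
    (h : (A.prob I fun x _ => x ∉ S) ≤ 1 / 16) :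
    ((medianOfRuns k A).prob I fun x c => ¬ (x ∈ S ∧ c ≤ k * b)) ≤ (1 / 2) ^ k := by
  classical
  rw [medianOfRuns, prob_bind_pure]
  calc _ ≤ (replicate k A).prob I fun l c => k ≤ 2 * l.countP (· ∉ S) ∨
        ¬ (l.length = k ∧ c ≤ k * b) := prob_mono I fun l c => by
          contrapose!
          rintro ⟨hcount, hlen, hc⟩
          exact ⟨median_mem hS (by rwa [hlen]), hc⟩
    _ ≤ (1 / 2) ^ k + 0 := (prob_or_le I _ _).trans
          (add_le_add (prob_replicate_half_le I h) (prob_replicate_not_le I k hc))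
    _ = _ := add_zero _

end MedianOfRuns

end Program

/-! ### Degrees and rooted triangles -/

namespace GraphInput

variable {n : ℕ} (I : GraphInput n)

section Degree

/-- The degree of a vertex, read off its neighbour list. -/
def deg (v : Fin n) : ℕ := (I.nbrs v).length

/-- The sorting key of a vertex `v` of degree `d`: vertices are compared by degree, ties being
broken by the label. -/
def key (d : ℕ) (v : Fin n) : ℕ ×ₗ Fin n := toLex (d, v)

/-- `x` comes before `y` in the order by degrees. -/
def Below (x y : Fin n) : Prop := key (I.deg x) x < key (I.deg y) y

variable {I} in
theorem Below.asymm {x y : Fin n} (h : I.Below x y) : ¬ I.Below y x := lt_asymm h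

variable {I} in
theorem Below.deg_le {x y : Fin n} (h : I.Below x y) : I.deg x ≤ I.deg y := by
  rcases Prod.Lex.lt_iff.1 h with h | h
  · exact h.le
  · exact h.1.le

theorem below_or_below {x y : Fin n} (h : x ≠ y) : I.Below x y ∨ I.Below y x :=
  lt_or_gt_of_ne fun hk => h (congrArg (fun k => (ofLex k).2) hk)

open Classical in
theorem sum_map_nbrs (v : Fin n) (f : Fin n → ℝ) :
    ((I.nbrs v).map f).sum = ∑ u, if I.graph.Adj v u then f u else 0 := by
  rw [← List.sum_toFinset f (I.nodup_nbrs v), ← Finset.sum_filter]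
  congr 1
  ext u
  simp [I.mem_nbrs]

open Classical in
theorem deg_eq_sum (v : Fin n) : (I.deg v : ℝ) = ∑ u, if I.graph.Adj v u then 1 else 0 := by
  rw [← sum_map_nbrs]
  simp [deg]

theorem deg_le (v : Fin n) : I.deg v ≤ n := by
  simpa [deg] using (I.nodup_nbrs v).length_le_card

theorem sum_deg : ∑ v, (I.deg v : ℝ) = 2 * (numEdges I.graph : ℝ) := by
  classical
  have hdeg (v : Fin n) : I.deg v = I.graph.degree v := I.length_nbrs v
  have hedges : numEdges I.graph = I.graph.edgeFinset.card := by
    rw [numEdges, ← SimpleGraph.coe_edgeFinset, Set.ncard_coe_finset]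
  simp only [hdeg, hedges]
  exact_mod_cast I.graph.sum_degrees_eq_twice_card_edges

open Classical in
theorem sum_min_deg_le (v : Fin n) :
    (∑ u, if I.graph.Adj v u then min (I.deg v : ℝ) (I.deg u) else 0) ≤
      I.deg v * √(2 * (numEdges I.graph : ℝ)) := by
  rcases le_total (I.deg v : ℝ) √(2 * (numEdges I.graph : ℝ)) with h | h
  · calc _ ≤ ∑ u, (if I.graph.Adj v u then (1 : ℝ) else 0) * I.deg v :=
          Finset.sum_le_sum fun u _ => by split_ifs <;> simp
      _ = I.deg v * I.deg v := by rw [← Finset.sum_mul, ← deg_eq_sum]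
      _ ≤ _ := by gcongr
  · calc _ ≤ ∑ u, (I.deg u : ℝ) := Finset.sum_le_sum fun u _ => by split_ifs <;> simp
      _ = √(2 * (numEdges I.graph : ℝ)) * √(2 * (numEdges I.graph : ℝ)) := by
          rw [sum_deg, Real.mul_self_sqrt (by positivity)]
      _ ≤ _ := by gcongr

end Degree

section DegUp

open Classical in
/-- The number of neighbours that come later in the order by degrees. -/
noncomputable def degUp (x : Fin n) : ℝ :=
  ∑ w, if I.graph.Adj x w ∧ I.Below x w then 1 else 0

theorem degUp_nonneg (x : Fin n) : 0 ≤ I.degUp x :=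
  Finset.sum_nonneg fun _ _ => by split_ifs <;> norm_num

theorem degUp_le_deg (x : Fin n) : I.degUp x ≤ I.deg x := by
  classical
  rw [deg_eq_sum]
  refine Finset.sum_le_sum fun w _ => ?_
  by_cases h : I.graph.Adj x w <;> by_cases h' : I.Below x w <;> simp [h, h']

/-- Each of the later neighbours has degree at least `degUp x`. -/
theorem degUp_sq_le (x : Fin n) : I.degUp x ^ 2 ≤ 2 * (numEdges I.graph : ℝ) := by
  classical
  calc I.degUp x ^ 2
      = ∑ w, (if I.graph.Adj x w ∧ I.Below x w then 1 else 0) * I.degUp x := by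
        rw [sq, ← Finset.sum_mul, ← degUp]
    _ ≤ ∑ w, (I.deg w : ℝ) := Finset.sum_le_sum fun w _ => by
        split_ifs with h
        · rw [one_mul]
          exact (I.degUp_le_deg x).trans (Nat.cast_le.2 h.2.deg_le)
        · rw [zero_mul]
          positivity
    _ = 2 * (numEdges I.graph : ℝ) := I.sum_deg

theorem degUp_le_sqrt (x : Fin n) : I.degUp x ≤ √(2 * (numEdges I.graph : ℝ)) :=
  Real.le_sqrt_of_sq_le (I.degUp_sq_le x)

theorem sum_degUp : ∑ x, I.degUp x = (numEdges I.graph : ℝ) := by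
  classical
  have hswap : ∑ x, I.degUp x =
      ∑ x, ∑ w, if I.graph.Adj w x ∧ I.Below w x then (1 : ℝ) else 0 := Finset.sum_comm
  have htwice : ∑ x, I.degUp x + ∑ x, I.degUp x = 2 * (numEdges I.graph : ℝ) := by
    nth_rw 2 [hswap]
    simp only [← sum_deg, deg_eq_sum, degUp, ← Finset.sum_add_distrib]
    refine Finset.sum_congr rfl fun x _ => Finset.sum_congr rfl fun w _ => ?_
    by_cases h : I.graph.Adj x w
    · rcases I.below_or_below h.ne with hb | hb <;> simp [h, hb, hb.asymm, h.symm]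
    · simp [h, I.graph.adj_comm w x]
  linarith

end DegUp

section RootedTriangle

/-- `x y w` is a triangle whose first vertex in the order by degrees is `x`. Every triangle is
represented by exactly two such triples, which makes it possible to count triangles locally. -/
def IsRootedTriangle (x y w : Fin n) : Prop :=
  I.graph.Adj x y ∧ I.graph.Adj x w ∧ I.graph.Adj y w ∧ I.Below x y ∧ I.Below x w

theorem isRootedTriangle_comm {x y w : Fin n} :
    I.IsRootedTriangle x y w ↔ I.IsRootedTriangle x w y := by
  unfold IsRootedTriangle
  rw [I.graph.adj_comm y w]
  tauto

theorem exists_isRootedTriangle {s : Finset (Fin n)} (hs : I.graph.IsNClique 3 s) :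
    ∃ a b c, I.IsRootedTriangle a b c ∧ s = {a, b, c} := by
  obtain ⟨a, b, c, hab, hac, hbc, rfl⟩ := SimpleGraph.is3Clique_iff.1 hs
  rcases I.below_or_below hab.ne with h1 | h1 <;> rcases I.below_or_below hac.ne with h2 | h2 <;>
    rcases I.below_or_below hbc.ne with h3 | h3
  · exact ⟨a, b, c, ⟨hab, hac, hbc, h1, h2⟩, rfl⟩
  · exact ⟨a, b, c, ⟨hab, hac, hbc, h1, h2⟩, rfl⟩
  · exact absurd (lt_trans h1 h3) h2.asymm
  · exact ⟨c, a, b, ⟨hac.symm, hbc.symm, hab, h2, h3⟩, by ext; simp; tauto⟩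
  · exact ⟨b, a, c, ⟨hab.symm, hbc, hac, h1, h3⟩, by ext; simp; tauto⟩
  · exact absurd (lt_trans h2 h3) h1.asymm
  · exact ⟨b, a, c, ⟨hab.symm, hbc, hac, h1, h3⟩, by ext; simp; tauto⟩
  · exact ⟨c, a, b, ⟨hac.symm, hbc.symm, hab, h2, h3⟩, by ext; simp; tauto⟩

open Classical in
/-- The triples that represent a triangle. -/
noncomputable def rootedTriangles : Finset (Fin n × Fin n × Fin n) :=
  Finset.univ.filter fun z => I.IsRootedTriangle z.1 z.2.1 z.2.2

theorem mem_rootedTriangles {z : Fin n × Fin n × Fin n} :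
    z ∈ I.rootedTriangles ↔ I.IsRootedTriangle z.1 z.2.1 z.2.2 := by
  simp only [rootedTriangles, Finset.mem_filter, Finset.mem_univ, true_and]

variable {I} in
theorem IsRootedTriangle.root_eq {a b c x y w : Fin n} (habc : I.IsRootedTriangle a b c)
    (hxyw : I.IsRootedTriangle x y w) (h : ({x, y, w} : Finset (Fin n)) = {a, b, c}) : x = a := by
  have ha : a ∈ ({x, y, w} : Finset (Fin n)) := h ▸ Finset.mem_insert_self _ _
  have hx : x ∈ ({a, b, c} : Finset (Fin n)) := h ▸ Finset.mem_insert_self _ _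
  simp only [Finset.mem_insert, Finset.mem_singleton] at ha hx
  by_contra hne
  have hxa : I.Below x a := by
    rcases ha with rfl | rfl | rfl
    exacts [absurd rfl hne, hxyw.2.2.2.1, hxyw.2.2.2.2]
  have hax : I.Below a x := by
    rcases hx with rfl | rfl | rfl
    exacts [absurd rfl hne, habc.2.2.2.1, habc.2.2.2.2]
  exact hxa.asymm hax

open Classical in
variable {I} in
theorem IsRootedTriangle.filter_rootedTriangles_eq {a b c : Fin n}
    (habc : I.IsRootedTriangle a b c) :
    (I.rootedTriangles.filter fun z => ({z.1, z.2.1, z.2.2} : Finset (Fin n)) = {a, b, c}) =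
      {(a, b, c), (a, c, b)} := by
  ext ⟨x, y, w⟩
  simp only [Finset.mem_filter, mem_rootedTriangles, Finset.mem_insert, Finset.mem_singleton,
    Prod.mk.injEq]
  constructor
  · rintro ⟨hxyw, h⟩
    obtain rfl := habc.root_eq hxyw h
    have hb : b ∈ ({x, y, w} : Finset (Fin n)) := h ▸ by simp
    have hc : c ∈ ({x, y, w} : Finset (Fin n)) := h ▸ by simp
    have hbc := habc.2.2.1.ne
    have hxb := habc.1.ne
    have hxc := habc.2.1.ne
    simp only [Finset.mem_insert, Finset.mem_singleton] at hb hc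
    grind
  · rintro (⟨rfl, rfl, rfl⟩ | ⟨rfl, rfl, rfl⟩)
    · exact ⟨habc, rfl⟩
    · exact ⟨I.isRootedTriangle_comm.1 habc, by rw [Finset.pair_comm]⟩

theorem card_rootedTriangles : I.rootedTriangles.card = 2 * numTriangles I.graph := by
  classical
  have hcliques : numTriangles I.graph = (I.graph.cliqueFinset 3).card := by
    rw [numTriangles, ← SimpleGraph.coe_cliqueFinset, Set.ncard_coe_finset]
  have hmaps : ∀ z ∈ I.rootedTriangles,
      ({z.1, z.2.1, z.2.2} : Finset (Fin n)) ∈ I.graph.cliqueFinset 3 := fun z hz => by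
    obtain ⟨h1, h2, h3, -, -⟩ := I.mem_rootedTriangles.1 hz
    rw [SimpleGraph.mem_cliqueFinset_iff]
    exact SimpleGraph.is3Clique_triple_iff.2 ⟨h1, h2, h3⟩
  rw [Finset.card_eq_sum_card_fiberwise hmaps, hcliques, mul_comm]
  refine Finset.sum_const_nat fun s hs => ?_
  obtain ⟨a, b, c, habc, rfl⟩ :=
    I.exists_isRootedTriangle (SimpleGraph.mem_cliqueFinset_iff.1 hs)
  rw [habc.filter_rootedTriangles_eq, Finset.card_pair]
  simp [habc.2.2.1.ne]

open Classical in
theorem sum_isRootedTriangle : (∑ x, ∑ y, ∑ w, if I.IsRootedTriangle x y w then (1 : ℝ) else 0) =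
    2 * (numTriangles I.graph : ℝ) := by
  rw [← Nat.cast_two, ← Nat.cast_mul, ← card_rootedTriangles, rootedTriangles, Finset.card_filter]
  push_cast
  simp only [Fintype.sum_prod_type]

theorem two_mul_numTriangles_le : 2 * (numTriangles I.graph : ℝ) ≤
    (numEdges I.graph : ℝ) * √(2 * (numEdges I.graph : ℝ)) := by
  classical
  calc 2 * (numTriangles I.graph : ℝ)
      = ∑ x, ∑ y, ∑ w, if I.IsRootedTriangle x y w then (1 : ℝ) else 0 :=
        I.sum_isRootedTriangle.symm
    _ ≤ ∑ x, I.degUp x * I.degUp x := Finset.sum_le_sum fun x _ => by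
        simp only [degUp, Finset.sum_mul_sum]
        gcongr with y _ w _
        by_cases h : I.IsRootedTriangle x y w
        · simp [h, h.1, h.2.1, h.2.2.2.1, h.2.2.2.2]
        · rw [if_neg h]
          positivity
    _ ≤ ∑ x, I.degUp x * √(2 * (numEdges I.graph : ℝ)) := by
        gcongr with x
        exacts [I.degUp_nonneg x, I.degUp_le_sqrt x]
    _ = _ := by rw [← Finset.sum_mul, sum_degUp]

theorem numEdges_pos (h : 0 < numTriangles I.graph) : 0 < numEdges I.graph := by
  by_contra! hzero
  have := I.two_mul_numTriangles_le
  rw [Nat.le_zero.1 hzero, Nat.cast_zero, zero_mul] at this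
  have : (0 : ℝ) < numTriangles I.graph := Nat.cast_pos.2 h
  linarith

theorem numTriangles_le : (numTriangles I.graph : ℝ) ≤ (n : ℝ) ^ 3 := by
  classical
  calc (numTriangles I.graph : ℝ) ≤ 2 * (numTriangles I.graph : ℝ) :=
        le_mul_of_one_le_left (Nat.cast_nonneg _) one_le_two
    _ ≤ ∑ x : Fin n, ∑ y : Fin n, ∑ w : Fin n, 1 := by
        rw [← sum_isRootedTriangle]
        gcongr
        split_ifs <;> norm_num
    _ = (n : ℝ) ^ 3 := by
        simp only [Finset.sum_const, Finset.card_univ, Fintype.card_fin, nsmul_eq_mul]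
        ring

end RootedTriangle

end GraphInput

/-! ### Edge-neighbouring graphs -/

section EdgeNeighboring

variable {n : ℕ} {G₁ G₂ : SimpleGraph (Fin n)}

theorem EdgeNeighboring.symm (h : EdgeNeighboring G₁ G₂) : EdgeNeighboring G₂ G₁ :=
  h.imp fun _ he => he.symm

theorem cliqueSet_three_subset {a b : Fin n}
    (h : G₁.edgeSet \ {s(a, b)} = G₂.edgeSet \ {s(a, b)}) :
    G₁.cliqueSet 3 ⊆ G₂.cliqueSet 3 ∪ Set.range fun w => ({a, b, w} : Finset (Fin n)) := by
  intro s hs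
  by_cases hmem : a ∈ s ∧ b ∈ s ∧ a ≠ b
  · obtain ⟨ha, hb, hab⟩ := hmem
    have hb' : b ∈ s.erase a := Finset.mem_erase.2 ⟨hab.symm, hb⟩
    have hcard : ((s.erase a).erase b).card = 1 := by
      rw [Finset.card_erase_of_mem hb', Finset.card_erase_of_mem ha, hs.card_eq]
    obtain ⟨w, hw⟩ := Finset.card_eq_one.1 hcard
    refine Or.inr ⟨w, ?_⟩
    change insert a (insert b {w}) = s
    rw [← hw, Finset.insert_erase hb', Finset.insert_erase ha]
  · refine Or.inl ⟨fun x hx y hy hxy => ?_, hs.card_eq⟩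
    have hne : s(x, y) ≠ s(a, b) := fun heq => hmem <| by
      rcases Sym2.eq_iff.1 heq with ⟨rfl, rfl⟩ | ⟨rfl, rfl⟩
      exacts [⟨hx, hy, hxy⟩, ⟨hy, hx, hxy.symm⟩]
    have : s(x, y) ∈ G₂.edgeSet \ {s(a, b)} := h ▸ ⟨hs.isClique hx hy hxy, hne⟩
    exact this.1

theorem numTriangles_le_add (h : EdgeNeighboring G₁ G₂) :
    numTriangles G₁ ≤ numTriangles G₂ + n := by
  obtain ⟨e, he⟩ := h
  induction e with | h a b => ?_
  calc numTriangles G₁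
      ≤ (G₂.cliqueSet 3 ∪ Set.range fun w => ({a, b, w} : Finset (Fin n))).ncard :=
        Set.ncard_le_ncard (cliqueSet_three_subset he) (Set.toFinite _)
    _ ≤ numTriangles G₂ + (Set.range fun w => ({a, b, w} : Finset (Fin n))).ncard :=
        Set.ncard_union_le _ _
    _ ≤ numTriangles G₂ + n := by
        gcongr
        rw [← Set.image_univ]
        refine (Set.ncard_image_le (Set.toFinite _)).trans ?_
        simp [Set.ncard_univ]

end EdgeNeighboring

namespace Program

variable {n : ℕ}

/-! ### Queries -/

section Queries

variable {α : Type} (I : GraphInput n)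

/-- Ask for a degree. -/
def askDeg (v : Fin n) (next : ℕ → Program n α) : Program n α := .ask (.degree v) next

/-- Ask for a neighbour. -/
def askNbr (v i : Fin n) (next : Option (Fin n) → Program n α) : Program n α :=
  .ask (.neighbor v i) next

/-- Ask whether a pair is an edge. -/
def askPair (u v : Fin n) (next : Bool → Program n α) : Program n α := .ask (.pair u v) next

theorem expect_askDeg (v : Fin n) (next : ℕ → Program n α) (f : α → ℕ → ℝ) :
    (askDeg v next).expect I f = (next (I.deg v)).expect I fun a c => f a (c + 1) := rfl

theorem mean_askDeg (v : Fin n) (next : ℕ → Program n ℝ) :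
    (askDeg v next).mean I = (next (I.deg v)).mean I := rfl

theorem variance_askDeg (v : Fin n) (next : ℕ → Program n ℝ) :
    (askDeg v next).variance I = (next (I.deg v)).variance I := rfl

theorem cost_askDeg (v : Fin n) (next : ℕ → Program n α) :
    (askDeg v next).cost I = 1 + (next (I.deg v)).cost I := cost_ask I (.degree v) next

theorem mean_askNbr (v i : Fin n) (next : Option (Fin n) → Program n ℝ) :
    (askNbr v i next).mean I = (next (I.nbrs v)[(i : ℕ)]?).mean I := rfl

theorem variance_askNbr (v i : Fin n) (next : Option (Fin n) → Program n ℝ) :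
    (askNbr v i next).variance I = (next (I.nbrs v)[(i : ℕ)]?).variance I := rfl

theorem cost_askNbr (v i : Fin n) (next : Option (Fin n) → Program n α) :
    (askNbr v i next).cost I = 1 + (next (I.nbrs v)[(i : ℕ)]?).cost I :=
  cost_ask I (.neighbor v i) next

open Classical in
theorem expect_askPair (u v : Fin n) (next : Bool → Program n α) (f : α → ℕ → ℝ) :
    (askPair u v next).expect I f =
      (next (decide (I.graph.Adj u v))).expect I fun a c => f a (c + 1) := rfl

end Queries

/-! ### Scanning the neighbours of a vertex -/

section ForNbrs

/-- Go through the neighbours of `v`, a vertex of degree `d`, keep each of them independently with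
probability `p`, and add up the results of `body`, divided by `p`. -/
noncomputable def forNbrs (v : Fin n) (d : ℕ) (p : Set.Ioc (0 : ℝ) 1)
    (body : Fin n → Program n ℝ) : Program n ℝ :=
  sumList (List.range d) fun i => thin p <|
    if h : i < n then
      askNbr v ⟨i, h⟩ fun o => o.elim (pure 0) body
    else pure 0

variable (I : GraphInput n) (v : Fin n)

theorem map_range_deg {φ : ℕ → ℝ} {ψ : Fin n → ℝ}
    (h : ∀ (i : ℕ) (hi : i < (I.nbrs v).length), φ i = ψ (I.nbrs v)[i]) :
    (List.range (I.deg v)).map φ = (I.nbrs v).map ψ := by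
  refine List.ext_getElem (by simp [GraphInput.deg]) fun i h1 h2 => ?_
  simp only [List.getElem_map, List.getElem_range]
  exact h i (by simpa using h2)

variable (p : Set.Ioc (0 : ℝ) 1) (body : Fin n → Program n ℝ)

open Classical in
theorem mean_forNbrs : (forNbrs v (I.deg v) p body).mean I =
    ∑ u, if I.graph.Adj v u then (body u).mean I else 0 := by
  rw [forNbrs, mean_sumList, ← I.sum_map_nbrs, map_range_deg]
  intro i hi
  rw [mean_thin, dif_pos (hi.trans_le (I.deg_le v)), mean_askNbr, List.getElem?_eq_getElem hi,
    Option.elim_some]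

open Classical in
theorem variance_forNbrs : (forNbrs v (I.deg v) p body).variance I =
    ∑ u, if I.graph.Adj v u then (thin p (body u)).variance I else 0 := by
  rw [forNbrs, variance_sumList, ← I.sum_map_nbrs, map_range_deg]
  intro i hi
  rw [variance_thin, variance_thin, dif_pos (hi.trans_le (I.deg_le v)), mean_askNbr,
    variance_askNbr, List.getElem?_eq_getElem hi, Option.elim_some]

open Classical in
theorem cost_forNbrs : (forNbrs v (I.deg v) p body).cost I =
    ∑ u, if I.graph.Adj v u then p * (1 + (body u).cost I) else 0 := by
  rw [forNbrs, cost_sumList, ← I.sum_map_nbrs, map_range_deg]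
  intro i hi
  rw [cost_thin, dif_pos (hi.trans_le (I.deg_le v)), cost_askNbr, List.getElem?_eq_getElem hi,
    Option.elim_some]

end ForNbrs

/-! ### Sums over triangles -/

section RootedSum

open Classical in
/-- The sum of `F` over the triangles `x y w` whose first vertex is `x`. -/
noncomputable def rootedSum (I : GraphInput n) (F : Fin n → Fin n → Fin n → ℝ) (x y : Fin n) : ℝ :=
  ∑ w, if I.IsRootedTriangle x y w then F x y w else 0

/-- The sum of `F` over the triangles that contain the edge `v u` and the first vertex of which
is `v` or `u`. -/
noncomputable def edgeSum (I : GraphInput n) (F : Fin n → Fin n → Fin n → ℝ) (v u : Fin n) : ℝ :=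
  rootedSum I F v u + rootedSum I F u v

variable (I : GraphInput n) {F G : Fin n → Fin n → Fin n → ℝ} (x y : Fin n)

theorem rootedSum_nonneg (hF : ∀ x y w, 0 ≤ F x y w) : 0 ≤ rootedSum I F x y :=
  Finset.sum_nonneg fun w _ => by split_ifs; exacts [hF x y w, le_rfl]

theorem edgeSum_nonneg (hF : ∀ x y w, 0 ≤ F x y w) : 0 ≤ edgeSum I F x y :=
  add_nonneg (rootedSum_nonneg I x y hF) (rootedSum_nonneg I y x hF)

theorem rootedSum_mono (h : ∀ x y w, F x y w ≤ G x y w) : rootedSum I F x y ≤ rootedSum I G x y :=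
  Finset.sum_le_sum fun w _ => by split_ifs; exacts [h x y w, le_rfl]

theorem rootedSum_le_sqrt (hF : ∀ x y w, F x y w ≤ 1) :
    rootedSum I F x y ≤ √(2 * (numEdges I.graph : ℝ)) := by
  classical
  refine le_trans (Finset.sum_le_sum fun w _ => ?_) (I.degUp_le_sqrt x)
  by_cases h : I.IsRootedTriangle x y w
  · simpa [h, h.2.1, h.2.2.2.2] using hF x y w
  · rw [if_neg h]
    positivity

variable (F) {x y}

theorem rootedSum_eq_zero (h : ¬ (I.graph.Adj x y ∧ I.Below x y)) : rootedSum I F x y = 0 :=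
  Finset.sum_eq_zero fun w _ => by rw [if_neg fun h' => h ⟨h'.1, h'.2.2.2.1⟩]

theorem edgeSum_eq_zero (h : ¬ I.graph.Adj x y) : edgeSum I F x y = 0 := by
  rw [edgeSum, rootedSum_eq_zero I F fun h' => h h'.1,
    rootedSum_eq_zero I F fun h' => h h'.1.symm, add_zero]

theorem edgeSum_of_below (h : I.Below x y) : edgeSum I F x y = rootedSum I F x y := by
  rw [edgeSum, rootedSum_eq_zero I F fun h' => h.asymm h'.2, add_zero]

theorem edgeSum_comm : edgeSum I F x y = edgeSum I F y x := add_comm _ _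

end RootedSum

/-! ### Sampling triangles at a vertex -/

section Probe

/-- Run `act x y w` if `x y w` is a triangle whose first vertex is `x`, a neighbour of `y` and `w`
of degree `d` that comes before `y`; otherwise return `0`. -/
def probe (act : Fin n → Fin n → Fin n → Program n ℝ) (x : Fin n) (d : ℕ) (y w : Fin n) :
    Program n ℝ :=
  askPair w y fun b =>
    if b then askDeg w fun dw =>
      if GraphInput.key d x < GraphInput.key dw w then act x y w else pure 0
    else pure 0

variable (I : GraphInput n) (act : Fin n → Fin n → Fin n → Program n ℝ) {x y w : Fin n}

theorem expect_probe_of_isRootedTriangle (h : I.IsRootedTriangle x y w) (f : ℝ → ℕ → ℝ) :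
    (probe act x (I.deg x) y w).expect I f = (act x y w).expect I fun a c => f a (c + 2) := by
  classical
  rw [probe, expect_askPair, decide_eq_true h.2.2.1.symm, if_pos rfl, expect_askDeg]
  exact congrArg (Program.expect I · _) (if_pos h.2.2.2.2)

theorem exists_expect_probe_eq (hxy : I.graph.Adj x y) (hb : I.Below x y) (hw : I.graph.Adj x w)
    (h : ¬ I.IsRootedTriangle x y w) :
    ∃ c ≤ 2, ∀ f : ℝ → ℕ → ℝ, (probe act x (I.deg x) y w).expect I f = f 0 c := by
  classical
  by_cases hwy : I.graph.Adj w y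
  · refine ⟨2, le_rfl, fun f => ?_⟩
    rw [probe, expect_askPair, decide_eq_true hwy, if_pos rfl, expect_askDeg]
    exact congrArg (Program.expect I · _) (if_neg fun hbw => h ⟨hxy, hw, hwy.symm, hb, hbw⟩)
  · refine ⟨1, one_le_two, fun f => ?_⟩
    rw [probe, expect_askPair, decide_eq_false hwy, if_neg Bool.false_ne_true]
    rfl

open Classical in
theorem mean_probe (hxy : I.graph.Adj x y) (hb : I.Below x y) (hw : I.graph.Adj x w) :
    (probe act x (I.deg x) y w).mean I =
      if I.IsRootedTriangle x y w then (act x y w).mean I else 0 := by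
  split_ifs with h
  · exact expect_probe_of_isRootedTriangle I act h _
  · obtain ⟨c, -, hc⟩ := exists_expect_probe_eq I act hxy hb hw h
    exact hc _

open Classical in
theorem variance_thin_probe (r : Set.Ioc (0 : ℝ) 1) (hxy : I.graph.Adj x y) (hb : I.Below x y)
    (hw : I.graph.Adj x w) : (thin r (probe act x (I.deg x) y w)).variance I =
      if I.IsRootedTriangle x y w then (thin r (act x y w)).variance I else 0 := by
  rw [variance_thin, variance_thin, mean_probe I act hxy hb hw, variance, secondMoment,
    mean_probe I act hxy hb hw]
  split_ifs with h
  · rw [expect_probe_of_isRootedTriangle I act h, variance, secondMoment]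
  · obtain ⟨c, -, hc⟩ := exists_expect_probe_eq I act hxy hb hw h
    rw [hc]
    ring

open Classical in
theorem cost_probe_le (hxy : I.graph.Adj x y) (hb : I.Below x y) (hw : I.graph.Adj x w) :
    (probe act x (I.deg x) y w).cost I ≤
      2 + if I.IsRootedTriangle x y w then (act x y w).cost I else 0 := by
  split_ifs with h
  · rw [cost, expect_probe_of_isRootedTriangle I act h]
    simp only [Nat.cast_add, expect_add, expect_const, cost, Nat.cast_ofNat, add_comm, le_refl]
  · obtain ⟨c, hc, he⟩ := exists_expect_probe_eq I act hxy hb hw h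
    rw [cost, he, add_zero]
    exact_mod_cast hc

end Probe

section RootedScan

/-- Sample the triangles `x y w` whose first vertex is `x`, and run `act` on the sample. -/
noncomputable def rootedScan (r : Set.Ioc (0 : ℝ) 1) (act : Fin n → Fin n → Fin n → Program n ℝ)
    (x : Fin n) (d : ℕ) (y : Fin n) : Program n ℝ :=
  forNbrs x d r (probe act x d y)

variable (I : GraphInput n) (act : Fin n → Fin n → Fin n → Program n ℝ) (r : Set.Ioc (0 : ℝ) 1)
  {x y : Fin n} (hxy : I.graph.Adj x y) (hb : I.Below x y)

include hxy hb in
theorem mean_rootedScan : (rootedScan r act x (I.deg x) y).mean I =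
    rootedSum I (fun x y w => (act x y w).mean I) x y := by
  classical
  rw [rootedScan, mean_forNbrs, rootedSum]
  refine Finset.sum_congr rfl fun w _ => ?_
  by_cases hw : I.graph.Adj x w
  · rw [if_pos hw, mean_probe I act hxy hb hw]
  · rw [if_neg hw, if_neg fun h => hw h.2.1]

include hxy hb in
theorem variance_rootedScan_le {K : ℝ}
    (hK : ∀ x y w, (thin r (act x y w)).variance I ≤ K * (act x y w).mean I) :
    (rootedScan r act x (I.deg x) y).variance I ≤
      K * rootedSum I (fun x y w => (act x y w).mean I) x y := by
  classical
  rw [rootedScan, variance_forNbrs, rootedSum, Finset.mul_sum]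
  refine Finset.sum_le_sum fun w _ => ?_
  by_cases hw : I.graph.Adj x w
  · rw [if_pos hw, variance_thin_probe I act r hxy hb hw, mul_ite, mul_zero]
    split_ifs
    exacts [hK x y w, le_rfl]
  · rw [if_neg hw, if_neg fun h => hw h.2.1, mul_zero]

include hxy hb in
theorem cost_rootedScan_le {κ : ℝ} (hκ : ∀ x y w, (act x y w).cost I ≤ κ) :
    (rootedScan r act x (I.deg x) y).cost I ≤
      3 * r * I.deg x + r * κ * rootedSum I (fun _ _ _ => 1) x y := by
  classical
  have hr := r.2.1.le
  rw [rootedScan, cost_forNbrs, rootedSum, Finset.mul_sum, I.deg_eq_sum, Finset.mul_sum,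
    ← Finset.sum_add_distrib]
  refine Finset.sum_le_sum fun w _ => ?_
  by_cases hw : I.graph.Adj x w
  · calc _ = r * (1 + (probe act x (I.deg x) y w).cost I) := if_pos hw
      _ ≤ r * (1 + (2 + if I.IsRootedTriangle x y w then κ else 0)) := by
          gcongr
          refine (cost_probe_le I act hxy hb hw).trans ?_
          gcongr
          split_ifs
          exacts [hκ x y w, le_rfl]
      _ = _ := by
          rw [if_pos hw]
          split_ifs <;> ring
  · rw [if_neg hw, if_neg hw, if_neg fun h => hw h.2.1]
    simp

end RootedScan

section EdgeScan

/-- Sample the triangles that contain the edge `v u`, the endpoints of which have the degrees `d`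
and `d'`, and the first vertex of which is `v` or `u`, and run `act` on the sample. -/
noncomputable def edgeScan (r : Set.Ioc (0 : ℝ) 1) (act : Fin n → Fin n → Fin n → Program n ℝ)
    (v : Fin n) (d : ℕ) (u : Fin n) (d' : ℕ) : Program n ℝ :=
  if GraphInput.key d v < GraphInput.key d' u then rootedScan r act v d u
  else rootedScan r act u d' v

variable (I : GraphInput n) (act : Fin n → Fin n → Fin n → Program n ℝ) (r : Set.Ioc (0 : ℝ) 1)
  {v u : Fin n}

theorem edgeScan_of_below (h : I.Below v u) :
    edgeScan r act v (I.deg v) u (I.deg u) = rootedScan r act v (I.deg v) u := if_pos h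

theorem edgeScan_comm (h : v ≠ u) :
    edgeScan r act v (I.deg v) u (I.deg u) = edgeScan r act u (I.deg u) v (I.deg v) := by
  rcases I.below_or_below h with hb | hb
  · exact (if_pos hb).trans (if_neg hb.asymm).symm
  · exact (if_neg hb.asymm).trans (if_pos hb).symm

variable (h : I.graph.Adj v u)

include h in
theorem mean_edgeScan : (edgeScan r act v (I.deg v) u (I.deg u)).mean I =
    edgeSum I (fun x y w => (act x y w).mean I) v u := by
  wlog hb : I.Below v u generalizing v u
  · rw [edgeScan_comm I act r h.ne, edgeSum_comm]
    exact this h.symm ((I.below_or_below h.ne).resolve_left hb)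
  · rw [edgeScan_of_below I act r hb, edgeSum_of_below I _ hb, mean_rootedScan I act r h hb]

include h in
theorem variance_edgeScan_le {K : ℝ}
    (hK : ∀ x y w, (thin r (act x y w)).variance I ≤ K * (act x y w).mean I) :
    (edgeScan r act v (I.deg v) u (I.deg u)).variance I ≤
      K * edgeSum I (fun x y w => (act x y w).mean I) v u := by
  wlog hb : I.Below v u generalizing v u
  · rw [edgeScan_comm I act r h.ne, edgeSum_comm]
    exact this h.symm ((I.below_or_below h.ne).resolve_left hb)
  · rw [edgeScan_of_below I act r hb, edgeSum_of_below I _ hb]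
    exact variance_rootedScan_le I act r h hb hK

include h in
theorem cost_edgeScan_le {κ : ℝ} (hκ : ∀ x y w, (act x y w).cost I ≤ κ) :
    (edgeScan r act v (I.deg v) u (I.deg u)).cost I ≤
      3 * r * min (I.deg v : ℝ) (I.deg u) + r * κ * edgeSum I (fun _ _ _ => 1) v u := by
  wlog hb : I.Below v u generalizing v u
  · rw [edgeScan_comm I act r h.ne, edgeSum_comm, min_comm]
    exact this h.symm ((I.below_or_below h.ne).resolve_left hb)
  · rw [edgeScan_of_below I act r hb, edgeSum_of_below I _ hb,
      min_eq_left (Nat.cast_le.2 hb.deg_le)]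
    exact cost_rootedScan_le I act r h hb hκ

theorem edgeSum_le_sqrt {F : Fin n → Fin n → Fin n → ℝ} (hF : ∀ x y w, F x y w ≤ 1) (hvu : v ≠ u) :
    edgeSum I F v u ≤ √(2 * (numEdges I.graph : ℝ)) := by
  wlog hb : I.Below v u generalizing v u
  · rw [edgeSum_comm]
    exact this hvu.symm ((I.below_or_below hvu).resolve_left hb)
  · rw [edgeSum_of_below I _ hb]
    exact rootedSum_le_sqrt I v u hF

end EdgeScan

section VertexScan

/-- Sample the triangles at the vertex `v` of degree `d`, and run `act` on the sample. -/
noncomputable def vertexScan (q r : Set.Ioc (0 : ℝ) 1)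
    (act : Fin n → Fin n → Fin n → Program n ℝ) (v : Fin n) (d : ℕ) : Program n ℝ :=
  forNbrs v d q fun u => askDeg u fun d' => edgeScan r act v d u d'

variable (I : GraphInput n) (act : Fin n → Fin n → Fin n → Program n ℝ) (q r : Set.Ioc (0 : ℝ) 1)
  (v : Fin n)

theorem mean_vertexScan : (vertexScan q r act v (I.deg v)).mean I =
    ∑ u, edgeSum I (fun x y w => (act x y w).mean I) v u := by
  classical
  rw [vertexScan, mean_forNbrs]
  refine Finset.sum_congr rfl fun u _ => ?_
  split_ifs with h
  · rw [mean_askDeg, mean_edgeScan I act r h]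
  · rw [edgeSum_eq_zero I _ h]

theorem variance_vertexScan_le {K : ℝ}
    (hK : ∀ x y w, (thin r (act x y w)).variance I ≤ K * (act x y w).mean I)
    (h0 : ∀ x y w, 0 ≤ (act x y w).mean I) (h1 : ∀ x y w, (act x y w).mean I ≤ 1) :
    (vertexScan q r act v (I.deg v)).variance I ≤
      (K / q + (1 / q - 1) * √(2 * (numEdges I.graph : ℝ))) *
        ∑ u, edgeSum I (fun x y w => (act x y w).mean I) v u := by
  classical
  have hq0 := q.2.1
  have hq : 0 ≤ 1 / (q : ℝ) - 1 := sub_nonneg.2 ((one_le_div hq0).2 q.2.2)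
  rw [vertexScan, variance_forNbrs, Finset.mul_sum]
  refine Finset.sum_le_sum fun u _ => ?_
  split_ifs with h
  · have hvar := variance_edgeScan_le I act r h hK
    have hle := edgeSum_le_sqrt I h1 h.ne
    have hnonneg := edgeSum_nonneg I v u h0
    rw [variance_thin, variance_askDeg, mean_askDeg, mean_edgeScan I act r h, add_mul, sq,
      mul_assoc, div_mul_eq_mul_div]
    gcongr
  · rw [edgeSum_eq_zero I _ h, mul_zero]

theorem cost_vertexScan_le {κ : ℝ} (hκ : ∀ x y w, (act x y w).cost I ≤ κ) :
    (vertexScan q r act v (I.deg v)).cost I ≤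
      2 * q * I.deg v + 3 * q * r * (I.deg v * √(2 * (numEdges I.graph : ℝ))) +
        q * r * κ * ∑ u, edgeSum I (fun _ _ _ => 1) v u := by
  classical
  have hq := q.2.1.le
  have hr := r.2.1.le
  refine le_trans ?_ (add_le_add (add_le_add le_rfl
    (mul_le_mul_of_nonneg_left (I.sum_min_deg_le v) (by positivity))) le_rfl)
  rw [vertexScan, cost_forNbrs, I.deg_eq_sum v, Finset.mul_sum, Finset.mul_sum, Finset.mul_sum,
    ← Finset.sum_add_distrib, ← Finset.sum_add_distrib]
  refine Finset.sum_le_sum fun u _ => ?_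
  split_ifs with h
  · rw [cost_askDeg, ← I.deg_eq_sum]
    linarith [mul_le_mul_of_nonneg_left (cost_edgeScan_le I act r h hκ) hq]
  · rw [edgeSum_eq_zero I _ h]
    simp

end VertexScan

end Program

namespace Program

variable {n : ℕ}

/-! ### Light vertices -/

section Light

/-- Decide (with random errors) whether the vertex `z` is light, that is, whether it has degree at
most `D` and lies in at most about `τ` triangles. The result is `1` if it is and `0` otherwise. -/
noncomputable def checkLight (q r : Set.Ioc (0 : ℝ) 1) (D τ : ℝ) (z : Fin n) : Program n ℝ :=
  askDeg z fun d => if D < d then pure 0 else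
    (vertexScan q r (fun _ _ _ => pure 1) z d).bind fun Y => pure (if Y ≤ τ then 1 else 0)

/-- The probability that `z` is found to be light. -/
noncomputable def lightProb (I : GraphInput n) (q r : Set.Ioc (0 : ℝ) 1) (D τ : ℝ)
    (z : Fin n) : ℝ :=
  (checkLight q r D τ z).mean I

/-- The number of triangles at `v`, counted twice if `v` is their first vertex. -/
noncomputable def trianglesAt (I : GraphInput n) (v : Fin n) : ℝ :=
  ∑ u, edgeSum I (fun _ _ _ => 1) v u

variable (I : GraphInput n) (q r : Set.Ioc (0 : ℝ) 1) (D τ : ℝ)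

theorem trianglesAt_nonneg (v : Fin n) : 0 ≤ trianglesAt I v :=
  Finset.sum_nonneg fun u _ => edgeSum_nonneg I v u fun _ _ _ => zero_le_one

variable {D} in
theorem lightProb_of_lt_deg {z : Fin n} (h : D < I.deg z) : lightProb I q r D τ z = 0 := by
  rw [lightProb, checkLight, mean_askDeg, if_pos h, mean_pure]

variable {D} in
theorem lightProb_of_deg_le {z : Fin n} (h : I.deg z ≤ D) : lightProb I q r D τ z =
    (vertexScan q r (fun _ _ _ => pure 1) z (I.deg z)).prob I fun Y _ => Y ≤ τ := by
  classical
  rw [lightProb, checkLight, mean_askDeg, if_neg h.not_gt, mean, expect_bind, prob]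
  simp only [expect]

theorem lightProb_mem_Icc (z : Fin n) : lightProb I q r D τ z ∈ Set.Icc (0 : ℝ) 1 := by
  rcases lt_or_ge D (I.deg z) with h | h
  · rw [lightProb_of_lt_deg I q r τ h]
    simp
  · rw [lightProb_of_deg_le I q r τ h]
    exact ⟨prob_nonneg I _, prob_le_one I _⟩

theorem one_sub_lightProb_nonneg (z : Fin n) : 0 ≤ 1 - lightProb I q r D τ z :=
  sub_nonneg.2 (lightProb_mem_Icc I q r D τ z).2

theorem expect_checkLight (z : Fin n) (f : ℝ → ℝ) :
    ((checkLight q r D τ z).expect I fun x _ => f x) =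
      lightProb I q r D τ z * f 1 + (1 - lightProb I q r D τ z) * f 0 := by
  rcases lt_or_ge D (I.deg z) with h | h
  · rw [lightProb_of_lt_deg I q r τ h, checkLight, expect_askDeg, if_pos h, expect]
    ring
  · rw [lightProb_of_deg_le I q r τ h, checkLight, expect_askDeg, if_neg h.not_gt, expect_bind,
      ← prob_not, ← expect_ite, ← expect_ite, ← expect_mul_const, ← expect_mul_const, ← expect_add]
    congr with Y _
    by_cases hY : Y ≤ τ <;> simp [expect, hY]

theorem cost_checkLight_le (hD : 0 ≤ D) (z : Fin n) : (checkLight q r D τ z).cost I ≤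
    1 + 2 * q * D + 3 * q * r * (D * √(2 * (numEdges I.graph : ℝ))) := by
  have hq := q.2.1.le
  have hr := r.2.1.le
  rw [checkLight, cost_askDeg, add_assoc]
  gcongr
  split_ifs with h
  · rw [cost_pure]
    positivity
  · rw [cost_bind_pure]
    refine (cost_vertexScan_le I (fun _ _ _ => pure 1) q r z (κ := 0)
      fun _ _ _ => (cost_pure I _).le).trans ?_
    rw [mul_zero, zero_mul, add_zero]
    have := not_lt.1 h
    gcongr

theorem mean_vertexScan_one (z : Fin n) :
    (vertexScan q r (fun _ _ _ => pure 1) z (I.deg z)).mean I = trianglesAt I z :=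
  mean_vertexScan I _ q r z

variable {q r} {B : ℝ} (hB : (1 / r - 1) / q + (1 / q - 1) * √(2 * (numEdges I.graph : ℝ)) ≤ B)

include hB in
theorem variance_vertexScan_one_le (z : Fin n) :
    (vertexScan q r (fun _ _ _ => pure 1) z (I.deg z)).variance I ≤ B * trianglesAt I z := by
  refine (variance_vertexScan_le I (fun _ _ _ => pure 1) q r z (K := 1 / r - 1) ?_ ?_ ?_).trans
    (mul_le_mul_of_nonneg_right hB (trianglesAt_nonneg I z))
  all_goals simp [variance_thin]

variable {τ}

include hB in
theorem one_sub_lightProb_le (hτ : 0 < τ) (hB0 : 0 ≤ B) {z : Fin n} (hz : I.deg z ≤ D)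
    (ht : trianglesAt I z ≤ τ / 2) : 1 - lightProb I q r D τ z ≤ 2 * B / τ := by
  rw [lightProb_of_deg_le I q r τ hz, ← prob_not]
  calc _ ≤ (vertexScan q r (fun _ _ _ => pure 1) z (I.deg z)).prob I fun Y _ =>
        τ / 2 ≤ |Y - (vertexScan q r (fun _ _ _ => pure 1) z (I.deg z)).mean I| := by
        refine prob_mono I fun Y c hY => ?_
        rw [mean_vertexScan_one]
        exact le_trans (by linarith) (le_abs_self _)
    _ ≤ B * trianglesAt I z / (τ / 2) ^ 2 := by
        refine (prob_le_abs_sub_mean_le I _ (half_pos hτ)).trans ?_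
        gcongr
        exact variance_vertexScan_one_le I hB z
    _ ≤ B * (τ / 2) / (τ / 2) ^ 2 := by gcongr
    _ = 2 * B / τ := by field_simp

include hB in
theorem lightProb_mul_trianglesAt_le (hτ : 0 < τ) (hB0 : 0 ≤ B) (z : Fin n) :
    lightProb I q r D τ z * trianglesAt I z ≤ 2 * τ + 4 * B := by
  have h1 := (lightProb_mem_Icc I q r D τ z).2
  rcases le_total (trianglesAt I z) (2 * τ) with ht | ht
  · linarith [mul_le_of_le_one_left (trianglesAt_nonneg I z) h1]
  rcases lt_or_ge D (I.deg z) with hz | hz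
  · rw [lightProb_of_lt_deg I q r τ hz]
    linarith
  have hpos : 0 < trianglesAt I z := by linarith
  have hle : lightProb I q r D τ z ≤ B * trianglesAt I z / (trianglesAt I z / 2) ^ 2 := by
    rw [lightProb_of_deg_le I q r τ hz]
    refine (prob_mono I fun Y c hY => ?_).trans
      ((prob_le_abs_sub_mean_le I _ (half_pos hpos)).trans ?_)
    · rw [mean_vertexScan_one, abs_sub_comm]
      exact le_trans (by linarith) (le_abs_self _)
    · gcongr
      exact variance_vertexScan_one_le I hB z
  calc _ ≤ B * trianglesAt I z / (trianglesAt I z / 2) ^ 2 * trianglesAt I z := by gcongr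
    _ = 4 * B := by field_simp; ring
    _ ≤ 2 * τ + 4 * B := by linarith

end Light

/-! ### The share of a vertex in a triangle -/

section Share

variable (I : GraphInput n) (q r : Set.Ioc (0 : ℝ) 1) (D τ : ℝ)

/-- The share of the vertex `v` in the triangle `x y w`, whose first vertex is `x`: the triangle is
shared among its light vertices, the first vertex having two shares. The vertex `w` gets its share
from the triangle `x w y`; without any light vertex, the shares are `0 / 0 = 0`. -/
noncomputable def share (v x y w : Fin n) : Program n ℝ :=
  (checkLight q r D τ x).bind fun lx => (checkLight q r D τ y).bind fun ly =>
    (checkLight q r D τ w).bind fun lw =>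
      pure ((if v = x then lx else if v = y then ly else 0) / (2 * lx + ly + lw))

theorem expect_share (v x y w : Fin n) (f : ℝ → ℝ) :
    ((share q r D τ v x y w).expect I fun a _ => f a) =
      (let a := lightProb I q r D τ x
       let b := lightProb I q r D τ y
       let c := lightProb I q r D τ w
       let g : ℝ → ℝ → ℝ → ℝ := fun lx ly lw =>
        f ((if v = x then lx else if v = y then ly else 0) / (2 * lx + ly + lw))
       a * (b * (c * g 1 1 1 + (1 - c) * g 1 1 0) + (1 - b) * (c * g 1 0 1 + (1 - c) * g 1 0 0)) +
       (1 - a) * (b * (c * g 0 1 1 + (1 - c) * g 0 1 0) +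
         (1 - b) * (c * g 0 0 1 + (1 - c) * g 0 0 0))) := by
  simp only [share, expect_bind, expect]
  rw [expect_checkLight I q r D τ x fun lx => (checkLight q r D τ y).expect I fun ly _ =>
    (checkLight q r D τ w).expect I fun lw _ =>
      f ((if v = x then lx else if v = y then ly else 0) / (2 * lx + ly + lw))]
  simp only [expect_checkLight I q r D τ y fun ly => (checkLight q r D τ w).expect I fun lw _ =>
    f ((if v = x then _ else if v = y then ly else 0) / (2 * _ + ly + lw))]
  simp only [expect_checkLight I q r D τ w fun lw =>
    f ((if v = x then _ else if v = y then _ else 0) / (2 * _ + _ + lw))]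

theorem mean_share_self (x y w : Fin n) : (share q r D τ x x y w).mean I =
    (let b := lightProb I q r D τ y
     let c := lightProb I q r D τ w
     lightProb I q r D τ x *
      (b * c / 4 + b * (1 - c) / 3 + (1 - b) * c / 3 + (1 - b) * (1 - c) / 2)) := by
  rw [mean, expect_share I q r D τ x x y w fun a => a]
  simp only [if_true]
  ring

theorem mean_share_of_ne {x y : Fin n} (h : y ≠ x) (w : Fin n) : (share q r D τ y x y w).mean I =
    (let a := lightProb I q r D τ x
     let c := lightProb I q r D τ w
     lightProb I q r D τ y *
      (a * c / 4 + a * (1 - c) / 3 + (1 - a) * c / 2 + (1 - a) * (1 - c))) := by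
  rw [mean, expect_share I q r D τ y x y w fun a => a]
  simp only [if_neg h, if_true]
  ring

theorem mean_share_of_ne_of_ne {v x y : Fin n} (hx : v ≠ x) (hy : v ≠ y) (w : Fin n) :
    (share q r D τ v x y w).mean I = 0 := by
  rw [mean, expect_share I q r D τ v x y w fun a => a]
  simp only [if_neg hx, if_neg hy]
  ring

theorem two_mul_mean_share_add {x y w : Fin n} (hy : y ≠ x) (hw : w ≠ x) :
    2 * (share q r D τ x x y w).mean I + (share q r D τ y x y w).mean I +
      (share q r D τ w x w y).mean I =
    1 - (1 - lightProb I q r D τ x) * (1 - lightProb I q r D τ y) *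
      (1 - lightProb I q r D τ w) := by
  rw [mean_share_self, mean_share_of_ne I q r D τ hy, mean_share_of_ne I q r D τ hw]
  ring

theorem mean_share_nonneg (v x y w : Fin n) : 0 ≤ (share q r D τ v x y w).mean I := by
  have a0 := (lightProb_mem_Icc I q r D τ x).1
  have b0 := (lightProb_mem_Icc I q r D τ y).1
  have c0 := (lightProb_mem_Icc I q r D τ w).1
  have a1 := one_sub_lightProb_nonneg I q r D τ x
  have b1 := one_sub_lightProb_nonneg I q r D τ y
  have c1 := one_sub_lightProb_nonneg I q r D τ w
  rw [mean, expect_share I q r D τ v x y w fun a => a]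
  dsimp only
  split_ifs <;> positivity

theorem mean_share_le (v x y w : Fin n) :
    (share q r D τ v x y w).mean I ≤ lightProb I q r D τ v := by
  have a0 := (lightProb_mem_Icc I q r D τ x).1
  have b0 := (lightProb_mem_Icc I q r D τ y).1
  have c0 := (lightProb_mem_Icc I q r D τ w).1
  have a1 := one_sub_lightProb_nonneg I q r D τ x
  have b1 := one_sub_lightProb_nonneg I q r D τ y
  have c1 := one_sub_lightProb_nonneg I q r D τ w
  by_cases hx : v = x
  · subst hx
    rw [mean_share_self]
    refine mul_le_of_le_one_right a0 ?_
    nlinarith [mul_nonneg b0 c0, mul_nonneg b0 c1, mul_nonneg c0 b1, mul_nonneg b1 c1]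
  by_cases hy : v = y
  · subst hy
    rw [mean_share_of_ne I q r D τ hx]
    refine mul_le_of_le_one_right b0 ?_
    nlinarith [mul_nonneg a0 c0, mul_nonneg a0 c1, mul_nonneg c0 a1, mul_nonneg a1 c1]
  · rw [mean_share_of_ne_of_ne I q r D τ hx hy]
    exact (lightProb_mem_Icc I q r D τ v).1

theorem secondMoment_share_le (v x y w : Fin n) :
    (share q r D τ v x y w).secondMoment I ≤ (share q r D τ v x y w).mean I := by
  have a0 := (lightProb_mem_Icc I q r D τ x).1
  have b0 := (lightProb_mem_Icc I q r D τ y).1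
  have c0 := (lightProb_mem_Icc I q r D τ w).1
  have a1 := one_sub_lightProb_nonneg I q r D τ x
  have b1 := one_sub_lightProb_nonneg I q r D τ y
  have c1 := one_sub_lightProb_nonneg I q r D τ w
  rw [mean, secondMoment, expect_share I q r D τ v x y w fun a => a,
    expect_share I q r D τ v x y w fun a => a ^ 2]
  dsimp only
  split_ifs <;> gcongr <;> norm_num

theorem variance_thin_share_le (p : Set.Ioc (0 : ℝ) 1) (v x y w : Fin n) :
    (thin p (share q r D τ v x y w)).variance I ≤ 1 / p * (share q r D τ v x y w).mean I := by
  have hp := p.2.1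
  rw [variance, secondMoment_thin, one_div_mul_eq_div]
  refine (sub_le_self _ (sq_nonneg _)).trans ?_
  gcongr
  exact secondMoment_share_le I q r D τ v x y w

variable {q r D τ} in
theorem cost_share_le {κ : ℝ} (hκ : ∀ z, (checkLight q r D τ z).cost I ≤ κ) (v x y w : Fin n) :
    (share q r D τ v x y w).cost I ≤ 3 * κ := by
  simp only [share, cost_bind, cost_pure, expect_const, add_zero]
  linarith [hκ x, hκ y, hκ w]

end Share

/-! ### Sums over all triangles -/

section RootedTotal

variable (I : GraphInput n)

/-- The sum of `F` over the triples `x y w` that form a triangle with first vertex `x`. -/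
noncomputable def rootedTotal (F : Fin n → Fin n → Fin n → ℝ) : ℝ :=
  ∑ x, ∑ y, rootedSum I F x y

theorem rootedTotal_const (a : ℝ) :
    rootedTotal I (fun _ _ _ => a) = a * (2 * (numTriangles I.graph : ℝ)) := by
  classical
  simp only [← I.sum_isRootedTriangle, rootedTotal, rootedSum, Finset.mul_sum, mul_ite, mul_one,
    mul_zero]

theorem rootedTotal_add (F G : Fin n → Fin n → Fin n → ℝ) :
    (rootedTotal I fun x y w => F x y w + G x y w) = rootedTotal I F + rootedTotal I G := by
  classical
  simp only [rootedTotal, rootedSum, ← Finset.sum_add_distrib, ite_add_ite, add_zero]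

theorem rootedTotal_comm (F : Fin n → Fin n → Fin n → ℝ) :
    rootedTotal I F = rootedTotal I fun x y w => F x w y := by
  classical
  refine Finset.sum_congr rfl fun x _ => ?_
  simp only [rootedSum]
  rw [Finset.sum_comm]
  simp only [I.isRootedTriangle_comm]

variable {I}

theorem rootedTotal_congr {F G : Fin n → Fin n → Fin n → ℝ}
    (h : ∀ x y w, I.IsRootedTriangle x y w → F x y w = G x y w) :
    rootedTotal I F = rootedTotal I G := by
  classical
  refine Finset.sum_congr rfl fun x _ => Finset.sum_congr rfl fun y _ =>
    Finset.sum_congr rfl fun w _ => ?_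
  split_ifs with h'
  exacts [h x y w h', rfl]

theorem rootedTotal_mono {F G : Fin n → Fin n → Fin n → ℝ} (h : ∀ x y w, F x y w ≤ G x y w) :
    rootedTotal I F ≤ rootedTotal I G :=
  Finset.sum_le_sum fun x _ => Finset.sum_le_sum fun y _ => rootedSum_mono I x y h

variable (I)

theorem sum_edgeSum (F : Fin n → Fin n → Fin n → Fin n → ℝ) :
    ∑ v, ∑ u, edgeSum I (F v) v u = rootedTotal I fun x y w => F x x y w + F y x y w := by
  rw [rootedTotal_add]
  simp only [edgeSum, Finset.sum_add_distrib]
  congr 1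
  rw [Finset.sum_comm]
  rfl

theorem sum_trianglesAt : ∑ v, trianglesAt I v = 4 * (numTriangles I.graph : ℝ) := by
  simp only [trianglesAt]
  rw [sum_edgeSum I fun _ _ _ _ => 1, rootedTotal_const]
  ring

theorem rootedTotal_mul_mul_le_sum_pow {f : Fin n → ℝ} (hf : ∀ z, 0 ≤ f z) :
    (rootedTotal I fun x y w => f x * f y * f w) ≤ (∑ z, f z) ^ 3 := by
  calc _ ≤ ∑ x, ∑ y, ∑ w, f x * f y * f w := by
        refine Finset.sum_le_sum fun x _ => Finset.sum_le_sum fun y _ =>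
          Finset.sum_le_sum fun w _ => ?_
        split_ifs
        exacts [le_rfl, mul_nonneg (mul_nonneg (hf x) (hf y)) (hf w)]
    _ = (∑ z, f z) ^ 3 := by
        rw [pow_three', Finset.sum_mul_sum, Finset.sum_mul]
        simp only [Finset.sum_mul, Finset.mul_sum]
        exact Finset.sum_congr rfl fun x _ => Finset.sum_comm

theorem rootedTotal_mul_mul_le_card_pow {f : Fin n → ℝ} (hf : ∀ z, f z ∈ Set.Icc (0 : ℝ) 1)
    (W : Finset (Fin n)) {η : ℝ} (hη : 0 ≤ η) (hW : ∀ z ∉ W, f z ≤ η) :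
    (rootedTotal I fun x y w => f x * f y * f w) ≤
      W.card ^ 3 + η * (2 * numTriangles I.graph) := by
  classical
  set ind : Fin n → ℝ := fun z => if z ∈ W then 1 else 0 with hind
  have ind_nonneg (z) : 0 ≤ ind z := by simp only [hind]; split_ifs <;> norm_num
  have hle (x y w) : f x * f y * f w ≤ ind x * ind y * ind w + η := by
    have hxy := mul_nonneg (hf x).1 (hf y).1
    by_cases hx : x ∈ W
    · by_cases hy : y ∈ W
      · by_cases hw : w ∈ W
        · have := mul_le_one₀ (mul_le_one₀ (hf x).2 (hf y).1 (hf y).2) (hf w).1 (hf w).2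
          simp only [hind, hx, hy, hw, if_true]
          linarith
        · have := mul_le_of_le_one_left (hf w).1 (mul_le_one₀ (hf x).2 (hf y).1 (hf y).2)
          simp only [hind, hw, if_false]
          linarith [hW w hw]
      · have := mul_le_of_le_one_right hxy (hf w).2
        have := mul_le_of_le_one_left (hf y).1 (hf x).2
        simp only [hind, hy, if_false]
        linarith [hW y hy]
    · have := mul_le_of_le_one_right hxy (hf w).2
      have := mul_le_of_le_one_right (hf x).1 (hf y).2
      simp only [hind, hx, if_false]
      linarith [hW x hx]
  calc _ ≤ rootedTotal I fun x y w => ind x * ind y * ind w + η := rootedTotal_mono hle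
    _ = (rootedTotal I fun x y w => ind x * ind y * ind w) + η * (2 * numTriangles I.graph) := by
        rw [rootedTotal_add I (fun x y w => ind x * ind y * ind w) fun _ _ _ => η,
          rootedTotal_const]
    _ ≤ (∑ z, ind z) ^ 3 + η * (2 * numTriangles I.graph) := by
        gcongr
        exact rootedTotal_mul_mul_le_sum_pow I ind_nonneg
    _ = _ := by simp [hind]

end RootedTotal

/-! ### Sampling the shares of the vertices -/

section TriangleEstimator

variable (I : GraphInput n) (q r p : Set.Ioc (0 : ℝ) 1) (D τ : ℝ)

/-- An estimator of the number of triangles: sample vertices with probability `p`, and sample the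
shares of every sampled vertex in the triangles at it. -/
noncomputable def triangleEstimator : Program n ℝ :=
  sumList (List.finRange n) fun v => thin p <| askDeg v fun d =>
    vertexScan q r (share q r D τ v) v d

/-- The expected contribution of a vertex to the estimator. -/
noncomputable def contribution (v : Fin n) : ℝ :=
  ∑ u, edgeSum I (fun x y w => (share q r D τ v x y w).mean I) v u

theorem contribution_nonneg (v : Fin n) : 0 ≤ contribution I q r D τ v :=
  Finset.sum_nonneg fun u _ => edgeSum_nonneg I v u fun _ _ _ => mean_share_nonneg I q r D τ v _ _ _

theorem contribution_le (v : Fin n) :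
    contribution I q r D τ v ≤ lightProb I q r D τ v * trianglesAt I v := by
  classical
  have hle (x y : Fin n) : rootedSum I (fun x y w => (share q r D τ v x y w).mean I) x y ≤
      lightProb I q r D τ v * rootedSum I (fun _ _ _ => 1) x y := by
    simp only [rootedSum, Finset.mul_sum, mul_ite, mul_one, mul_zero]
    gcongr
    split_ifs
    exacts [mean_share_le I q r D τ v _ _ _, le_rfl]
  rw [contribution, trianglesAt, Finset.mul_sum]
  gcongr with u
  rw [edgeSum, edgeSum, mul_add]
  exact add_le_add (hle v u) (hle u v)

theorem mean_triangleEstimator :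
    (triangleEstimator q r p D τ).mean I = ∑ v, contribution I q r D τ v := by
  rw [triangleEstimator, mean_sumList, ← Fin.sum_univ_def]
  refine Finset.sum_congr rfl fun v _ => ?_
  rw [mean_thin, mean_askDeg, mean_vertexScan, contribution]

/-- A triangle is lost exactly if none of its vertices is found to be light. -/
theorem mean_triangleEstimator_eq_sub : (triangleEstimator q r p D τ).mean I =
    numTriangles I.graph - (rootedTotal I fun x y w => (1 - lightProb I q r D τ x) *
      (1 - lightProb I q r D τ y) * (1 - lightProb I q r D τ w)) / 2 := by
  set first := rootedTotal I fun x y w => (share q r D τ x x y w).mean I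
  set other := rootedTotal I fun x y w => (share q r D τ y x y w).mean I
  set lost := rootedTotal I fun x y w => (1 - lightProb I q r D τ x) *
      (1 - lightProb I q r D τ y) * (1 - lightProb I q r D τ w)
  have hmean : (triangleEstimator q r p D τ).mean I = first + other := by
    rw [mean_triangleEstimator, ← rootedTotal_add]
    exact sum_edgeSum I fun v x y w => (share q r D τ v x y w).mean I
  have hother : other = rootedTotal I fun x y w => (share q r D τ w x w y).mean I :=
    rootedTotal_comm I _
  have hsum : first + first + other + other + lost = 1 * (2 * numTriangles I.graph) := by
    rw [← rootedTotal_const]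
    nth_rewrite 2 [hother]
    simp only [first, other, lost, ← rootedTotal_add]
    refine rootedTotal_congr fun x y w h => ?_
    linarith [two_mul_mean_share_add I q r D τ h.1.ne' h.2.1.ne']
  linarith

theorem mean_triangleEstimator_le :
    (triangleEstimator q r p D τ).mean I ≤ numTriangles I.graph := by
  have hlost : rootedTotal I (fun _ _ _ => 0) ≤ rootedTotal I fun x y w =>
      (1 - lightProb I q r D τ x) * (1 - lightProb I q r D τ y) * (1 - lightProb I q r D τ w) :=
    rootedTotal_mono fun x y w => mul_nonneg (mul_nonneg (one_sub_lightProb_nonneg I q r D τ x)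
      (one_sub_lightProb_nonneg I q r D τ y)) (one_sub_lightProb_nonneg I q r D τ w)
  rw [rootedTotal_const, zero_mul] at hlost
  linarith [mean_triangleEstimator_eq_sub I q r p D τ]

theorem mean_triangleEstimator_ge (W : Finset (Fin n)) {η : ℝ} (hη : 0 ≤ η)
    (hW : ∀ z ∉ W, 1 - lightProb I q r D τ z ≤ η) :
    numTriangles I.graph - (W.card ^ 3 / 2 + η * numTriangles I.graph) ≤
      (triangleEstimator q r p D τ).mean I := by
  have hlost := rootedTotal_mul_mul_le_card_pow I (f := fun z => 1 - lightProb I q r D τ z)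
    (fun z => ⟨one_sub_lightProb_nonneg I q r D τ z,
      sub_le_self _ (lightProb_mem_Icc I q r D τ z).1⟩) W hη hW
  linarith [mean_triangleEstimator_eq_sub I q r p D τ]

variable {q r τ} in
theorem variance_triangleEstimator_le {B : ℝ} (hτ : 0 < τ)
    (hB : (1 / r - 1) / q + (1 / q - 1) * √(2 * (numEdges I.graph : ℝ)) ≤ B) (hB0 : 0 ≤ B) :
    (triangleEstimator q r p D τ).variance I ≤
      ((1 / r / q + (1 / q - 1) * √(2 * (numEdges I.graph : ℝ))) / p +
        (1 / p - 1) * (2 * τ + 4 * B)) * (triangleEstimator q r p D τ).mean I := by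
  have hp0 := p.2.1
  have hp : 0 ≤ 1 / (p : ℝ) - 1 := sub_nonneg.2 ((one_le_div hp0).2 p.2.2)
  rw [mean_triangleEstimator, triangleEstimator, variance_sumList, ← Fin.sum_univ_def,
    Finset.mul_sum]
  gcongr with v
  have hvar : (vertexScan q r (share q r D τ v) v (I.deg v)).variance I ≤
      (1 / r / q + (1 / q - 1) * √(2 * (numEdges I.graph : ℝ))) * contribution I q r D τ v :=
    variance_vertexScan_le I (share q r D τ v) q r v (variance_thin_share_le I q r D τ r v)
      (mean_share_nonneg I q r D τ v) fun x y w =>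
        (mean_share_le I q r D τ v x y w).trans (lightProb_mem_Icc I q r D τ v).2
  have hle : contribution I q r D τ v ≤ 2 * τ + 4 * B :=
    (contribution_le I q r D τ v).trans (lightProb_mul_trianglesAt_le I D hB hτ hB0 v)
  have hnonneg := contribution_nonneg I q r D τ v
  rw [variance_thin, mean_askDeg, variance_askDeg, mean_vertexScan, ← contribution, add_mul, sq,
    mul_assoc (1 / (p : ℝ) - 1), div_mul_eq_mul_div]
  gcongr

theorem cost_triangleEstimator_le (hD : 0 ≤ D) :
    (triangleEstimator q r p D τ).cost I ≤
      p * (n + 2 * q * (2 * numEdges I.graph) +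
        3 * q * r * (2 * numEdges I.graph * √(2 * (numEdges I.graph : ℝ))) +
        q * r * (3 * (1 + 2 * q * D + 3 * q * r * (D * √(2 * (numEdges I.graph : ℝ))))) *
          (4 * numTriangles I.graph)) := by
  have hp := p.2.1.le
  rw [triangleEstimator, cost_sumList, ← Fin.sum_univ_def, ← sum_trianglesAt]
  simp only [cost_thin, cost_askDeg, ← Finset.mul_sum]
  gcongr
  refine (Finset.sum_le_sum fun v _ => add_le_add_right
    (cost_vertexScan_le I (share q r D τ v) q r v
      (cost_share_le I (cost_checkLight_le I q r D τ hD) v)) 1).trans_eq ?_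
  simp only [Finset.sum_add_distrib, ← Finset.mul_sum, ← Finset.sum_mul, Finset.sum_const,
    Finset.card_univ, Fintype.card_fin, nsmul_eq_mul, mul_one, trianglesAt, I.sum_deg]
  ring

end TriangleEstimator

end Program

namespace Program

variable {n : ℕ} {α β ι : Type}

/-! ### Nonnegative estimators -/

section Always

/-- All possible results satisfy `P`, whatever the answers to the queries are. -/
def Always (P : α → Prop) : Program n α → Prop
  | .pure a => P a
  | .ask _ next => ∀ x, (next x).Always P
  | .rand _ next => ∀ i, (next i).Always P

theorem Always.bind {P : α → Prop} {Q : β → Prop} {A : Program n α} (hA : A.Always P)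
    {g : α → Program n β} (hg : ∀ a, P a → (g a).Always Q) : (A.bind g).Always Q := by
  induction A with
  | pure a => exact hg a hA
  | ask _ _ ih => exact fun x => ih x (hA x)
  | rand _ _ ih => exact fun i => ih i (hA i)

theorem Always.expect_mono (I : GraphInput n) {P : α → Prop} {A : Program n α} (hA : A.Always P)
    {f g : α → ℕ → ℝ} (h : ∀ a c, P a → f a c ≤ g a c) : A.expect I f ≤ A.expect I g := by
  induction A generalizing f g with
  | pure a => exact h a 0 hA
  | ask _ _ ih => exact ih _ (hA _) fun a c => h a (c + 1)
  | rand w _ ih =>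
    exact Finset.sum_le_sum fun i _ =>
      mul_le_mul_of_nonneg_left (ih i (hA i) h) (stdSimplex.zero_le w i)

theorem Always.prob_le_mean_div (I : GraphInput n) {A : Program n ℝ} (hA : A.Always (0 ≤ ·)) {r : ℝ}
    (hr : 0 < r) : (A.prob I fun x _ => r ≤ x) ≤ A.mean I / r := by
  rw [div_eq_mul_inv, mean, ← expect_mul_const]
  refine hA.expect_mono I fun x c hx => ?_
  split_ifs with h
  · rwa [← div_eq_mul_inv, one_le_div hr]
  · positivity

theorem always_pure {P : α → Prop} {a : α} (h : P a) : (pure a : Program n α).Always P := h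

theorem always_sumList {l : List ι} {f : ι → Program n ℝ} (h : ∀ i, (f i).Always (0 ≤ ·)) :
    (sumList l f).Always (0 ≤ ·) := by
  induction l with
  | nil => exact always_pure le_rfl
  | cons i l ih => exact (h i).bind fun x hx => ih.bind fun y hy => always_pure (add_nonneg hx hy)

theorem always_average (R : ℕ) {A : Program n ℝ} (h : A.Always (0 ≤ ·)) :
    (average R A).Always (0 ≤ ·) :=
  (always_sumList fun _ => h).bind fun _ hs => always_pure (div_nonneg hs R.cast_nonneg)

theorem always_thin (p : Set.Ioc (0 : ℝ) 1) {A : Program n ℝ} (h : A.Always (0 ≤ ·)) :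
    (thin p A).Always (0 ≤ ·) := by
  rw [thin, Always, Fin.forall_fin_two]
  exact ⟨h.bind fun x hx => always_pure (div_nonneg hx p.2.1.le), always_pure le_rfl⟩

theorem always_forNbrs (v : Fin n) (d : ℕ) (p : Set.Ioc (0 : ℝ) 1) {body : Fin n → Program n ℝ}
    (h : ∀ u, (body u).Always (0 ≤ ·)) : (forNbrs v d p body).Always (0 ≤ ·) := by
  refine always_sumList fun i => always_thin p ?_
  split_ifs
  · rintro (_ | u)
    exacts [always_pure le_rfl, h u]
  · exact always_pure le_rfl

theorem always_rootedScan (r : Set.Ioc (0 : ℝ) 1) {act : Fin n → Fin n → Fin n → Program n ℝ}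
    (h : ∀ x y w, (act x y w).Always (0 ≤ ·)) (x : Fin n) (d : ℕ) (y : Fin n) :
    (rootedScan r act x d y).Always (0 ≤ ·) := by
  refine always_forNbrs x d r fun w => ?_
  rintro (_ | _)
  · exact always_pure le_rfl
  · intro dw
    dsimp only
    split_ifs
    exacts [h x y w, always_pure le_rfl]

theorem always_vertexScan (q r : Set.Ioc (0 : ℝ) 1) {act : Fin n → Fin n → Fin n → Program n ℝ}
    (h : ∀ x y w, (act x y w).Always (0 ≤ ·)) (v : Fin n) (d : ℕ) :
    (vertexScan q r act v d).Always (0 ≤ ·) := by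
  refine always_forNbrs v d q fun u d' => ?_
  dsimp only [edgeScan]
  split_ifs
  exacts [always_rootedScan r h v d u, always_rootedScan r h u d' v]

theorem always_checkLight (q r : Set.Ioc (0 : ℝ) 1) (D τ : ℝ) (z : Fin n) :
    (checkLight q r D τ z).Always (0 ≤ ·) := by
  intro d
  dsimp only
  split_ifs
  · exact always_pure le_rfl
  · refine (always_vertexScan q r (fun _ _ _ => always_pure zero_le_one) z d).bind fun Y _ => ?_
    refine always_pure ?_
    split_ifs
    exacts [zero_le_one, le_rfl]

theorem always_triangleEstimator (q r p : Set.Ioc (0 : ℝ) 1) (D τ : ℝ) :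
    (triangleEstimator (n := n) q r p D τ).Always (0 ≤ ·) := by
  refine always_sumList fun v => always_thin p fun d => always_vertexScan q r (fun x y w => ?_) v d
  refine (always_checkLight q r D τ x).bind fun lx hx =>
    (always_checkLight q r D τ y).bind fun ly hy =>
      (always_checkLight q r D τ w).bind fun lw hw => always_pure ?_
  split_ifs <;> positivity

end Always

/-! ### Estimating the number of edges -/

section EdgeEstimator

/-- The sampling probability `1 / (1 + s)`, for nonnegative `s`. -/
noncomputable def oneDivOneAdd (s : ℝ) : Set.Ioc (0 : ℝ) 1 :=
  ⟨1 / (1 + max s 0), by positivity,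
    (div_le_one (by positivity)).2 (le_add_of_nonneg_right (le_max_right s 0))⟩

theorem coe_oneDivOneAdd {s : ℝ} (hs : 0 ≤ s) : (oneDivOneAdd s : ℝ) = 1 / (1 + s) := by
  change 1 / (1 + max s 0) = _
  rw [max_eq_left hs]

theorem one_div_oneDivOneAdd {s : ℝ} (hs : 0 ≤ s) : 1 / (oneDivOneAdd s : ℝ) = 1 + s := by
  rw [coe_oneDivOneAdd hs, one_div_one_div]

/-- An estimator of twice the number of edges. -/
noncomputable def edgeEstimator (p : Set.Ioc (0 : ℝ) 1) : Program n ℝ :=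
  sumList (List.finRange n) fun v => thin p <| askDeg v fun d => pure (d : ℝ)

variable (I : GraphInput n) (p : Set.Ioc (0 : ℝ) 1)

theorem mean_edgeEstimator : (edgeEstimator p).mean I = 2 * numEdges I.graph := by
  rw [edgeEstimator, mean_sumList, ← Fin.sum_univ_def, ← I.sum_deg]
  simp only [mean_thin, mean_askDeg, mean_pure]

theorem cost_edgeEstimator : (edgeEstimator p).cost I = p * n := by
  rw [edgeEstimator, cost_sumList, ← Fin.sum_univ_def]
  simp [cost_thin, cost_askDeg, mul_comm]

theorem always_edgeEstimator : (edgeEstimator (n := n) p).Always (0 ≤ ·) :=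
  always_sumList fun _ => always_thin p fun (d : ℕ) => always_pure d.cast_nonneg

theorem expect_sumList_thin_deg_le (l : List (Fin n)) {b : Fin n → ℝ} (hb : ∀ v, b v ≤ I.deg v)
    {g : ℝ → ℝ} (hg : Antitone g) :
    ((sumList l fun v => thin p <| askDeg v fun d => pure (d : ℝ)).expect I fun x _ => g x) ≤
      (sumList l fun v => thin p <| pure (b v)).expect I fun x _ => g x := by
  have hp := p.2.1
  have hp1 := sub_nonneg.2 p.2.2
  induction l generalizing g with
  | nil => exact le_rfl
  | cons v l ih =>
    simp only [sumList, expect_bind, expect_thin, expect_askDeg, expect]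
    gcongr ?_ * ?_ + ?_ * ?_
    · refine (expect_mono I fun x c => hg ?_).trans
        (ih fun x y hxy => hg (add_le_add_right hxy (b v / p)))
      gcongr
      exact hb v
    · exact ih fun x y hxy => hg (add_le_add_right hxy 0)

theorem variance_sumList_thin_pure_le {b : ι → ℝ} {s : ℝ} (hb : ∀ i, b i ∈ Set.Icc 0 s)
    (l : List ι) : (sumList l fun i => thin p <| pure (b i)).variance I ≤
      (1 / p - 1) * s * (l.map b).sum := by
  have hp : 0 ≤ 1 / (p : ℝ) - 1 := sub_nonneg.2 ((one_le_div p.2.1).2 p.2.2)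
  rw [variance_sumList, ← List.sum_map_mul_left]
  refine List.sum_le_sum fun i _ => ?_
  rw [variance_thin, variance_pure, mean_pure, zero_div, zero_add, sq, mul_assoc]
  gcongr
  exacts [(hb i).1, (hb i).2]

/-- High-degree vertices make the variance of the estimator large, but not its lower tail: replacing
degrees by the smaller `degUp` leaves bounded summands whose sum is still the number of edges. -/
theorem prob_edgeEstimator_lt_half_le (hm : 0 < numEdges I.graph) :
    ((edgeEstimator p).prob I fun x _ => x < (numEdges I.graph : ℝ) / 2) ≤
      4 * (1 / p - 1) * √(2 * (numEdges I.graph : ℝ)) / numEdges I.graph := by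
  classical
  set m : ℝ := (numEdges I.graph : ℝ) with hm_def
  have hm0 : 0 < m := Nat.cast_pos.2 hm
  set A : Program n ℝ := sumList (List.finRange n) fun v => thin p <| pure (I.degUp v) with hA
  have hmean : A.mean I = m := by
    rw [hA, mean_sumList, ← Fin.sum_univ_def, hm_def, ← I.sum_degUp]
    simp only [mean_thin, mean_pure]
  have hvar : A.variance I ≤ (1 / p - 1) * √(2 * m) * m := by
    have := variance_sumList_thin_pure_le I p (s := √(2 * m))
      (fun v => ⟨I.degUp_nonneg v, I.degUp_le_sqrt v⟩) (List.finRange n)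
    rwa [← Fin.sum_univ_def, I.sum_degUp] at this
  have hantitone : Antitone fun x : ℝ => if x < m / 2 then (1 : ℝ) else 0 := by
    intro x y hxy
    dsimp only
    split_ifs with hy hx
    exacts [le_rfl, absurd (hxy.trans_lt hy) hx, zero_le_one, le_rfl]
  calc _ ≤ A.prob I fun x _ => x < m / 2 :=
        expect_sumList_thin_deg_le I p (List.finRange n) I.degUp_le_deg hantitone
    _ ≤ A.prob I fun x _ => m / 2 ≤ |x - A.mean I| := by
        refine prob_mono I fun x _ hx => ?_
        rw [hmean, abs_sub_comm]
        exact le_trans (by linarith) (le_abs_self _)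
    _ ≤ A.variance I / (m / 2) ^ 2 := prob_le_abs_sub_mean_le I A (half_pos hm0)
    _ ≤ (1 / p - 1) * √(2 * m) * m / (m / 2) ^ 2 := by gcongr
    _ = _ := by field_simp; ring

theorem le_two_mul_sqrt_of_pow_le {θ : ℝ} (h : θ ^ 3 ≤ 16 * numTriangles I.graph) :
    θ ≤ 2 * √(2 * (numEdges I.graph : ℝ)) := by
  have ht := I.two_mul_numTriangles_le
  refine le_of_pow_le_pow_left₀ three_ne_zero (by positivity) (h.trans ?_)
  calc 16 * (numTriangles I.graph : ℝ)
      ≤ 8 * (numEdges I.graph * √(2 * (numEdges I.graph : ℝ))) := by linarith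
    _ = 4 * √(2 * (numEdges I.graph : ℝ)) ^ 2 * √(2 * (numEdges I.graph : ℝ)) := by
        rw [Real.sq_sqrt (by positivity)]
        ring
    _ ≤ (2 * √(2 * (numEdges I.graph : ℝ))) ^ 3 := by
        rw [mul_pow, pow_succ _ 2]
        nlinarith [Real.sqrt_nonneg (2 * (numEdges I.graph : ℝ)),
          pow_nonneg (Real.sqrt_nonneg (2 * (numEdges I.graph : ℝ))) 3]

theorem prob_edgeEstimator_lt {θ : ℝ} (hθ : 0 ≤ θ) (hm : 0 < numEdges I.graph)
    (h : θ ^ 3 ≤ 16 * numTriangles I.graph) :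
    ((edgeEstimator (oneDivOneAdd (θ / 512))).prob I fun x _ =>
      x < (numEdges I.graph : ℝ) / 2) ≤ 1 / 32 := by
  refine (prob_edgeEstimator_lt_half_le I _ hm).trans ?_
  have hm0 : (0 : ℝ) < numEdges I.graph := Nat.cast_pos.2 hm
  rw [one_div_oneDivOneAdd (by positivity), add_sub_cancel_left, div_le_iff₀ hm0]
  calc _ ≤ 4 * (2 * √(2 * (numEdges I.graph : ℝ)) / 512) * √(2 * (numEdges I.graph : ℝ)) := by
        gcongr
        exact le_two_mul_sqrt_of_pow_le I h
    _ = 1 / 64 * √(2 * (numEdges I.graph : ℝ)) ^ 2 := by ring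
    _ = 1 / 32 * numEdges I.graph := by
        rw [Real.sq_sqrt (by positivity)]
        ring

end EdgeEstimator

end Program

namespace Program

variable {n : ℕ}

/-! ### Testing a guess of the number of triangles -/

section GuessEstimator

/-- The probability with which the guess estimator inspects an edge at a sampled vertex. -/
noncomputable def edgeRate (θ M : ℝ) : Set.Ioc (0 : ℝ) 1 := oneDivOneAdd (θ ^ 2 / M)

/-- The probability with which the guess estimator inspects a further neighbour of a sampled edge,
chosen so that both choices together have probability `1 / (1 + θ ^ 2)`. -/
noncomputable def neighborRate (θ M : ℝ) : Set.Ioc (0 : ℝ) 1 :=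
  oneDivOneAdd ((1 + θ ^ 2) / (1 + θ ^ 2 / M) - 1)

/-- The degree above which the guess estimator regards a vertex as heavy. -/
noncomputable def degreeBound (a θ M : ℝ) : ℝ := 128 * M ^ 2 / (a * θ)

/-- The number of triangles above which the guess estimator regards a vertex as heavy. -/
noncomputable def triangleBound (a θ : ℝ) : ℝ := 1024 * θ ^ 2 / a

/-- The estimator of the number of triangles for the guess `θ ^ 3` of this number, the bound `M` of
the square root of twice the number of edges, and the precision `a`. -/
noncomputable def guessEstimator (n : ℕ) (a θ M : ℝ) : Program n ℝ :=
  triangleEstimator (edgeRate θ M) (neighborRate θ M) (oneDivOneAdd θ) (degreeBound a θ M)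
    (triangleBound a θ)

/-- A bound of the expected number of queries of `guessEstimator`. -/
noncomputable def guessCost (n : ℕ) (a θ M : ℝ) : ℝ :=
  n / θ + 200 + 128000 * M ^ 3 / (a * θ ^ 3)

variable (I : GraphInput n) {a θ M : ℝ}

theorem always_guessEstimator (a θ M : ℝ) : (guessEstimator n a θ M).Always (0 ≤ ·) :=
  always_triangleEstimator _ _ _ _ _

theorem mean_guessEstimator_le (a θ M : ℝ) :
    (guessEstimator n a θ M).mean I ≤ numTriangles I.graph :=
  mean_triangleEstimator_le I _ _ _ _ _

theorem mean_guessEstimator_nonneg (a θ M : ℝ) : 0 ≤ (guessEstimator n a θ M).mean I := by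
  rw [mean, ← expect_const I (guessEstimator n a θ M) 0]
  exact (always_guessEstimator a θ M).expect_mono I fun x _ hx => hx

theorem one_div_edgeRate (hM : 1 ≤ M) : 1 / (edgeRate θ M : ℝ) = 1 + θ ^ 2 / M :=
  one_div_oneDivOneAdd (by positivity)

theorem one_div_neighborRate (hM : 1 ≤ M) :
    1 / (neighborRate θ M : ℝ) = (1 + θ ^ 2) / (1 + θ ^ 2 / M) := by
  have : θ ^ 2 / M ≤ θ ^ 2 := div_le_self (sq_nonneg θ) hM
  rw [neighborRate, one_div_oneDivOneAdd, add_sub_cancel]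
  rw [sub_nonneg, one_le_div (by positivity)]
  gcongr

theorem edgeRate_mul_neighborRate (hM : 1 ≤ M) :
    (edgeRate θ M : ℝ) * neighborRate θ M = 1 / (1 + θ ^ 2) := by
  rw [← one_div_one_div (edgeRate θ M * neighborRate θ M : ℝ), ← one_div_mul_one_div_rev,
    one_div_edgeRate hM, one_div_neighborRate hM, div_mul_cancel₀ _ (by positivity)]

theorem oneDivOneAdd_le (hθ : 0 < θ) : (oneDivOneAdd θ : ℝ) ≤ 1 / θ := by
  rw [coe_oneDivOneAdd hθ.le]
  gcongr
  linarith

theorem edgeRate_le (hθ : 0 < θ) (hM : 1 ≤ M) : (edgeRate θ M : ℝ) ≤ M / θ ^ 2 := by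
  rw [← one_div_div]
  exact oneDivOneAdd_le (by positivity)

theorem edgeRate_mul_neighborRate_le (hθ : 0 < θ) (hM : 1 ≤ M) :
    (edgeRate θ M : ℝ) * neighborRate θ M ≤ 1 / θ ^ 2 := by
  rw [edgeRate_mul_neighborRate hM]
  gcongr
  linarith

theorem one_div_rates_add_le (hM : 1 ≤ M) (hmM : 2 * (numEdges I.graph : ℝ) ≤ M ^ 2) :
    1 / (neighborRate θ M : ℝ) / edgeRate θ M +
      (1 / (edgeRate θ M : ℝ) - 1) * √(2 * (numEdges I.graph : ℝ)) ≤ 1 + 2 * θ ^ 2 := by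
  rw [div_div, mul_comm, edgeRate_mul_neighborRate hM, one_div_one_div, one_div_edgeRate hM,
    add_sub_cancel_left]
  calc _ ≤ 1 + θ ^ 2 + θ ^ 2 / M * M := by
        gcongr
        exact Real.sqrt_le_iff.2 ⟨by positivity, hmM⟩
    _ = 1 + 2 * θ ^ 2 := by
        field_simp
        ring

theorem one_div_rates_sub_one_add_le (hM : 1 ≤ M) (hmM : 2 * (numEdges I.graph : ℝ) ≤ M ^ 2) :
    (1 / (neighborRate θ M : ℝ) - 1) / edgeRate θ M +
      (1 / (edgeRate θ M : ℝ) - 1) * √(2 * (numEdges I.graph : ℝ)) ≤ 2 * θ ^ 2 := by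
  have h1 : 1 ≤ 1 / (edgeRate θ M : ℝ) := (one_le_div (edgeRate θ M).2.1).2 (edgeRate θ M).2.2
  have h2 := one_div_rates_add_le (θ := θ) I hM hmM
  rw [sub_div]
  linarith

theorem card_heavy_le {D τ : ℝ} (hD : 0 < D) (hτ : 0 < τ) :
    ((Finset.univ.filter fun z => D < I.deg z ∨ τ < trianglesAt I z).card : ℝ) ≤
      2 * numEdges I.graph / D + 4 * numTriangles I.graph / τ := by
  have htri (z : Fin n) : 0 ≤ trianglesAt I z / τ := div_nonneg (trianglesAt_nonneg I z) hτ.le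
  rw [← I.sum_deg, ← sum_trianglesAt I, Finset.sum_div, Finset.sum_div, ← Finset.sum_add_distrib,
    Finset.cast_card, Finset.sum_filter]
  refine Finset.sum_le_sum fun z _ => ?_
  have hdeg : 0 ≤ (I.deg z : ℝ) / D := by positivity
  split_ifs with h
  · rcases h with h | h
    · exact le_add_of_le_of_nonneg ((one_le_div hD).2 h.le) (htri z)
    · exact le_add_of_nonneg_of_le hdeg ((one_le_div hτ).2 h.le)
  · exact add_nonneg hdeg (htri z)

theorem card_heavy_guess_le (ha : 0 < a) (hθ : 0 < θ) (hM : 1 ≤ M)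
    (hmM : 2 * (numEdges I.graph : ℝ) ≤ M ^ 2) (hlo : (numTriangles I.graph : ℝ) ≤ 16 * θ ^ 3) :
    ((Finset.univ.filter fun z =>
      degreeBound a θ M < I.deg z ∨ triangleBound a θ / 2 < trianglesAt I z).card : ℝ) ≤
      5 * a * θ / 32 := by
  have hD : 0 < degreeBound a θ M := by unfold degreeBound; positivity
  have hτ : 0 < triangleBound a θ / 2 := by unfold triangleBound; positivity
  calc _ ≤ _ := card_heavy_le I hD hτ
    _ ≤ M ^ 2 / degreeBound a θ M + 4 * (16 * θ ^ 3) / (triangleBound a θ / 2) := by gcongr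
    _ = 17 * a * θ / 128 := by
        unfold degreeBound triangleBound
        field_simp
        ring
    _ ≤ 5 * a * θ / 32 := by nlinarith [mul_pos ha hθ]

theorem mean_guessEstimator_ge (ha : 0 < a) (ha1 : a ≤ 1 / 2) (hθ : 0 < θ) (hM : 1 ≤ M)
    (hmM : 2 * (numEdges I.graph : ℝ) ≤ M ^ 2) (hlo : (numTriangles I.graph : ℝ) ≤ 16 * θ ^ 3)
    (hhi : θ ^ 3 ≤ 16 * numTriangles I.graph) :
    (1 - a / 4) * numTriangles I.graph ≤ (guessEstimator n a θ M).mean I := by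
  classical
  have ht := (numTriangles I.graph).cast_nonneg (α := ℝ)
  have hτ : 0 < triangleBound a θ := by unfold triangleBound; positivity
  set W : Finset (Fin n) := Finset.univ.filter fun z =>
    degreeBound a θ M < I.deg z ∨ triangleBound a θ / 2 < trianglesAt I z with hW
  have hcard : (W.card : ℝ) ≤ 5 * a * θ / 32 := card_heavy_guess_le I ha hθ hM hmM hlo
  have hlight : ∀ z ∉ W, 1 - lightProb I (edgeRate θ M) (neighborRate θ M) (degreeBound a θ M)
      (triangleBound a θ) z ≤ a / 256 := by
    intro z hz
    simp only [hW, Finset.mem_filter, Finset.mem_univ, true_and, not_or, not_lt] at hz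
    refine (one_sub_lightProb_le I _ (one_div_rates_sub_one_add_le I hM hmM) hτ (by positivity)
      hz.1 hz.2).trans_eq ?_
    unfold triangleBound
    field_simp
    norm_num
  have hheavy : (W.card : ℝ) ^ 3 / 2 ≤ a / 8 * numTriangles I.graph := by
    calc (W.card : ℝ) ^ 3 / 2 ≤ (5 * a * θ / 32) ^ 3 / 2 := by gcongr
      _ = 125 / 65536 * (a * a ^ 2) * θ ^ 3 := by ring
      _ ≤ 125 / 65536 * (a * (1 / 2) ^ 2) * (16 * numTriangles I.graph) := by gcongr
      _ ≤ a / 8 * numTriangles I.graph := by nlinarith [mul_nonneg ha.le ht]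
  have hmean := mean_triangleEstimator_ge I (edgeRate θ M) (neighborRate θ M) (oneDivOneAdd θ)
    (degreeBound a θ M) (triangleBound a θ) W (by positivity) hlight
  rw [← guessEstimator] at hmean
  nlinarith [mul_nonneg ha.le ht]

theorem guess_variance_coeff_le (ha : 0 < a) (ha1 : a ≤ 1 / 2) (hθ : 0 < θ) {t : ℝ} (ht : 1 ≤ t)
    (hhi : θ ^ 3 ≤ 16 * t) :
    (1 + 2 * θ ^ 2) * (1 + θ) + θ * (2 * triangleBound a θ + 4 * (2 * θ ^ 2)) ≤
      38400 / a * t := by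
  have ha2 : 2 ≤ 1 / a := by
    rw [le_div_iff₀ ha]
    linarith
  have h1 : θ ≤ 1 + θ ^ 3 := by nlinarith [sq_nonneg (θ - 1), mul_pos hθ hθ]
  have h2 : θ ^ 2 ≤ 1 + θ ^ 3 := by nlinarith [sq_nonneg (θ - 1), mul_pos hθ hθ]
  calc _ = 1 + θ + 2 * θ ^ 2 + (10 + 2048 * (1 / a)) * θ ^ 3 := by
        unfold triangleBound
        field_simp
        ring
    _ ≤ 4 * t + (13 + 2048 * (1 / a)) * (16 * t) := by nlinarith
    _ ≤ 38400 * (1 / a) * t := by nlinarith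
    _ = 38400 / a * t := by ring

theorem variance_guessEstimator_le (ha : 0 < a) (ha1 : a ≤ 1 / 2) (hθ : 0 < θ) (hM : 1 ≤ M)
    (hmM : 2 * (numEdges I.graph : ℝ) ≤ M ^ 2) (ht : 0 < numTriangles I.graph)
    (hhi : θ ^ 3 ≤ 16 * numTriangles I.graph) :
    (guessEstimator n a θ M).variance I ≤ 38400 / a * (numTriangles I.graph : ℝ) ^ 2 := by
  have hτ : 0 < triangleBound a θ := by unfold triangleBound; positivity
  have hvar := variance_triangleEstimator_le I (oneDivOneAdd θ) (degreeBound a θ M) hτ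
    (one_div_rates_sub_one_add_le (θ := θ) I hM hmM) (by positivity)
  rw [← guessEstimator, div_eq_mul_one_div (_ + _), one_div_oneDivOneAdd hθ.le,
    add_sub_cancel_left] at hvar
  calc _ ≤ _ := hvar
    _ ≤ ((1 + 2 * θ ^ 2) * (1 + θ) + θ * (2 * triangleBound a θ + 4 * (2 * θ ^ 2))) *
        (guessEstimator n a θ M).mean I := by
        gcongr (?_ * _ + _) * _
        exacts [mean_guessEstimator_nonneg I a θ M, one_div_rates_add_le I hM hmM]
    _ ≤ 38400 / a * numTriangles I.graph * numTriangles I.graph := by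
        gcongr
        exacts [mean_guessEstimator_nonneg I a θ M,
          guess_variance_coeff_le ha ha1 hθ (Nat.one_le_cast.2 ht) hhi,
          mean_guessEstimator_le I a θ M]
    _ = _ := by ring

theorem cost_guessEstimator_le (ha : 0 < a) (ha1 : a ≤ 1 / 2) (hθ : 0 < θ) (hM : 1 ≤ M)
    (hmM : 2 * (numEdges I.graph : ℝ) ≤ M ^ 2) (hlo : (numTriangles I.graph : ℝ) ≤ 16 * θ ^ 3) :
    (guessEstimator n a θ M).cost I ≤ guessCost n a θ M := by
  have hD : 0 ≤ degreeBound a θ M := by unfold degreeBound; positivity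
  have hs : √(2 * (numEdges I.graph : ℝ)) ≤ M := Real.sqrt_le_iff.2 ⟨by positivity, hmM⟩
  have hq := edgeRate_le hθ hM
  have hqr := edgeRate_mul_neighborRate_le hθ hM
  have hp := oneDivOneAdd_le hθ
  have hq0 := (edgeRate θ M).2.1.le
  have hr0 := (neighborRate θ M).2.1.le
  have ha2 : 5 ≤ 5120 / a := by
    rw [le_div_iff₀ ha]
    linarith
  calc _ ≤ _ := cost_triangleEstimator_le I (edgeRate θ M) (neighborRate θ M) (oneDivOneAdd θ)
        (degreeBound a θ M) (triangleBound a θ) hD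
    _ ≤ 1 / θ * (n + 2 * (M / θ ^ 2) * M ^ 2 + 3 * (1 / θ ^ 2) * (M ^ 2 * M) +
        1 / θ ^ 2 * (3 * (1 + 2 * (M / θ ^ 2) * degreeBound a θ M +
          3 * (1 / θ ^ 2) * (degreeBound a θ M * M))) * (4 * (16 * θ ^ 3))) := by
        simp only [mul_assoc (3 : ℝ)]
        gcongr
    _ = n / θ + 192 + (5 + 122880 / a) * (M ^ 3 / θ ^ 3) := by
        unfold degreeBound
        field_simp
        ring
    _ ≤ n / θ + 200 + (5120 / a + 122880 / a) * (M ^ 3 / θ ^ 3) := by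
        gcongr
        norm_num
    _ = guessCost n a θ M := by
        unfold guessCost
        field_simp
        ring

end GuessEstimator

section GuessRun

/-- The number of repetitions that makes the variance of the averaged guess estimator small. -/
noncomputable def repetitions (a : ℝ) : ℕ := ⌈4915200 / a ^ 3⌉₊

/-- The averaged guess estimator, stopped after 32 times its expected number of queries. -/
noncomputable def guessRun (n : ℕ) (a θ M : ℝ) : Program n ℝ :=
  truncate 0 ⌈32 * repetitions a * guessCost n a θ M⌉₊
    (average (repetitions a) (guessEstimator n a θ M))

variable (I : GraphInput n) {a θ M : ℝ}

theorem repetitions_pos (ha : 0 < a) : 0 < repetitions a := Nat.ceil_pos.2 (by positivity)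

theorem prob_guessRun_notMem_Iio_le (ha : 0 < a) (hθ : 0 < θ)
    (h : 16 * (numTriangles I.graph : ℝ) < θ ^ 3) :
    ((guessRun n a θ M).prob I fun x _ => x ∉ Set.Iio (θ ^ 3)) ≤ 1 / 16 := by
  have hθ3 : 0 < θ ^ 3 := by positivity
  have hmean := mean_guessEstimator_le I a θ M
  calc _ ≤ _ := prob_truncate_le_of_not I 0 _ _ (P := (· ∉ Set.Iio (θ ^ 3))) (by simpa using hθ3)
    _ = (average (repetitions a) (guessEstimator n a θ M)).prob I fun x _ => θ ^ 3 ≤ x := by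
        simp only [Set.mem_Iio, not_lt]
    _ ≤ _ := (always_average _ (always_guessEstimator a θ M)).prob_le_mean_div I hθ3
    _ ≤ 1 / 16 := by
        rw [mean_average I _ (repetitions_pos ha).ne', div_le_iff₀ hθ3]
        linarith

theorem variance_average_guessEstimator_le (ha : 0 < a) (ha1 : a ≤ 1 / 2) (hθ : 0 < θ)
    (hM : 1 ≤ M) (hmM : 2 * (numEdges I.graph : ℝ) ≤ M ^ 2) (ht : 0 < numTriangles I.graph)
    (hhi : θ ^ 3 ≤ 16 * numTriangles I.graph) :
    (average (repetitions a) (guessEstimator n a θ M)).variance I ≤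
      1 / 32 * (a * numTriangles I.graph / 2) ^ 2 := by
  have hR : 4915200 / a ^ 3 ≤ repetitions a := Nat.le_ceil _
  rw [variance_average I _ (repetitions_pos ha).ne']
  calc _ ≤ 38400 / a * (numTriangles I.graph : ℝ) ^ 2 / (4915200 / a ^ 3) := by
        gcongr
        exact variance_guessEstimator_le I ha ha1 hθ hM hmM ht hhi
    _ = _ := by
        field_simp
        ring

theorem prob_guessRun_notMem_Icc_le (ha : 0 < a) (ha1 : a ≤ 1 / 2) (hθ : 0 < θ) (hM : 1 ≤ M)
    (hmM : 2 * (numEdges I.graph : ℝ) ≤ M ^ 2) (ht : 0 < numTriangles I.graph)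
    (hlo : (numTriangles I.graph : ℝ) ≤ 16 * θ ^ 3) (hhi : θ ^ 3 ≤ 16 * numTriangles I.graph) :
    ((guessRun n a θ M).prob I fun x _ => x ∉ Set.Icc ((1 - a) * (numTriangles I.graph : ℝ))
      ((1 + a) * (numTriangles I.graph : ℝ))) ≤ 1 / 16 := by
  have ht0 : (0 : ℝ) < numTriangles I.graph := Nat.cast_pos.2 ht
  have hR : (0 : ℝ) < repetitions a := Nat.cast_pos.2 (repetitions_pos ha)
  have hcost0 : 0 < guessCost n a θ M := by unfold guessCost; positivity
  have hat : 0 < a * numTriangles I.graph := mul_pos ha ht0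
  set A := average (repetitions a) (guessEstimator n a θ M) with hA
  have hmean : A.mean I = (guessEstimator n a θ M).mean I :=
    mean_average I _ (repetitions_pos ha).ne'
  have hmean_le := hmean.trans_le (mean_guessEstimator_le I a θ M)
  have hle_mean := (mean_guessEstimator_ge I ha ha1 hθ hM hmM hlo hhi).trans_eq hmean.symm
  have hdev : (A.prob I fun x _ => x ∉ Set.Icc ((1 - a) * (numTriangles I.graph : ℝ))
      ((1 + a) * (numTriangles I.graph : ℝ))) ≤ 1 / 32 := by
    calc _ ≤ A.prob I fun x _ => a * numTriangles I.graph / 2 ≤ |x - A.mean I| := by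
          refine prob_mono I fun x _ hx => ?_
          contrapose! hx
          rw [abs_lt] at hx
          exact ⟨by linarith, by linarith⟩
      _ ≤ _ := prob_le_abs_sub_mean_le I A (half_pos hat)
      _ ≤ 1 / 32 := div_le_of_le_mul₀ (sq_nonneg _) (by norm_num)
          (variance_average_guessEstimator_le I ha ha1 hθ hM hmM ht hhi)
  have hlong : (A.prob I fun _ c => ⌈32 * repetitions a * guessCost n a θ M⌉₊ < c) ≤ 1 / 32 := by
    calc _ ≤ A.cost I / (32 * repetitions a * guessCost n a θ M) :=
          prob_le_expect_div I (fun _ c => c.cast_nonneg) (by positivity)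
            fun _ _ hc => (Nat.lt_of_ceil_lt hc).le
      _ ≤ repetitions a * guessCost n a θ M / (32 * repetitions a * guessCost n a θ M) := by
          rw [hA, cost_average]
          gcongr
          exact cost_guessEstimator_le I ha ha1 hθ hM hmM hlo
      _ = 1 / 32 := by field_simp
  refine (prob_truncate_le I 0 _ A _).trans ((prob_or_le I _ _).trans ?_)
  linarith

end GuessRun

end Program

namespace Program

variable {n : ℕ}

/-! ### Searching for a good guess -/

section EdgeRun

/-- The edge estimator with sampling probability about `512 / θ`, stopped after `64` times its
expected number of queries. -/
noncomputable def edgeRun (n : ℕ) (θ : ℝ) : Program n ℝ :=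
  truncate 0 ⌈32768 * (n / θ)⌉₊ (edgeEstimator (oneDivOneAdd (θ / 512)))

variable (I : GraphInput n) {θ : ℝ}

theorem prob_edgeEstimator_notMem_Iic_le (p : Set.Ioc (0 : ℝ) 1) :
    ((edgeEstimator p).prob I fun x _ => x ∉ Set.Iic (128 * (numEdges I.graph : ℝ) + 1)) ≤
      1 / 64 := by
  calc _ ≤ (edgeEstimator p).prob I fun x _ => 128 * (numEdges I.graph : ℝ) + 1 ≤ x :=
        prob_mono I fun x _ hx => (not_le.1 hx).le
    _ ≤ _ := (always_edgeEstimator p).prob_le_mean_div I (by positivity)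
    _ ≤ 1 / 64 := by
        rw [mean_edgeEstimator, div_le_iff₀ (by positivity)]
        linarith

theorem prob_edgeRun_notMem_Iic_le (θ : ℝ) :
    ((edgeRun n θ).prob I fun x _ => x ∉ Set.Iic (128 * (numEdges I.graph : ℝ) + 1)) ≤ 1 / 16 := by
  refine (prob_truncate_le_of_not I 0 _ _ ?_).trans
    ((prob_edgeEstimator_notMem_Iic_le I _).trans (by norm_num))
  rw [not_not, Set.mem_Iic]
  positivity

theorem prob_edgeEstimator_lt_cost_le (hθ : 0 < θ) (hn : 0 < n) :
    ((edgeEstimator (oneDivOneAdd (θ / 512))).prob I fun _ c => ⌈32768 * (n / θ)⌉₊ < c) ≤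
      1 / 64 := by
  calc _ ≤ (edgeEstimator (oneDivOneAdd (θ / 512))).cost I / (32768 * (n / θ)) :=
        prob_le_expect_div I (fun _ c => c.cast_nonneg) (by positivity)
          fun _ _ hc => (Nat.lt_of_ceil_lt hc).le
    _ ≤ 1 / (θ / 512) * n / (32768 * (n / θ)) := by
        rw [cost_edgeEstimator]
        gcongr
        exact oneDivOneAdd_le (by positivity)
    _ = 1 / 64 := by
        field_simp
        norm_num

theorem prob_edgeRun_notMem_Icc_le (hθ : 0 < θ) (hn : 0 < n) (ht : 0 < numTriangles I.graph)
    (h : θ ^ 3 ≤ 16 * numTriangles I.graph) :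
    ((edgeRun n θ).prob I fun x _ => x ∉ Set.Icc ((numEdges I.graph : ℝ) / 2)
      (128 * (numEdges I.graph : ℝ) + 1)) ≤ 1 / 16 := by
  refine (prob_truncate_le I 0 _ _ _).trans ?_
  calc _ ≤ (edgeEstimator (oneDivOneAdd (θ / 512))).prob I fun x c =>
        (x < (numEdges I.graph : ℝ) / 2 ∨ x ∉ Set.Iic (128 * (numEdges I.graph : ℝ) + 1)) ∨
          ⌈32768 * (n / θ)⌉₊ < c := by
        refine prob_mono I fun x c => Or.imp_left fun hx => ?_
        contrapose! hx
        exact hx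
    _ ≤ 1 / 32 + 1 / 64 + 1 / 64 := by
        refine (prob_or_le I _ _).trans (add_le_add ((prob_or_le I _ _).trans ?_)
          (prob_edgeEstimator_lt_cost_le I hθ hn))
        exact add_le_add (prob_edgeEstimator_lt I hθ.le (I.numEdges_pos ht) h)
          (prob_edgeEstimator_notMem_Iic_le I _)
    _ = 1 / 16 := by norm_num

end EdgeRun

section SearchRound

/-- The bound of the square root of twice the number of edges that results from the estimate `x` of
the number of edges, which is correct up to constant factors. -/
noncomputable def rootBound (x : ℝ) : ℝ := √(4 * max x 0 + 1)

theorem one_le_rootBound (x : ℝ) : 1 ≤ rootBound x := by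
  rw [rootBound, Real.one_le_sqrt]
  linarith [le_max_right x 0]

theorem two_mul_le_rootBound_sq {m x : ℝ} (h : m / 2 ≤ x) : 2 * m ≤ rootBound x ^ 2 := by
  rw [rootBound, Real.sq_sqrt (by positivity)]
  linarith [le_max_left x 0]

/-- One round of the search: bound the number of edges, then estimate the number of triangles with
the guess `θ ^ 3`, taking medians of `k` runs. -/
noncomputable def searchRound (n : ℕ) (a : ℝ) (k : ℕ) (θ : ℝ) : Program n ℝ :=
  (medianOfRuns k (edgeRun n θ)).bind fun x => medianOfRuns k (guessRun n a θ (rootBound x))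

/-- A bound of the number of queries in a round for graphs with `m` edges. -/
noncomputable def roundCost (n : ℕ) (a : ℝ) (k : ℕ) (m θ : ℝ) : ℕ :=
  k * ⌈32768 * (n / θ)⌉₊ + k * ⌈32 * repetitions a * guessCost n a θ √(512 * m + 5)⌉₊

/-- The result `x` of a round does not exceed a guess `θ ^ 3` that is much too large, and is
accurate if the guess is not too large. -/
def IsReliable (I : GraphInput n) (a θ x : ℝ) : Prop :=
  (16 * (numTriangles I.graph : ℝ) < θ ^ 3 → x < θ ^ 3) ∧
    (θ ^ 3 ≤ 16 * (numTriangles I.graph : ℝ) →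
      x ∈ Set.Icc ((1 - a) * (numTriangles I.graph : ℝ)) ((1 + a) * numTriangles I.graph))

variable {I : GraphInput n} {a θ x : ℝ}

theorem IsReliable.mem_Icc (h : IsReliable I a θ x) (hx : θ ^ 3 ≤ x) :
    x ∈ Set.Icc ((1 - a) * (numTriangles I.graph : ℝ)) ((1 + a) * numTriangles I.graph) :=
  h.2 (not_lt.1 fun h' => (h.1 h').not_ge hx)

theorem IsReliable.numTriangles_le (h : IsReliable I a θ x) (ha1 : a ≤ 1 / 2) (hx : x < θ ^ 3) :
    (numTriangles I.graph : ℝ) ≤ 16 * (θ / 2) ^ 3 := by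
  by_contra! hlt
  have hx' := (h.2 (by linarith)).1
  nlinarith

theorem ceil_guessCost_rootBound_le {m : ℝ} (hm : 0 ≤ m) (ha : 0 < a) (hθ : 0 < θ)
    (hx : x ≤ 128 * m + 1) : ⌈32 * repetitions a * guessCost n a θ (rootBound x)⌉₊ ≤
      ⌈32 * repetitions a * guessCost n a θ √(512 * m + 5)⌉₊ := by
  have hM : rootBound x ≤ √(512 * m + 5) := by
    refine Real.sqrt_le_sqrt ?_
    linarith [max_le hx (by positivity : 0 ≤ 128 * m + 1)]
  have hM0 := one_le_rootBound x
  unfold guessCost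
  gcongr

variable (I) (k : ℕ)

theorem prob_searchRound_not_mem_le (ha : 0 < a) (hθ : 0 < θ) {S T : Set ℝ} (hS : S.OrdConnected)
    (hT : T.OrdConnected) (hSm : ∀ x ∈ S, x ≤ 128 * (numEdges I.graph : ℝ) + 1)
    (hedge : ((edgeRun n θ).prob I fun x _ => x ∉ S) ≤ 1 / 16)
    (hguess : ∀ x ∈ S, ((guessRun n a θ (rootBound x)).prob I fun y _ => y ∉ T) ≤ 1 / 16) :
    ((searchRound n a k θ).prob I fun y c =>
      ¬ (y ∈ T ∧ c ≤ roundCost n a k (numEdges I.graph) θ)) ≤ 2 * (1 / 2) ^ k := by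
  rw [two_mul]
  refine prob_bind_not_le I (by positivity)
    (prob_medianOfRuns_not_le I (prob_truncate_not_cost_le I _ _ _).le hS hedge)
    fun x c ⟨hx, hc⟩ => ?_
  refine (prob_mono I fun y c' hy => ?_).trans
    (prob_medianOfRuns_not_le I (prob_truncate_not_cost_le I _ _ _).le hT (hguess x hx))
  contrapose! hy
  exact ⟨hy.1, Nat.add_le_add hc (hy.2.trans (Nat.mul_le_mul_left k
    (ceil_guessCost_rootBound_le (Nat.cast_nonneg _) ha hθ (hSm x hx))))⟩

theorem prob_searchRound_not_isReliable_le (ha : 0 < a) (ha1 : a ≤ 1 / 2) (hθ : 0 < θ) (hn : 0 < n)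
    (hlo : (numTriangles I.graph : ℝ) ≤ 16 * θ ^ 3) :
    ((searchRound n a k θ).prob I fun y c =>
      ¬ (IsReliable I a θ y ∧ c ≤ roundCost n a k (numEdges I.graph) θ)) ≤ 2 * (1 / 2) ^ k := by
  rcases lt_or_ge (16 * (numTriangles I.graph : ℝ)) (θ ^ 3) with h | h
  · refine (prob_mono I fun y c => mt ?_).trans
      (prob_searchRound_not_mem_le I k ha hθ Set.ordConnected_Iic Set.ordConnected_Iio
        (fun _ => id) (prob_edgeRun_notMem_Iic_le I θ)
        fun x _ => prob_guessRun_notMem_Iio_le I ha hθ h)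
    exact fun ⟨hy, hc⟩ => ⟨⟨fun _ => hy, fun h' => absurd h h'.not_gt⟩, hc⟩
  · have ht : 0 < numTriangles I.graph := by
      have : 0 < θ ^ 3 := by positivity
      exact Nat.cast_pos.1 (by linarith : (0 : ℝ) < numTriangles I.graph)
    refine (prob_mono I fun y c => mt ?_).trans
      (prob_searchRound_not_mem_le I k ha hθ Set.ordConnected_Icc Set.ordConnected_Icc
        (fun _ => And.right) (prob_edgeRun_notMem_Icc_le I hθ hn ht h)
        fun x hx => prob_guessRun_notMem_Icc_le I ha ha1 hθ (one_le_rootBound x)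
          (two_mul_le_rootBound_sq hx.1) ht hlo h)
    exact fun ⟨hy, hc⟩ => ⟨⟨fun h' => absurd h h'.not_ge, fun _ => hy⟩, hc⟩

end SearchRound

section Search

/-- Search for the number of triangles, halving `θ` until the guess `θ ^ 3` is exceeded by the
estimate, for at most `f` rounds. -/
noncomputable def search (n : ℕ) (a : ℝ) (k : ℕ) : ℕ → ℝ → Program n ℝ
  | 0, _ => pure 0
  | f + 1, θ => (searchRound n a k θ).bind fun x =>
      if θ ^ 3 ≤ x then pure x else search n a k f (θ / 2)

theorem prob_search_not_le (I : GraphInput n) {a : ℝ} (k : ℕ) (ha : 0 < a) (ha1 : a ≤ 1 / 2)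
    (hn : 0 < n) {Γ : ℕ} (hΓ : 0 < numTriangles I.graph → ∀ θ : ℝ, 0 < θ →
      (numTriangles I.graph : ℝ) ≤ 16 * θ ^ 3 → roundCost n a k (numEdges I.graph) θ ≤ Γ)
    (f : ℕ) {θ : ℝ} (hθ : 0 < θ) (hlo : (numTriangles I.graph : ℝ) ≤ 16 * θ ^ 3)
    (hf : 0 < numTriangles I.graph → θ ≤ 2 ^ f / 4) :
    ((search n a k f θ).prob I fun x c => ¬ (
      x ∈ Set.Icc ((1 - a) * (numTriangles I.graph : ℝ)) ((1 + a) * numTriangles I.graph) ∧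
      (0 < numTriangles I.graph → c ≤ f * Γ))) ≤ f * (2 * (1 / 2) ^ k) := by
  induction f generalizing θ with
  | zero =>
    have ht : numTriangles I.graph = 0 := by
      by_contra! ht
      have ht1 : (1 : ℝ) ≤ numTriangles I.graph := Nat.one_le_cast.2 (Nat.pos_of_ne_zero ht)
      have hθ3 : θ ^ 3 ≤ (1 / 4) ^ 3 := by
        gcongr
        simpa using hf (Nat.pos_of_ne_zero ht)
      norm_num at hθ3
      linarith
    simp [search, prob_pure, ht]
  | succ f ih =>
    have hsplit : ((f + 1 : ℕ) : ℝ) * (2 * (1 / 2) ^ k) =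
        2 * (1 / 2) ^ k + f * (2 * (1 / 2) ^ k) := by
      push_cast
      ring
    rw [search, hsplit]
    refine prob_bind_not_le I (by positivity)
      (prob_searchRound_not_isReliable_le I k ha ha1 hθ hn hlo) fun x c ⟨hx, hc⟩ => ?_
    have hcΓ (ht : 0 < numTriangles I.graph) : c ≤ Γ := hc.trans (hΓ ht θ hθ hlo)
    split_ifs with hle
    · rw [prob_pure, if_neg]
      · positivity
      · exact not_not.2 ⟨hx.mem_Icc hle, fun ht =>
          (hcΓ ht).trans (Nat.le_mul_of_pos_left Γ f.succ_pos)⟩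
    · refine (prob_mono I fun y c' => mt fun ⟨hy, hc'⟩ => ⟨hy, fun ht => ?_⟩).trans
        (ih (half_pos hθ) (hx.numTriangles_le ha1 (not_le.1 hle)) fun ht => ?_)
      · linarith [hf ht, pow_succ (2 : ℝ) f]
      · linarith [hcΓ ht, hc' ht]

end Search

end Program

/-! ### A sublinear estimator of the number of triangles -/

section QueryScale

/-- The leading factor of the number of queries for a graph with `t` triangles and `m` edges. -/
noncomputable def queryScale (n : ℕ) (t m : ℝ) : ℝ :=
  n / t ^ (1 / 3 : ℝ) + m ^ (3 / 2 : ℝ) / t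

variable {n : ℕ} {t m θ x : ℝ}

theorem rpow_one_third_le (hx : 0 ≤ x) (ht : 0 ≤ t) (h : t ≤ x ^ 3) : t ^ (1 / 3 : ℝ) ≤ x := by
  calc t ^ (1 / 3 : ℝ) ≤ (x ^ 3) ^ (1 / 3 : ℝ) := by gcongr
    _ = x := by
      rw [← Real.rpow_natCast, ← Real.rpow_mul hx]
      norm_num

theorem div_rpow_le_queryScale (ht : 0 ≤ t) (hm : 0 ≤ m) :
    n / t ^ (1 / 3 : ℝ) ≤ queryScale n t m :=
  le_add_of_nonneg_right (by positivity)

theorem rpow_div_le_queryScale (ht : 0 ≤ t) : m ^ (3 / 2 : ℝ) / t ≤ queryScale n t m :=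
  le_add_of_nonneg_left (by positivity)

theorem one_le_queryScale (ht : 0 < t) (hm : 0 ≤ m) (h : t ≤ (n : ℝ) ^ 3) :
    1 ≤ queryScale n t m :=
  ((one_le_div (by positivity)).2 (rpow_one_third_le n.cast_nonneg ht.le h)).trans
    (div_rpow_le_queryScale ht.le hm)

theorem div_le_queryScale (ht : 0 < t) (hm : 0 ≤ m) (hθ : 0 < θ) (h : t ≤ 16 * θ ^ 3) :
    n / θ ≤ 3 * queryScale n t m := by
  have hroot : t ^ (1 / 3 : ℝ) ≤ 3 * θ := by
    refine rpow_one_third_le (by positivity) ht.le (h.trans ?_)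
    rw [mul_pow]
    gcongr
    norm_num
  calc n / θ = 3 * (n / (3 * θ)) := by field_simp
    _ ≤ 3 * (n / t ^ (1 / 3 : ℝ)) := by gcongr
    _ ≤ 3 * queryScale n t m := by
        gcongr
        exact div_rpow_le_queryScale ht.le hm

theorem sqrt_pow_three (hm : 0 ≤ m) : √m ^ 3 = m ^ (3 / 2 : ℝ) := by
  rw [Real.sqrt_eq_rpow, ← Real.rpow_natCast, ← Real.rpow_mul hm]
  norm_num

theorem sqrt_pow_three_div_le_queryScale (ht : 0 < t) (hm : 1 ≤ m) (h : t ≤ 16 * θ ^ 3) :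
    √(512 * m + 5) ^ 3 / θ ^ 3 ≤ 194672 * queryScale n t m := by
  have hroot : √(512 * m + 5) ≤ 23 * √m := by
    rw [Real.sqrt_le_iff, mul_pow, Real.sq_sqrt (by positivity)]
    exact ⟨by positivity, by linarith⟩
  calc √(512 * m + 5) ^ 3 / θ ^ 3 ≤ (23 * √m) ^ 3 / (t / 16) := by
        gcongr
        linarith
    _ = 194672 * (m ^ (3 / 2 : ℝ) / t) := by
        rw [mul_pow, sqrt_pow_three (by positivity)]
        field_simp
        norm_num
    _ ≤ 194672 * queryScale n t m := by
        gcongr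
        exact rpow_div_le_queryScale ht.le

end QueryScale

namespace Program

variable {n : ℕ}

section RoundCost

variable {a t m θ : ℝ}

theorem guessCost_le (ha : 0 < a) (ha1 : a ≤ 1 / 2) (ht : 0 < t) (hm : 1 ≤ m) (hθ : 0 < θ)
    (hn : t ≤ (n : ℝ) ^ 3) (h : t ≤ 16 * θ ^ 3) :
    guessCost n a θ √(512 * m + 5) ≤ 3 * 10 ^ 10 * (queryScale n t m * (1 / a)) := by
  have hscale := one_le_queryScale ht (by linarith) hn (m := m)
  have ha2 : 2 ≤ 1 / a := by
    rw [le_div_iff₀ ha]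
    linarith
  calc guessCost n a θ √(512 * m + 5)
      = n / θ + 200 + 128000 * (1 / a) * (√(512 * m + 5) ^ 3 / θ ^ 3) := by
        unfold guessCost
        field_simp
    _ ≤ 3 * queryScale n t m + 200 * queryScale n t m +
          128000 * (1 / a) * (194672 * queryScale n t m) := by
        gcongr
        exacts [div_le_queryScale ht (by linarith) hθ h, by linarith,
          sqrt_pow_three_div_le_queryScale ht hm h]
    _ ≤ 3 * 10 ^ 10 * (queryScale n t m * (1 / a)) := by nlinarith

theorem repetitions_le (ha : 0 < a) (ha1 : a ≤ 1) :
    (repetitions a : ℝ) ≤ 4915201 * (1 / a) ^ 3 := by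
  have hcube : 1 ≤ (1 / a) ^ 3 := one_le_pow₀ ((one_le_div ha).2 ha1)
  calc (repetitions a : ℝ) ≤ 4915200 / a ^ 3 + 1 := (Nat.ceil_lt_add_one (by positivity)).le
    _ ≤ 4915201 * (1 / a) ^ 3 := by
        rw [div_eq_mul_one_div, ← one_div_pow]
        linarith

theorem roundCost_le (k : ℕ) (ha : 0 < a) (ha1 : a ≤ 1 / 2) (ht : 0 < t) (hm : 1 ≤ m)
    (hθ : 0 < θ) (hn : t ≤ (n : ℝ) ^ 3) (h : t ≤ 16 * θ ^ 3) :
    (roundCost n a k m θ : ℝ) ≤ 10 ^ 19 * k * queryScale n t m * (1 / a) ^ 4 := by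
  have hscale := one_le_queryScale ht (by linarith) hn (m := m)
  have hcost0 : 0 ≤ guessCost n a θ √(512 * m + 5) := by unfold guessCost; positivity
  have hle : queryScale n t m ≤ queryScale n t m * (1 / a) ^ 4 :=
    le_mul_of_one_le_right (by linarith) (one_le_pow₀ ((one_le_div ha).2 (by linarith)))
  have hedges : (⌈32768 * (n / θ)⌉₊ : ℝ) ≤ 32768 * (3 * queryScale n t m) + 1 :=
    (Nat.ceil_lt_add_one (by positivity)).le.trans <| by
      gcongr
      exact div_le_queryScale ht (by linarith) hθ h
  have htriangles : (⌈32 * repetitions a * guessCost n a θ √(512 * m + 5)⌉₊ : ℝ) ≤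
      32 * (4915201 * (1 / a) ^ 3) * (3 * 10 ^ 10 * (queryScale n t m * (1 / a))) + 1 :=
    (Nat.ceil_lt_add_one (by positivity)).le.trans <| by
      gcongr
      exacts [repetitions_le ha (by linarith), guessCost_le ha ha1 ht hm hθ hn h]
  calc (roundCost n a k m θ : ℝ)
      = k * (⌈32768 * (n / θ)⌉₊ +
          ⌈32 * repetitions a * guessCost n a θ √(512 * m + 5)⌉₊ : ℝ) := by
        rw [roundCost]
        push_cast
        ring
    _ ≤ k * (10 ^ 19 * (queryScale n t m * (1 / a) ^ 4)) := by
        gcongr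
        linarith
    _ = 10 ^ 19 * k * queryScale n t m * (1 / a) ^ 4 := by ring

end RoundCost

section Estimator

/-- The number of rounds of the search. -/
def numRounds (n : ℕ) : ℕ := Nat.log 2 n + 3

/-- The number of runs whose median is taken, for the failure probability `δ` of the search. -/
noncomputable def numRuns (n : ℕ) (δ : ℝ) : ℕ := ⌈2 * Real.log (2 * numRounds n / δ)⌉₊

variable {δ : ℝ}

theorem numRounds_pos (n : ℕ) : 0 < numRounds n := Nat.succ_pos _

theorem numRounds_le (hn : 0 < n) : (numRounds n : ℝ) ≤ 3 + 2 * Real.log n := by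
  have hpow : (2 : ℝ) ^ Nat.log 2 n ≤ n := by exact_mod_cast Nat.pow_log_le_self 2 hn.ne'
  have hlog := Real.log_le_log (by positivity) hpow
  have hlog2 := Real.log_two_gt_d9
  have hnonneg := (Nat.log 2 n).cast_nonneg (α := ℝ)
  rw [Real.log_pow] at hlog
  rw [numRounds, Nat.cast_add, Nat.cast_ofNat]
  nlinarith

theorem le_two_pow_numRounds (n : ℕ) : (n : ℝ) ≤ 2 ^ numRounds n / 4 := by
  calc (n : ℝ) ≤ 2 ^ (Nat.log 2 n + 1) := by
        exact_mod_cast (Nat.lt_pow_succ_log_self one_lt_two n).le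
    _ = 2 ^ numRounds n / 4 := by
        rw [numRounds]
        ring

theorem numRuns_le (hn : 0 < n) (hδ : 0 < δ) (hδ1 : δ ≤ 1) :
    (numRuns n δ : ℝ) ≤ 13 + 8 * Real.log n + 2 * Real.log (1 / δ) := by
  have hrounds := numRounds_pos n
  have hlogδ : 0 ≤ Real.log (1 / δ) := Real.log_nonneg ((one_le_div hδ).2 hδ1)
  have hlog : Real.log (2 * numRounds n / δ) ≤ 2 * numRounds n + Real.log (1 / δ) := by
    rw [div_eq_mul_one_div, Real.log_mul (by positivity) (by positivity)]
    gcongr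
    exact Real.log_le_self (by positivity)
  calc (numRuns n δ : ℝ) ≤ ⌈2 * (2 * numRounds n + Real.log (1 / δ))⌉₊ := by
        unfold numRuns
        gcongr
    _ ≤ 2 * (2 * numRounds n + Real.log (1 / δ)) + 1 := (Nat.ceil_lt_add_one (by positivity)).le
    _ ≤ 13 + 8 * Real.log n + 2 * Real.log (1 / δ) := by linarith [numRounds_le hn]

theorem numRounds_mul_pow_numRuns_le (n : ℕ) (hδ : 0 < δ) :
    numRounds n * (2 * (1 / 2 : ℝ) ^ numRuns n δ) ≤ δ := by
  have hrounds := numRounds_pos n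
  have hlog : 2 * Real.log (2 * numRounds n / δ) ≤ numRuns n δ := Nat.le_ceil _
  have hlog2 := Real.log_two_gt_d9
  have hpow : (2 * numRounds n / δ : ℝ) ≤ 2 ^ numRuns n δ := by
    rw [← Real.log_le_log_iff (by positivity) (by positivity), Real.log_pow]
    nlinarith [(numRuns n δ).cast_nonneg (α := ℝ)]
  rw [div_le_iff₀ hδ] at hpow
  calc numRounds n * (2 * (1 / 2 : ℝ) ^ numRuns n δ)
      = 2 * numRounds n * (1 / 2 : ℝ) ^ numRuns n δ := by ring
    _ ≤ 2 ^ numRuns n δ * δ * (1 / 2 : ℝ) ^ numRuns n δ := by gcongr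
    _ = δ := by
        rw [mul_right_comm, ← mul_pow]
        norm_num

/-- An estimator of the number of triangles with relative error `a` and failure probability `δ`. -/
noncomputable def sublinearEstimator (n : ℕ) (a δ : ℝ) : Program n ℝ :=
  search n a (numRuns n δ) (numRounds n) n

theorem search_cost_le {a t m : ℝ} (hn : 0 < n) (ha : 0 < a) (hδ : 0 < δ) (hδ1 : δ ≤ 1)
    (hscale : 0 ≤ queryScale n t m) :
    numRounds n * (10 ^ 19 * numRuns n δ * queryScale n t m * (1 / a) ^ 4) ≤
      10 ^ 21 * queryScale n t m * (1 + Real.log n + 1 / a + Real.log (1 / δ)) ^ 6 := by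
  have hlogn : 0 ≤ Real.log n := Real.log_natCast_nonneg n
  have hlogδ : 0 ≤ Real.log (1 / δ) := Real.log_nonneg ((one_le_div hδ).2 hδ1)
  have hinv : 0 ≤ 1 / a := by positivity
  set L := 1 + Real.log n + 1 / a + Real.log (1 / δ)
  calc _ ≤ 3 * L * (10 ^ 19 * (17 * L) * queryScale n t m * L ^ 4) := by
        gcongr
        · linarith [numRounds_le hn]
        · linarith [numRuns_le hn hδ hδ1]
        · linarith
    _ = 510 * 10 ^ 18 * queryScale n t m * L ^ 6 := by ring
    _ ≤ 10 ^ 21 * queryScale n t m * L ^ 6 := by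
        gcongr
        norm_num

theorem prob_sublinearEstimator_not_le (I : GraphInput n) (hn : 0 < n) {a : ℝ} (ha : 0 < a)
    (ha1 : a ≤ 1 / 2) (hδ : 0 < δ) (hδ1 : δ ≤ 1) :
    ((sublinearEstimator n a δ).prob I fun x c => ¬ (
      x ∈ Set.Icc ((1 - a) * (numTriangles I.graph : ℝ)) ((1 + a) * numTriangles I.graph) ∧
      (0 < numTriangles I.graph → (c : ℝ) ≤ 10 ^ 21 *
        queryScale n (numTriangles I.graph) (numEdges I.graph) *
        (1 + Real.log n + 1 / a + Real.log (1 / δ)) ^ 6))) ≤ δ := by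
  set k := numRuns n δ
  set Q := queryScale n (numTriangles I.graph) (numEdges I.graph) with hQ
  have hQ0 : 0 ≤ Q := by
    rw [hQ, queryScale]
    positivity
  have hn0 : (0 : ℝ) < n := Nat.cast_pos.2 hn
  have hround (ht : 0 < numTriangles I.graph) (θ : ℝ) (hθ : 0 < θ)
      (hlo : (numTriangles I.graph : ℝ) ≤ 16 * θ ^ 3) :
      roundCost n a k (numEdges I.graph) θ ≤ ⌊10 ^ 19 * k * Q * (1 / a) ^ 4⌋₊ :=
    Nat.le_floor (roundCost_le k ha ha1 (Nat.cast_pos.2 ht)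
      (Nat.one_le_cast.2 (I.numEdges_pos ht)) hθ I.numTriangles_le hlo)
  have hstart : (numTriangles I.graph : ℝ) ≤ 16 * (n : ℝ) ^ 3 :=
    I.numTriangles_le.trans (le_mul_of_one_le_left (by positivity) (by norm_num))
  refine (prob_mono I fun x c => mt fun ⟨hx, hc⟩ => ⟨hx, fun ht => ?_⟩).trans
    ((prob_search_not_le I k ha ha1 hn hround (numRounds n) hn0 hstart
      fun _ => le_two_pow_numRounds n).trans (numRounds_mul_pow_numRuns_le n hδ))
  calc (c : ℝ) ≤ numRounds n * ⌊10 ^ 19 * k * Q * (1 / a) ^ 4⌋₊ := by exact_mod_cast hc ht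
    _ ≤ numRounds n * (10 ^ 19 * k * Q * (1 / a) ^ 4) := by
        gcongr
        exact Nat.floor_le (by positivity)
    _ ≤ _ := search_cost_le hn ha hδ hδ1 hQ0

end Estimator

end Program

/-! ### The truncated geometric mechanism -/

/-- The probability that the truncated geometric mechanism on `{0, …, K}` with parameter `a` moves
`i` to `j`. -/
noncomputable def geometricWeight (a : ℝ) (K i j : ℕ) : ℝ :=
  (if j = 0 ∨ j = K then 1 else 1 - a) / (1 + a) * a ^ Nat.dist i j

/-- The distribution function of the truncated geometric mechanism: the probability that `i` is
moved to a number (strictly) below `j`. -/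
noncomputable def geometricCDF (a : ℝ) (K i j : ℕ) : ℝ :=
  if j = 0 then 0 else if K < j then 1 else
    if j ≤ i then a ^ (i + 1 - j) / (1 + a) else 1 - a ^ (j - i) / (1 + a)

section Geometric

variable {a : ℝ} {K : ℕ}

theorem geometricWeight_nonneg (ha : 0 ≤ a) (ha1 : a ≤ 1) (i j : ℕ) :
    0 ≤ geometricWeight a K i j := by
  have : 0 ≤ 1 - a := by linarith
  unfold geometricWeight
  split_ifs <;> positivity

theorem pow_mul_geometricWeight_le (ha : 0 ≤ a) (ha1 : a ≤ 1) {i i' D : ℕ}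
    (h : Nat.dist i i' ≤ D) (j : ℕ) :
    a ^ D * geometricWeight a K i j ≤ geometricWeight a K i' j := by
  have hd : Nat.dist i' j ≤ D + Nat.dist i j :=
    (Nat.dist.triangle_inequality i' i j).trans (by rw [Nat.dist_comm]; gcongr)
  have hc : 0 ≤ (if j = 0 ∨ j = K then 1 else 1 - a) / (1 + a) := by
    have : 0 ≤ 1 - a := by linarith
    split_ifs <;> positivity
  calc a ^ D * geometricWeight a K i j
      = (if j = 0 ∨ j = K then 1 else 1 - a) / (1 + a) * a ^ (D + Nat.dist i j) := by
        rw [geometricWeight, pow_add]; ring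
    _ ≤ geometricWeight a K i' j := mul_le_mul_of_nonneg_left (pow_le_pow_of_le_one ha ha1 hd) hc

theorem geometricCDF_of_le {i j : ℕ} (hj : 0 < j) (hji : j ≤ i) (hi : i ≤ K) :
    geometricCDF a K i j = a ^ (i + 1 - j) / (1 + a) := by
  rw [geometricCDF, if_neg hj.ne', if_neg (hji.trans hi).not_gt, if_pos hji]

theorem geometricCDF_of_lt {i j : ℕ} (hij : i < j) (hj : j ≤ K) :
    geometricCDF a K i j = 1 - a ^ (j - i) / (1 + a) := by
  rw [geometricCDF, if_neg (Nat.ne_zero_of_lt hij), if_neg hj.not_gt, if_neg hij.not_ge]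

@[simp] theorem geometricCDF_zero (i : ℕ) : geometricCDF a K i 0 = 0 := if_pos rfl

@[simp] theorem geometricCDF_last (i : ℕ) : geometricCDF a K i (K + 1) = 1 := by
  rw [geometricCDF, if_neg K.succ_ne_zero, if_pos K.lt_succ_self]

theorem geometricWeight_eq_sub (ha : 0 ≤ a) (hK : 0 < K) {i j : ℕ} (hi : i ≤ K) (hj : j ≤ K) :
    geometricWeight a K i j = geometricCDF a K i (j + 1) - geometricCDF a K i j := by
  have h1 : 1 + a ≠ 0 := by positivity
  rcases j.eq_zero_or_pos with rfl | hj0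
  · rw [geometricWeight, if_pos (Or.inl rfl), geometricCDF_zero, sub_zero, Nat.dist_zero_right,
      zero_add]
    rcases i.eq_zero_or_pos with rfl | hi0
    · rw [geometricCDF_of_lt zero_lt_one hK]
      field_simp; ring
    · rw [geometricCDF_of_le zero_lt_one hi0 hi, Nat.add_sub_cancel]
      ring
  rcases hj.lt_or_eq with hjK | rfl
  · rw [geometricWeight, if_neg (not_or.2 ⟨hj0.ne', hjK.ne⟩)]
    rcases lt_trichotomy j i with h | rfl | h
    · rw [geometricCDF_of_le j.succ_pos h hi, geometricCDF_of_le hj0 h.le hi,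
        Nat.dist_eq_sub_of_le_right h.le, Nat.add_sub_add_right, Nat.sub_add_comm h.le, pow_succ]
      ring
    · rw [geometricCDF_of_lt j.lt_add_one hjK, geometricCDF_of_le hj0 le_rfl hi, Nat.dist_self,
        Nat.add_sub_cancel_left]
      field_simp; ring
    · rw [geometricCDF_of_lt (h.trans j.lt_add_one) hjK, geometricCDF_of_lt h hj,
        Nat.dist_eq_sub_of_le h.le, Nat.sub_add_comm h.le, pow_succ]
      ring
  · rw [geometricWeight, if_pos (Or.inr rfl), geometricCDF_last]
    rcases hi.lt_or_eq with h | rfl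
    · rw [geometricCDF_of_lt h le_rfl, Nat.dist_eq_sub_of_le h.le]
      ring
    · rw [geometricCDF_of_le hj0 le_rfl le_rfl, Nat.dist_self, Nat.add_sub_cancel_left]
      field_simp; ring

theorem sum_range_geometricWeight (ha : 0 ≤ a) (hK : 0 < K) {i l : ℕ} (hi : i ≤ K)
    (hl : l ≤ K + 1) : ∑ j ∈ Finset.range l, geometricWeight a K i j = geometricCDF a K i l := by
  rw [Finset.sum_congr rfl fun j hj => geometricWeight_eq_sub ha hK hi
    (Nat.le_of_lt_succ ((Finset.mem_range.1 hj).trans_le hl)), Finset.sum_range_sub,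
    geometricCDF_zero, sub_zero]

theorem sum_range_sub_geometricWeight_le (ha : 0 ≤ a) (hK : 0 < K) {i s : ℕ} (hi : i ≤ K)
    (hs : 0 < s) :
    ∑ j ∈ Finset.range (i + 1 - s), geometricWeight a K i j ≤ a ^ s / (1 + a) := by
  rw [sum_range_geometricWeight ha hK hi (by omega)]
  rcases lt_or_ge i s with h | h
  · rw [Nat.sub_eq_zero_of_le h, geometricCDF_zero]
    positivity
  · rw [geometricCDF_of_le (by omega) (by omega) hi, Nat.sub_sub_self (by omega)]

theorem sum_Ico_add_geometricWeight_le (ha : 0 ≤ a) (hK : 0 < K) {i s : ℕ} (hi : i ≤ K)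
    (hs : 0 < s) :
    ∑ j ∈ Finset.Ico (i + s) (K + 1), geometricWeight a K i j ≤ a ^ s / (1 + a) := by
  rcases lt_or_ge K (i + s) with h | h
  · rw [Finset.Ico_eq_empty_of_le h, Finset.sum_empty]
    positivity
  · rw [Finset.sum_Ico_eq_sub _ (h.trans K.le_succ), sum_range_geometricWeight ha hK hi le_rfl,
      sum_range_geometricWeight ha hK hi (h.trans K.le_succ), geometricCDF_last,
      geometricCDF_of_lt (by omega) h, Nat.add_sub_cancel_left, sub_sub_cancel]

end Geometric

/-- The law on `{0, …, K}` of the result of the truncated geometric mechanism for the starting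
point `i`. -/
noncomputable def geometricMechanism (a : unitInterval) {K : ℕ} (hK : 0 < K) (i : Fin (K + 1)) :
    stdSimplex ℝ (Fin (K + 1)) :=
  ⟨fun j => geometricWeight a K i j, fun j => geometricWeight_nonneg a.2.1 a.2.2 i j, by
    rw [Fin.sum_univ_eq_sum_range (geometricWeight a K i),
      sum_range_geometricWeight a.2.1 hK i.is_le le_rfl, geometricCDF_last]⟩

/-! ### Perturbing the result of a program -/

section Mass

variable {ι : Type*} [Fintype ι]

open Classical in
/-- The mass that the weights `w` give to the set `S`. -/
noncomputable def mass (w : ι → ℝ) (S : Set ι) : ℝ := ∑ i with i ∈ S, w i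

theorem mass_nonneg (w : stdSimplex ℝ ι) (S : Set ι) : 0 ≤ mass w S :=
  Finset.sum_nonneg fun _ _ => stdSimplex.zero_le w _

theorem mass_mono (w : stdSimplex ℝ ι) {S T : Set ι} (h : S ⊆ T) : mass w S ≤ mass w T :=
  Finset.sum_le_sum_of_subset_of_nonneg (by gcongr)
    fun _ _ _ => stdSimplex.zero_le w _

theorem mass_le_one (w : stdSimplex ℝ ι) (S : Set ι) : mass w S ≤ 1 := by
  classical
  rw [← stdSimplex.sum_eq_one w]
  exact Finset.sum_le_sum_of_subset_of_nonneg (Finset.filter_subset _ _)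
    fun _ _ _ => stdSimplex.zero_le w _

theorem le_mass (w : stdSimplex ℝ ι) {S : Set ι} {i : ι} (hi : i ∈ S) : w i ≤ mass w S :=
  Finset.single_le_sum (f := w) (fun _ _ => stdSimplex.zero_le w _) (by simpa using hi)

theorem mass_empty (w : ι → ℝ) : mass w ∅ = 0 := by simp [mass]

theorem mul_mass_le_mass {w w' : ι → ℝ} {r : ℝ} (h : ∀ i, r * w i ≤ w' i) (S : Set ι) :
    r * mass w S ≤ mass w' S := by
  rw [mass, Finset.mul_sum]
  exact Finset.sum_le_sum fun i _ => h i

theorem mass_geometricMechanism_setOf_le_dist_le (a : unitInterval) {K : ℕ} (hK : 0 < K)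
    (i : Fin (K + 1)) {s : ℕ} (hs : 0 < s) :
    mass (geometricMechanism a hK i) {j | s ≤ Nat.dist i j} ≤ 2 * (a : ℝ) ^ s / (1 + a) := by
  have hsub : {j ∈ Finset.range (K + 1) | s ≤ Nat.dist i j} ⊆
      Finset.range (i + 1 - s) ∪ Finset.Ico (i + s) (K + 1) := fun j hj => by
    rw [Finset.mem_filter, Finset.mem_range] at hj
    rw [Finset.mem_union, Finset.mem_range, Finset.mem_Ico]
    unfold Nat.dist at hj
    omega
  calc mass (geometricMechanism a hK i) {j | s ≤ Nat.dist i j}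
      = ∑ j ∈ Finset.range (K + 1) with s ≤ Nat.dist i j, geometricWeight a K i j := by
        rw [Finset.sum_filter, ← Fin.sum_univ_eq_sum_range
          (fun j => if s ≤ Nat.dist i j then geometricWeight a K i j else 0), mass,
          ← Finset.sum_filter]
        congr!
    _ ≤ ∑ j ∈ Finset.range (i + 1 - s) ∪ Finset.Ico (i + s) (K + 1), geometricWeight a K i j :=
        Finset.sum_le_sum_of_subset_of_nonneg hsub
          fun j _ _ => geometricWeight_nonneg a.2.1 a.2.2 i j
    _ = ∑ j ∈ Finset.range (i + 1 - s), geometricWeight a K i j +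
          ∑ j ∈ Finset.Ico (i + s) (K + 1), geometricWeight a K i j :=
        Finset.sum_union (Finset.disjoint_left.2 fun j => by
          rw [Finset.mem_range, Finset.mem_Ico]; omega)
    _ ≤ (a : ℝ) ^ s / (1 + a) + (a : ℝ) ^ s / (1 + a) :=
        add_le_add (sum_range_sub_geometricWeight_le a.2.1 hK i.is_le hs)
          (sum_Ico_add_geometricWeight_le a.2.1 hK i.is_le hs)
    _ = 2 * (a : ℝ) ^ s / (1 + a) := by ring

variable [Nonempty ι]

/-- The mixture of the law `w`, with weight `1 - ζ`, and of the uniform law, with weight `ζ`. -/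
noncomputable def mixUniform (ζ : unitInterval) (w : stdSimplex ℝ ι) : stdSimplex ℝ ι :=
  ⟨(1 - ζ : ℝ) • ⇑w + (ζ : ℝ) • ⇑(stdSimplex.barycenter : stdSimplex ℝ ι),
    convex_stdSimplex ℝ ι w.2 stdSimplex.barycenter.2 (sub_nonneg.2 ζ.2.2) ζ.2.1 (by ring)⟩

theorem mass_mixUniform (ζ : unitInterval) (w : stdSimplex ℝ ι) (S : Set ι) :
    mass (mixUniform ζ w) S =
      (1 - ζ) * mass w S + ζ * mass (stdSimplex.barycenter : stdSimplex ℝ ι) S := by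
  simp only [mass, Finset.mul_sum, ← Finset.sum_add_distrib]
  rfl

theorem mass_mixUniform_le (ζ : unitInterval) (w : stdSimplex ℝ ι) (S : Set ι) :
    mass (mixUniform ζ w) S ≤ mass w S + ζ := by
  rw [mass_mixUniform]
  gcongr
  · exact mul_le_of_le_one_left (mass_nonneg w S) (sub_le_self _ ζ.2.1)
  · exact mul_le_of_le_one_right ζ.2.1 (mass_le_one _ S)

end Mass

namespace Program

variable {n k : ℕ} {α β : Type}

/-- Replace the result `x` of a program by `out j`, where `j` is drawn from the law `κ x`. -/
noncomputable def perturb (A : Program n α) (κ : α → stdSimplex ℝ (Fin k)) (out : Fin k → β) :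
    Program n β :=
  A.bind fun x => .rand (κ x) fun j => pure (out j)

section Perturb

variable (I : GraphInput n) (A : Program n α) (κ : α → stdSimplex ℝ (Fin k)) (out : Fin k → β)

theorem prob_rand_pure (w : stdSimplex ℝ (Fin k)) (S : Set β) :
    ((rand w fun j => pure (out j)).prob I fun y _ => y ∈ S) = mass w (out ⁻¹' S) := by
  classical
  simp only [prob_rand, prob_pure, mass, mul_ite, mul_one, mul_zero, Finset.sum_filter,
    Set.mem_preimage]

theorem prob_perturb (S : Set β) :
    ((A.perturb κ out).prob I fun y _ => y ∈ S) =
      A.expect I fun x _ => mass (κ x) (out ⁻¹' S) := by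
  simp only [perturb, prob_bind, prob_rand_pure]

theorem prob_perturb_cost (P : ℕ → Prop) :
    ((A.perturb κ out).prob I fun _ c => P c) = A.prob I fun _ c => P c := by
  classical
  simp only [perturb, prob_bind, prob_rand, prob_pure, ← Finset.sum_mul, stdSimplex.sum_eq_one,
    one_mul, add_zero, expect_ite]

variable {I A κ out} {ζ : unitInterval}

theorem prob_perturb_mixUniform_notMem_le [NeZero k] {G : Set α} {S : Set β} {δ τ : ℝ}
    (hτ : 0 ≤ τ) (hA : (A.prob I fun x _ => x ∉ G) ≤ δ)
    (hκ : ∀ x ∈ G, mass (κ x) {j | out j ∉ S} ≤ τ) :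
    ((A.perturb (fun x => mixUniform ζ (κ x)) out).prob I fun y _ => y ∉ S) ≤ δ + (τ + ζ) := by
  refine prob_bind_not_le I (P := fun x _ => x ∈ G) (add_nonneg hτ ζ.2.1) hA fun x _ hx => ?_
  exact (prob_rand_pure I out _ Sᶜ).le.trans
    ((mass_mixUniform_le ζ (κ x) _).trans (add_le_add (hκ x hx) le_rfl))

theorem mul_expect_sub_le_expect {I₁ I₂ : GraphInput n} {g : α → ℝ} (hg0 : ∀ x, 0 ≤ g x)
    (hg1 : ∀ x, g x ≤ 1) {G₁ G₂ : Set α} {δ r : ℝ} (hr : 0 ≤ r)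
    (h₁ : (A.prob I₁ fun x _ => x ∉ G₁) ≤ δ) (h₂ : (A.prob I₂ fun x _ => x ∉ G₂) ≤ δ)
    (hδ : δ ≤ 1) (h : ∀ x ∈ G₁, ∀ y ∈ G₂, r * g x ≤ g y) :
    r * (1 - δ) * ((A.expect I₁ fun x _ => g x) - δ) ≤ A.expect I₂ fun x _ => g x := by
  classical
  set p := A.expect I₁ fun x _ => g x
  have hP₂ : 0 ≤ A.expect I₂ fun x _ => g x := expect_nonneg I₂ fun x _ => hg0 x
  have hcross : ∀ y ∈ G₂, r * (p - δ) ≤ g y := fun y hy => by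
    suffices r * p ≤ r * δ + g y by linarith
    calc r * p = A.expect I₁ fun x _ => r * g x := (expect_const_mul ..).symm
      _ ≤ A.expect I₁ fun x _ => r * (if x ∉ G₁ then 1 else 0) + g y :=
          expect_mono I₁ fun x _ => by
            by_cases hx : x ∈ G₁
            · simpa [hx] using h x hx y hy
            · simpa [hx] using
                (mul_le_of_le_one_right hr (hg1 x)).trans (le_add_of_nonneg_right (hg0 y))
      _ ≤ r * δ + g y := by
          rw [expect_add, expect_const_mul, expect_const, expect_ite]
          gcongr
  rcases le_total p δ with hp | hp
  · exact (mul_nonpos_of_nonneg_of_nonpos (mul_nonneg hr (sub_nonneg.2 hδ))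
      (sub_nonpos.2 hp)).trans hP₂
  · have : 0 ≤ r * (p - δ) := mul_nonneg hr (sub_nonneg.2 hp)
    calc r * (1 - δ) * (p - δ) = r * (p - δ) * (1 - δ) := by ring
      _ ≤ r * (p - δ) * (1 - A.prob I₂ fun x _ => x ∉ G₂) := by gcongr
      _ = A.expect I₂ fun x _ => r * (p - δ) * (1 - if x ∉ G₂ then 1 else 0) := by
          rw [expect_const_mul, expect_sub, expect_const, expect_ite]
      _ ≤ A.expect I₂ fun x _ => g x := expect_mono I₂ fun y _ => by
          by_cases hy : y ∈ G₂
          · simpa [hy] using hcross y hy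
          · simpa [hy] using hg0 y

/-- The uniform part of the mixture gives every possible result a probability of at least `ζ / k`;
this absorbs the event of probability `δ` on which the program fails, so that privacy holds without
an additive error. -/
theorem prob_perturb_mixUniform_le [NeZero k] {I₁ I₂ : GraphInput n} {G₁ G₂ : Set α} {δ r e : ℝ}
    (h₁ : (A.prob I₁ fun x _ => x ∉ G₁) ≤ δ) (h₂ : (A.prob I₂ fun x _ => x ∉ G₂) ≤ δ)
    (hr : 0 ≤ r) (hκ : ∀ x ∈ G₁, ∀ y ∈ G₂, ∀ j, r * κ x j ≤ κ y j) (he : 1 ≤ e)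
    (hδ0 : 0 ≤ δ) (hδ1 : δ ≤ 1) (hre : 1 ≤ e * (r * (1 - δ))) (hδk : δ * k ≤ (e - 1) * ζ)
    (S : Set β) :
    ((A.perturb (fun x => mixUniform ζ (κ x)) out).prob I₁ fun y _ => y ∈ S) ≤
      e * (A.perturb (fun x => mixUniform ζ (κ x)) out).prob I₂ fun y _ => y ∈ S := by
  simp only [prob_perturb, mass_mixUniform, expect_add, expect_const_mul, expect_const]
  rcases (out ⁻¹' S).eq_empty_or_nonempty with hS | ⟨j, hj⟩
  · simp only [hS, mass_empty, expect_const, mul_zero, add_zero, le_refl]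
  set p₁ := A.expect I₁ fun x _ => mass (κ x) (out ⁻¹' S)
  set p₂ := A.expect I₂ fun x _ => mass (κ x) (out ⁻¹' S)
  set u := mass (stdSimplex.barycenter : stdSimplex ℝ (Fin k)) (out ⁻¹' S)
  have hk : (0 : ℝ) < k := Nat.cast_pos.2 (NeZero.pos k)
  have hp₂ : 0 ≤ p₂ := expect_nonneg I₂ fun x _ => mass_nonneg _ _
  have hp : p₁ - δ ≤ e * p₂ := by
    rcases le_total p₁ δ with h | h
    · exact (sub_nonpos.2 h).trans (mul_nonneg (zero_le_one.trans he) hp₂)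
    calc p₁ - δ ≤ e * (r * (1 - δ)) * (p₁ - δ) := le_mul_of_one_le_left (sub_nonneg.2 h) hre
      _ = e * (r * (1 - δ) * (p₁ - δ)) := by ring
      _ ≤ e * p₂ := by
          gcongr
          exact mul_expect_sub_le_expect (fun x => mass_nonneg _ _) (fun x => mass_le_one _ _) hr
            h₁ h₂ hδ1 fun x hx y hy => mul_mass_le_mass (hκ x hx y hy) _
  have hu : (k : ℝ)⁻¹ ≤ u := by
    have hcard : (k : ℝ)⁻¹ = (Fintype.card (Fin k) : ℝ)⁻¹ := by rw [Fintype.card_fin]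
    exact hcard.trans_le (le_mass (stdSimplex.barycenter : stdSimplex ℝ (Fin k)) hj)
  have hδu : δ ≤ (e - 1) * ζ * u := by
    have : 0 ≤ (e - 1) * (ζ : ℝ) := mul_nonneg (sub_nonneg.2 he) ζ.2.1
    calc δ = δ * k * (k : ℝ)⁻¹ := by field_simp
      _ ≤ (e - 1) * ζ * u := by gcongr
  have hζp : (1 - ζ : ℝ) * (p₁ - δ) ≤ (1 - ζ) * (e * p₂) :=
    mul_le_mul_of_nonneg_left hp (sub_nonneg.2 ζ.2.2)
  linarith [mul_nonneg ζ.2.1 hδ0]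

end Perturb

end Program

/-! ### The logarithmic grid -/

/-- The index of the grid point below `x` in the logarithmic grid with offset `N`, step `g` and
`K + 1` points. -/
noncomputable def gridIndex (N g : ℝ) (K : ℕ) (x : ℝ) : Fin (K + 1) :=
  ⟨min ⌊Real.log (1 + x / N) / g⌋₊ K, Nat.lt_succ_of_le (min_le_right _ _)⟩

/-- The `j`-th point of the logarithmic grid with offset `N` and step `g`. -/
noncomputable def gridPoint (N g : ℝ) (j : ℕ) : ℝ := N * (Real.exp (g * j) - 1)

section Grid

variable {N g : ℝ} {K : ℕ}

theorem gridIndex_le_add (hN : 0 < N) (hg : 0 < g) {x y w : ℝ} (hx : 0 ≤ x) (hy : 0 ≤ y)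
    (h : 1 + x / N ≤ Real.exp w * (1 + y / N)) :
    (gridIndex N g K x : ℕ) ≤ gridIndex N g K y + ⌈w / g⌉₊ := by
  have hx1 : 0 < 1 + x / N := by positivity
  have hy1 : 1 ≤ 1 + y / N := le_add_of_nonneg_right (div_nonneg hy hN.le)
  have hlog : Real.log (1 + x / N) ≤ w + Real.log (1 + y / N) := by
    have := Real.log_le_log hx1 h
    rwa [Real.log_mul (Real.exp_pos w).ne' (by positivity), Real.log_exp] at this
  have hle : Real.log (1 + x / N) / g ≤ Real.log (1 + y / N) / g + ⌈w / g⌉₊ := by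
    calc Real.log (1 + x / N) / g ≤ (w + Real.log (1 + y / N)) / g := by gcongr
      _ = Real.log (1 + y / N) / g + w / g := by rw [add_div, add_comm]
      _ ≤ Real.log (1 + y / N) / g + ⌈w / g⌉₊ := by gcongr; exact Nat.le_ceil _
  have hfloor := Nat.floor_le_floor hle
  rw [Nat.floor_add_natCast (div_nonneg (Real.log_nonneg hy1) hg.le)] at hfloor
  unfold gridIndex
  dsimp only
  omega

theorem one_add_div_le_exp_mul (hN : 0 < N) {a ν t t' x y : ℝ} (ha : 0 ≤ a) (ha1 : a ≤ 1 / 2)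
    (ht' : 0 ≤ t') (h : t ≤ t' + ν * N) (hν : 0 ≤ ν)
    (hx : x ≤ (1 + a) * t) (hy : (1 - a) * t' ≤ y) :
    1 + x / N ≤ Real.exp (ν + 3 * a) * (1 + y / N) := by
  have hexp : 1 ≤ Real.exp (2 * a) * (1 - a) := by
    have := Real.add_one_le_exp (2 * a)
    nlinarith
  have hup : N + x ≤ (1 + a) * ((1 + ν) * (N + t')) := by
    have : (1 + a) * t ≤ (1 + a) * (t' + ν * N) := by gcongr
    nlinarith [mul_nonneg hν ht', mul_nonneg ha (mul_nonneg hν ht'), mul_nonneg ha hN.le]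
  have hlow : (1 - a) * (N + t') ≤ N + y := by nlinarith [mul_nonneg ha hN.le]
  have : 0 ≤ N + t' := by positivity
  have key : N + x ≤ Real.exp (ν + 3 * a) * (N + y) := by
    calc N + x ≤ (1 + a) * ((1 + ν) * (N + t')) := hup
      _ ≤ Real.exp a * (Real.exp ν * (N + t')) := by
          gcongr
          · linarith [Real.add_one_le_exp a]
          · linarith [Real.add_one_le_exp ν]
      _ ≤ Real.exp a * (Real.exp ν * (N + t')) * (Real.exp (2 * a) * (1 - a)) :=
          le_mul_of_one_le_right (by positivity) hexp
      _ = Real.exp (ν + 3 * a) * ((1 - a) * (N + t')) := by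
          rw [show ν + 3 * a = a + ν + 2 * a by ring, Real.exp_add, Real.exp_add]; ring
      _ ≤ Real.exp (ν + 3 * a) * (N + y) := by gcongr
  calc 1 + x / N = (N + x) / N := by field_simp
    _ ≤ Real.exp (ν + 3 * a) * (N + y) / N := by gcongr
    _ = Real.exp (ν + 3 * a) * (1 + y / N) := by field_simp

theorem dist_gridIndex_le (hN : 0 < N) (hg : 0 < g) {a ν t t' x y : ℝ} (ha : 0 ≤ a)
    (ha1 : a ≤ 1 / 2) (ht : 0 ≤ t) (ht' : 0 ≤ t') (h : t ≤ t' + ν * N) (h' : t' ≤ t + ν * N)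
    (hν : 0 ≤ ν) (hx : x ∈ Set.Icc ((1 - a) * t) ((1 + a) * t))
    (hy : y ∈ Set.Icc ((1 - a) * t') ((1 + a) * t')) :
    Nat.dist (gridIndex N g K x) (gridIndex N g K y) ≤ ⌈(ν + 3 * a) / g⌉₊ := by
  have hx0 : 0 ≤ x := (mul_nonneg (by linarith) ht).trans hx.1
  have hy0 : 0 ≤ y := (mul_nonneg (by linarith) ht').trans hy.1
  have hxy := gridIndex_le_add (K := K) hN hg hx0 hy0
    (one_add_div_le_exp_mul hN ha ha1 ht' h hν hx.2 hy.1)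
  have hyx := gridIndex_le_add (K := K) hN hg hy0 hx0
    (one_add_div_le_exp_mul hN ha ha1 ht h' hν hy.2 hx.1)
  unfold Nat.dist
  omega

theorem gridIndex_of_le (hN : 0 < N) (hg : 0 < g) {x : ℝ} (hx : 0 ≤ x) (hxK : x ≤ K * g * N) :
    (gridIndex N g K x : ℕ) = ⌊Real.log (1 + x / N) / g⌋₊ := by
  have hlog : Real.log (1 + x / N) ≤ K * g :=
    calc Real.log (1 + x / N) ≤ 1 + x / N - 1 := Real.log_le_sub_one_of_pos (by positivity)
      _ = x / N := add_sub_cancel_left _ _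
      _ ≤ K * g := (div_le_iff₀ hN).2 hxK
  exact min_eq_left (Nat.floor_le_of_le ((div_le_iff₀ hg).2 hlog))

theorem gridPoint_mem_Icc (hN : 0 < N) (hg : 0 < g) {x : ℝ} (hx : 0 ≤ x) (hxK : x ≤ K * g * N)
    {j s : ℕ} (h : Nat.dist (gridIndex N g K x) j < s) :
    gridPoint N g j ∈ Set.Icc ((N + x) * Real.exp (-(g * s)) - N)
      ((N + x) * Real.exp (g * s) - N) := by
  have hx1 : 1 ≤ 1 + x / N := le_add_of_nonneg_right (div_nonneg hx hN.le)
  rw [gridIndex_of_le hN hg hx hxK] at h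
  set L := Real.log (1 + x / N)
  have hfloor : (⌊L / g⌋₊ : ℝ) * g ≤ L :=
    (le_div_iff₀ hg).1 (Nat.floor_le (div_nonneg (Real.log_nonneg hx1) hg.le))
  have hfloor' : L < (⌊L / g⌋₊ + 1 : ℝ) * g := (div_lt_iff₀ hg).1 (Nat.lt_floor_add_one _)
  have hup : (j : ℝ) ≤ ⌊L / g⌋₊ + s := by
    exact_mod_cast (by unfold Nat.dist at h; omega : j ≤ ⌊L / g⌋₊ + s)
  have hlow : (⌊L / g⌋₊ : ℝ) + 1 ≤ j + s := by
    exact_mod_cast (by unfold Nat.dist at h; omega : ⌊L / g⌋₊ + 1 ≤ j + s)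
  have hexp : N + x = N * Real.exp L := by
    rw [Real.exp_log (zero_lt_one.trans_le hx1)]; field_simp
  rw [hexp, mul_assoc, mul_assoc, ← Real.exp_add, ← Real.exp_add, gridPoint, mul_sub, mul_one]
  constructor
  · have : L + -(g * s) ≤ g * j := by linarith [mul_le_mul_of_nonneg_right hlow hg.le]
    gcongr
  · have : g * j ≤ L + g * s := by linarith [mul_le_mul_of_nonneg_right hup hg.le]
    gcongr

end Grid

/-! ### Elementary inequalities for the choice of the parameters -/

theorem two_mul_exp_neg_pow_div_le {c l q : ℝ} {s : ℕ} (hc : 0 < c) (hl : 1 ≤ l) (hq0 : 0 ≤ q)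
    (hq : q ≤ c / 40) (hs : 3 / 2 * c * l ≤ q * s) :
    2 * Real.exp (-q) ^ s / (1 + Real.exp (-q)) ≤
      Real.exp (-(c * l)) * Real.exp (-(19 / 40 * c)) := by
  have hexp := Real.exp_pos (-q)
  have hexp1 : Real.exp (-q) ≤ 1 := Real.exp_le_one_iff.2 (neg_nonpos.2 hq0)
  have hfactor : 2 / (1 + Real.exp (-q)) ≤ Real.exp (c / 40) :=
    calc 2 / (1 + Real.exp (-q)) ≤ 2 - Real.exp (-q) := by
          rw [div_le_iff₀ (by positivity)]; nlinarith
      _ ≤ c / 40 + 1 := by linarith [Real.one_sub_le_exp_neg q]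
      _ ≤ Real.exp (c / 40) := Real.add_one_le_exp _
  have hpow : Real.exp (-q) ^ s ≤ Real.exp (-(3 / 2 * c * l)) := by
    rw [← Real.exp_nat_mul, Real.exp_le_exp]; linarith
  calc 2 * Real.exp (-q) ^ s / (1 + Real.exp (-q))
      = 2 / (1 + Real.exp (-q)) * Real.exp (-q) ^ s := by ring
    _ ≤ Real.exp (c / 40) * Real.exp (-(3 / 2 * c * l)) := by gcongr
    _ ≤ Real.exp (-(c * l)) * Real.exp (-(19 / 40 * c)) := by
      rw [← Real.exp_add, ← Real.exp_add, Real.exp_le_exp]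
      linarith [mul_le_mul_of_nonneg_left hl hc.le]

theorem log_one_div_one_sub_exp_neg_le {x : ℝ} (hx : 0 < x) :
    Real.log (1 / (1 - Real.exp (-x))) ≤ 1 / x := by
  have hpos : 0 < 1 - Real.exp (-x) := sub_pos.2 (Real.exp_lt_one_iff.2 (neg_lt_zero.2 hx))
  have hexp : Real.exp (-x) ≤ 1 / (1 + x) := by
    rw [Real.exp_neg, ← one_div]
    exact one_div_le_one_div_of_le (by positivity) (by linarith [Real.add_one_le_exp x])
  have hinv : 1 / (1 - Real.exp (-x)) ≤ 1 + 1 / x :=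
    calc 1 / (1 - Real.exp (-x)) ≤ 1 / (1 - 1 / (1 + x)) := by
          refine one_div_le_one_div_of_le (sub_pos.2 ?_) (by linarith)
          rw [div_lt_one (by positivity)]; linarith
      _ = 1 + 1 / x := by
          rw [one_sub_div (by positivity), add_sub_cancel_left, one_div_div, add_div,
            div_self hx.ne', add_comm]
  linarith [Real.log_le_sub_one_of_pos (one_div_pos.2 hpos)]

theorem exp_le_one_add_div {α θ : ℝ} (hα : 0 < α) (hα1 : α < 1) (hθ : θ ≤ 7 * α / 128) :
    Real.exp θ ≤ 1 + α / 16 := by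
  have hlow : 1 - 7 * α / 128 ≤ Real.exp (-θ) := by linarith [Real.one_sub_le_exp_neg θ]
  calc Real.exp θ = (Real.exp (-θ))⁻¹ := by rw [Real.exp_neg, inv_inv]
    _ ≤ (1 - 7 * α / 128)⁻¹ := inv_anti₀ (by linarith) hlow
    _ ≤ 1 + α / 16 := by
        rw [inv_le_iff_one_le_mul₀ (by linarith)]
        nlinarith

/-! ### The choice of the parameters -/

/-- The share `σ` of the failure probability `n ^ (-c)` that is given to the uniform part of the
mixture, and another time to the failures of the sublinear estimator; what is left,
`1 - 2 * σ = exp (-(19 / 40 * c))`, suffices for the tail of the geometric mechanism. -/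
noncomputable def mixShare (c : ℝ) : ℝ := (1 - Real.exp (-(19 / 40 * c))) / 2

theorem mixShare_pos {c : ℝ} (hc : 0 < c) : 0 < mixShare c :=
  half_pos (sub_pos.2 (Real.exp_lt_one_iff.2 (neg_lt_zero.2 (by positivity))))

theorem mixShare_le_one (c : ℝ) : mixShare c ≤ 1 := by
  unfold mixShare
  linarith [Real.exp_pos (-(19 / 40 * c))]

/-- The confidence exponent `c`, the privacy `ε` and the accuracy `α` that the private estimator on
`n`-vertex graphs is asked for, in the range where it does not have to be trivial. -/
structure NoiseParameters (n : ℕ) where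
  c : ℝ
  ε : ℝ
  α : ℝ
  one_le_log : 1 ≤ Real.log n
  c_pos : 0 < c
  ε_pos : 0 < ε
  α_pos : 0 < α
  α_lt_one : α < 1
  mul_lt : α * ε < c * Real.log n

namespace NoiseParameters

variable {n : ℕ} (p : NoiseParameters n)

theorem one_lt_natCast (p : NoiseParameters n) : (1 : ℝ) < n :=
  (Real.log_pos_iff n.cast_nonneg).1 (zero_lt_one.trans_le p.one_le_log)

theorem natCast_pos (p : NoiseParameters n) : (0 : ℝ) < n := zero_lt_one.trans p.one_lt_natCast

theorem log_pos (p : NoiseParameters n) : 0 < Real.log n := zero_lt_one.trans_le p.one_le_log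

/-- The scale `ν` of the noise: the number of triangles is estimated up to a factor `1 ± ν / 40`. -/
noncomputable def scale : ℝ := p.α * p.ε / (32 * p.c * Real.log n)

/-- The offset of the logarithmic grid, for which adding `n` triangles is a relative change `ν`. -/
noncomputable def offset : ℝ := n / p.scale

/-- The step of the logarithmic grid. -/
noncomputable def step : ℝ := p.scale * p.α / (40 * Real.log n)

/-- A bound on the distance of the grid indices obtained on edge-neighbouring graphs. -/
noncomputable def sensitivity : ℕ := ⌈43 * Real.log n / p.α⌉₊

/-- The rate of decay of the geometric mechanism. -/
noncomputable def rate : ℝ := 39 / 40 * p.ε / p.sensitivity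

/-- A distance that the geometric mechanism moves its argument with small probability only. -/
noncomputable def radius : ℕ := ⌈3 / 2 * p.c * Real.log n / p.rate⌉₊

/-- The last index of the logarithmic grid. -/
noncomputable def gridSize : ℕ := ⌈80 * (n ^ 2 * Real.log n / p.α)⌉₊ + 1

theorem scale_pos : 0 < p.scale := by
  have := p.α_pos; have := p.ε_pos; have := p.c_pos; have := p.log_pos
  unfold scale; positivity

theorem scale_le : p.scale ≤ 1 / 32 := by
  have := p.c_pos; have := p.log_pos
  rw [scale, div_le_iff₀ (by positivity)]
  linarith [p.mul_lt]

theorem offset_pos : 0 < p.offset := div_pos p.natCast_pos p.scale_pos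

theorem scale_mul_offset : p.scale * p.offset = n := mul_div_cancel₀ _ p.scale_pos.ne'

theorem step_pos : 0 < p.step := by
  have := p.scale_pos; have := p.α_pos; have := p.log_pos
  unfold step; positivity

theorem step_le : p.step ≤ p.α / 1280 := by
  have := p.log_pos
  rw [step, div_le_iff₀ (by positivity)]
  have h₁ : p.scale * p.α ≤ 1 / 32 * p.α := mul_le_mul_of_nonneg_right p.scale_le p.α_pos.le
  have h₂ : p.α * 1 ≤ p.α * Real.log n := mul_le_mul_of_nonneg_left p.one_le_log p.α_pos.le
  linarith

theorem sensitivity_eq : p.sensitivity = ⌈(p.scale + 3 * (p.scale / 40)) / p.step⌉₊ := by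
  have := p.scale_pos.ne'; have := p.α_pos.ne'; have := p.log_pos.ne'
  unfold sensitivity step
  congr 1
  field_simp
  norm_num

theorem sensitivity_pos : (0 : ℝ) < p.sensitivity := by
  have := p.log_pos; have := p.α_pos
  exact_mod_cast Nat.ceil_pos.2 (by positivity)

theorem sensitivity_le : (p.sensitivity : ℝ) ≤ 44 * (Real.log n / p.α) := by
  have := p.log_pos; have := p.α_pos
  have hone : 1 ≤ Real.log n / p.α :=
    (one_le_div p.α_pos).2 (p.α_lt_one.le.trans p.one_le_log)
  have hceil : (p.sensitivity : ℝ) < 43 * Real.log n / p.α + 1 :=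
    Nat.ceil_lt_add_one (by positivity)
  linarith [mul_div_assoc 43 (Real.log n) p.α]

theorem rate_pos : 0 < p.rate := by
  have := p.ε_pos; have := p.sensitivity_pos
  unfold rate; positivity

theorem sensitivity_mul_rate : p.sensitivity * p.rate = 39 / 40 * p.ε :=
  mul_div_cancel₀ _ p.sensitivity_pos.ne'

theorem rate_le : p.rate ≤ p.c / 40 := by
  have hceil : 43 * Real.log n ≤ p.sensitivity * p.α := (div_le_iff₀ p.α_pos).1 (Nat.le_ceil _)
  refine le_of_mul_le_mul_right ?_ p.log_pos
  have h₁ : p.rate * (43 * Real.log n) ≤ p.rate * (p.sensitivity * p.α) :=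
    mul_le_mul_of_nonneg_left hceil p.rate_pos.le
  have h₂ : p.rate * (p.sensitivity * p.α) = 39 / 40 * (p.α * p.ε) := by
    linear_combination p.α * p.sensitivity_mul_rate
  linarith [p.mul_lt, mul_pos p.c_pos p.log_pos]

theorem radius_pos : 0 < p.radius := by
  have := p.c_pos; have := p.log_pos; have := p.rate_pos
  exact Nat.ceil_pos.2 (by positivity)

theorem le_rate_mul_radius : 3 / 2 * p.c * Real.log n ≤ p.rate * p.radius := by
  rw [mul_comm p.rate]
  exact (div_le_iff₀ p.rate_pos).1 (Nat.le_ceil _)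

theorem step_mul_radius_le : p.step * p.radius ≤ 7 * p.α / 128 := by
  have hα := p.α_pos; have hε := p.ε_pos; have hc := p.c_pos; have hl := p.log_pos
  have hstep := p.step_pos; have hD := p.sensitivity_pos; have := p.rate_pos
  have hceil : (p.radius : ℝ) ≤ 3 / 2 * p.c * Real.log n / p.rate + 1 :=
    (Nat.ceil_lt_add_one (by positivity)).le
  have hmain : p.step * (3 / 2 * p.c * Real.log n / p.rate) ≤ 66 / 39 * (p.α / 32) :=
    calc p.step * (3 / 2 * p.c * Real.log n / p.rate)
        = p.step * (20 / 13 * p.c * Real.log n / p.ε) * p.sensitivity := by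
          unfold rate; field_simp; norm_num
      _ ≤ p.step * (20 / 13 * p.c * Real.log n / p.ε) * (44 * (Real.log n / p.α)) := by
          gcongr; exact p.sensitivity_le
      _ = 66 / 39 * (p.α / 32) := by unfold step scale; field_simp; norm_num
  calc p.step * p.radius ≤ p.step * (3 / 2 * p.c * Real.log n / p.rate + 1) := by gcongr
    _ ≤ 66 / 39 * (p.α / 32) + p.α / 1280 := by
        rw [mul_add, mul_one]; exact add_le_add hmain p.step_le
    _ ≤ 7 * p.α / 128 := by linarith

theorem two_mul_pow_three_le : 2 * (n : ℝ) ^ 3 ≤ p.gridSize * p.step * p.offset := by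
  have hα := p.α_pos; have hl := p.log_pos; have hn := p.natCast_pos
  have := p.scale_pos; have := p.step_pos; have := p.offset_pos
  have hceil : 80 * (n ^ 2 * Real.log n / p.α) ≤ (p.gridSize : ℝ) := by
    rw [gridSize, Nat.cast_add_one]
    exact (Nat.le_ceil _).trans (by linarith)
  calc 2 * (n : ℝ) ^ 3 = 80 * (n ^ 2 * Real.log n / p.α) * p.step * p.offset := by
        unfold step offset; field_simp; norm_num
    _ ≤ p.gridSize * p.step * p.offset := by gcongr

theorem log_gridSize_add_one_le :
    Real.log (p.gridSize + 1) ≤ 83 + 3 * Real.log n + Real.log (1 / p.α) := by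
  have hα := p.α_pos; have hl := p.log_pos; have hn := p.natCast_pos
  have hone : 1 ≤ (n : ℝ) ^ 3 / p.α :=
    (one_le_div hα).2 (p.α_lt_one.le.trans (one_le_pow₀ p.one_lt_natCast.le))
  have hlog : (n : ℝ) ^ 2 * Real.log n / p.α ≤ (n : ℝ) ^ 3 / p.α := by
    rw [pow_succ (n : ℝ) 2]; gcongr; exact Real.log_le_self hn.le
  have hceil := Nat.ceil_lt_add_one (by positivity : 0 ≤ 80 * (n ^ 2 * Real.log n / p.α))
  have hsize : (p.gridSize + 1 : ℝ) ≤ 83 * ((n : ℝ) ^ 3 * (1 / p.α)) := by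
    rw [gridSize, Nat.cast_add_one, mul_one_div]
    linarith
  calc Real.log (p.gridSize + 1) ≤ Real.log (83 * ((n : ℝ) ^ 3 * (1 / p.α))) := by gcongr
    _ = Real.log 83 + (3 * Real.log n + Real.log (1 / p.α)) := by
        rw [Real.log_mul (by norm_num) (by positivity), Real.log_mul (by positivity)
          (by positivity), Real.log_pow, Nat.cast_ofNat]
    _ ≤ 83 + 3 * Real.log n + Real.log (1 / p.α) := by
        linarith [Real.log_le_self (by norm_num : (0 : ℝ) ≤ 83)]

theorem one_div_rpow_eq_exp (p : NoiseParameters n) (c : ℝ) :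
    1 / (n : ℝ) ^ c = Real.exp (-(c * Real.log n)) := by
  rw [Real.rpow_def_of_pos p.natCast_pos, one_div, ← Real.exp_neg, mul_comm]

/-- The ratio of the geometric mechanism. -/
noncomputable def decay : unitInterval :=
  ⟨Real.exp (-p.rate), (Real.exp_pos _).le, Real.exp_le_one_iff.2 (neg_nonpos.2 p.rate_pos.le)⟩

/-- The weight of the uniform law in the mixture with the geometric mechanism. The mixture makes
every outcome likely enough to hide the failures of the sublinear estimator. -/
noncomputable def uniformWeight : unitInterval :=
  ⟨mixShare p.c * Real.exp (-(p.c * Real.log n)),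
    mul_nonneg (mixShare_pos p.c_pos).le (Real.exp_pos _).le,
    mul_le_one₀ (mixShare_le_one _) (Real.exp_pos _).le
      (Real.exp_le_one_iff.2 (neg_nonpos.2 (mul_pos p.c_pos p.log_pos).le))⟩

/-- The failure probability of the sublinear estimator. -/
noncomputable def failureProb : ℝ :=
  p.uniformWeight * (1 - Real.exp (-(p.ε / 40))) / (p.gridSize + 1)

theorem uniformWeight_pos : (0 : ℝ) < p.uniformWeight :=
  mul_pos (mixShare_pos p.c_pos) (Real.exp_pos _)

theorem one_sub_exp_pos : 0 < 1 - Real.exp (-(p.ε / 40)) :=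
  sub_pos.2 (Real.exp_lt_one_iff.2 (neg_lt_zero.2 (div_pos p.ε_pos (by norm_num))))

theorem failureProb_pos : 0 < p.failureProb := by
  have := p.uniformWeight_pos; have := p.one_sub_exp_pos
  unfold failureProb; positivity

theorem failureProb_mul_eq :
    p.failureProb * (p.gridSize + 1) = p.uniformWeight * (1 - Real.exp (-(p.ε / 40))) :=
  div_mul_cancel₀ _ (by positivity)

theorem failureProb_mul_le :
    p.failureProb * (p.gridSize + 1) ≤ (Real.exp p.ε - 1) * p.uniformWeight := by
  rw [failureProb_mul_eq, mul_comm]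
  refine mul_le_mul_of_nonneg_right ?_ p.uniformWeight_pos.le
  linarith [Real.one_sub_le_exp_neg (p.ε / 40), Real.add_one_le_exp p.ε, p.ε_pos]

theorem failureProb_le_mul :
    p.failureProb ≤ p.uniformWeight * (1 - Real.exp (-(p.ε / 40))) :=
  p.failureProb_mul_eq ▸ le_mul_of_one_le_right p.failureProb_pos.le
    (le_add_of_nonneg_left (Nat.cast_nonneg _))

theorem failureProb_le_uniformWeight : p.failureProb ≤ p.uniformWeight :=
  p.failureProb_le_mul.trans
    (mul_le_of_le_one_right p.uniformWeight_pos.le (sub_le_self _ (Real.exp_pos _).le))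

theorem exp_neg_le_one_sub_failureProb : Real.exp (-(p.ε / 40)) ≤ 1 - p.failureProb :=
  le_sub_comm.1 (p.failureProb_le_mul.trans
    (mul_le_of_le_one_left p.one_sub_exp_pos.le p.uniformWeight.2.2))

theorem failureProb_le_one : p.failureProb ≤ 1 :=
  p.failureProb_le_uniformWeight.trans p.uniformWeight.2.2

theorem failureProb_add_le :
    p.failureProb + (2 * (p.decay : ℝ) ^ p.radius / (1 + p.decay) + p.uniformWeight) ≤
      1 / (n : ℝ) ^ p.c := by
  have htail : 2 * (p.decay : ℝ) ^ p.radius / (1 + p.decay) ≤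
      Real.exp (-(p.c * Real.log n)) * Real.exp (-(19 / 40 * p.c)) :=
    two_mul_exp_neg_pow_div_le p.c_pos p.one_le_log p.rate_pos.le p.rate_le p.le_rate_mul_radius
  have hsum : 2 * (p.uniformWeight : ℝ) +
      Real.exp (-(p.c * Real.log n)) * Real.exp (-(19 / 40 * p.c)) =
        Real.exp (-(p.c * Real.log n)) := by
    dsimp only [uniformWeight, mixShare]
    ring
  rw [p.one_div_rpow_eq_exp]
  linarith [p.failureProb_le_uniformWeight]

theorem log_one_div_failureProb_le :
    Real.log (1 / p.failureProb) ≤ Real.log (1 / mixShare p.c) + p.c * Real.log n + 40 / p.ε +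
      (83 + 3 * Real.log n + Real.log (1 / p.α)) := by
  have hσ := mixShare_pos p.c_pos; have hr := p.one_sub_exp_pos; have hε := p.ε_pos
  have heq : 1 / p.failureProb = 1 / mixShare p.c * Real.exp (p.c * Real.log n) *
      (1 / (1 - Real.exp (-(p.ε / 40)))) * (p.gridSize + 1) := by
    dsimp only [failureProb, uniformWeight]
    rw [Real.exp_neg (p.c * Real.log n)]
    field_simp
  rw [heq, Real.log_mul (by positivity) (by positivity), Real.log_mul (by positivity)
    (by positivity), Real.log_mul (by positivity) (by positivity), Real.log_exp]
  have hlog : Real.log (1 / (1 - Real.exp (-(p.ε / 40)))) ≤ 40 / p.ε :=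
    (log_one_div_one_sub_exp_neg_le (by positivity)).trans_eq (one_div_div _ _)
  linarith [p.log_gridSize_add_one_le]

end NoiseParameters

/-! ### The private estimator -/

/-- The numbers that approximate `t` with relative error `β` and additional error `η`. -/
def approxInterval (t β η : ℝ) : Set ℝ := Set.Icc ((1 - β) * t - η) ((1 + β) * t + η)

theorem approxInterval_subset {t β β' η η' : ℝ} (ht : 0 ≤ t) (hβ : β ≤ β') (hη : η ≤ η') :
    approxInterval t β η ⊆ approxInterval t β' η' := by
  unfold approxInterval
  gcongr

theorem zero_mem_approxInterval {t β η : ℝ} (ht : 0 ≤ t) (hη : 0 ≤ η) (h : t = 0 ∨ 1 ≤ β) :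
    0 ∈ approxInterval t β η := by
  rcases h with rfl | h
  · simpa [approxInterval] using hη
  · constructor
    · linarith [mul_le_mul_of_nonneg_right h ht]
    · have : 0 ≤ 1 + β := by linarith
      positivity

namespace Program

variable {n : ℕ}

/-- Pure `ε`-edge differential privacy of a program. -/
def IsEdgeDP (T : Program n ℝ) (ε : ℝ) : Prop :=
  ∀ I₁ I₂ : GraphInput n, EdgeNeighboring I₁.graph I₂.graph → ∀ S : Set ℝ,
    (T.prob I₁ fun x _ => x ∈ S) ≤ Real.exp ε * T.prob I₂ fun x _ => x ∈ S

theorem IsEdgeDP.mono {T : Program n ℝ} {ε ε' : ℝ} (h : T.IsEdgeDP ε) (hε : ε ≤ ε') :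
    T.IsEdgeDP ε' := fun I₁ I₂ hI S =>
  (h I₁ I₂ hI S).trans
    (mul_le_mul_of_nonneg_right (Real.exp_le_exp.2 hε) (prob_nonneg I₂ _))

theorem isEdgeDP_pure (x : ℝ) {ε : ℝ} (hε : 0 ≤ ε) : (pure x : Program n ℝ).IsEdgeDP ε :=
  fun I₁ _ _ _ => le_mul_of_one_le_left (prob_nonneg I₁ _) (Real.one_le_exp hε)

theorem IsRealizedBy.isEdgeDP {T : Program n ℝ} {A : RandomizedAlgorithm n} {ε : ℝ}
    (h : T.IsRealizedBy A) (hT : T.IsEdgeDP ε) : A.IsEdgeDP ε := fun I₁ I₂ hI S hS => by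
  rw [h.probOutput_eq I₁ hS, h.probOutput_eq I₂ hS]
  exact hT I₁ I₂ hI S

end Program

namespace NoiseParameters

variable {n : ℕ} (p : NoiseParameters n)

/-- The private estimator: the grid index of the result of the sublinear estimator is moved by the
geometric mechanism, or, with a small probability, replaced by a uniformly random one. -/
noncomputable def estimator : Program n ℝ :=
  (Program.sublinearEstimator n (p.scale / 40) p.failureProb).perturb
    (fun x => mixUniform p.uniformWeight (geometricMechanism p.decay
      (Nat.succ_pos _ : 0 < p.gridSize) (gridIndex p.offset p.step p.gridSize x)))
    fun j => gridPoint p.offset p.step j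

/-- The results that the sublinear estimator should have on the input `I`. -/
def goodEstimates (I : GraphInput n) : Set ℝ :=
  Set.Icc ((1 - p.scale / 40) * numTriangles I.graph) ((1 + p.scale / 40) * numTriangles I.graph)

theorem prob_sublinearEstimator_notMem_le (I : GraphInput n) :
    ((Program.sublinearEstimator n (p.scale / 40) p.failureProb).prob I
      fun x _ => x ∉ p.goodEstimates I) ≤ p.failureProb :=
  (Program.prob_mono I fun _ _ hx h => hx h.1).trans <|
    Program.prob_sublinearEstimator_not_le I (by exact_mod_cast p.natCast_pos)
      (div_pos p.scale_pos (by norm_num)) (by linarith [p.scale_le]) p.failureProb_pos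
      p.failureProb_le_one

theorem one_le_exp_mul_decay_pow :
    1 ≤ Real.exp p.ε * ((p.decay : ℝ) ^ p.sensitivity * (1 - p.failureProb)) :=
  calc (1 : ℝ) = Real.exp p.ε * (Real.exp (-(39 / 40 * p.ε)) * Real.exp (-(p.ε / 40))) := by
        rw [← Real.exp_add, ← Real.exp_add, ← Real.exp_zero]; congr 1; ring
    _ = Real.exp p.ε * ((p.decay : ℝ) ^ p.sensitivity * Real.exp (-(p.ε / 40))) := by
        rw [decay, ← Real.exp_nat_mul, mul_neg, p.sensitivity_mul_rate]
    _ ≤ Real.exp p.ε * ((p.decay : ℝ) ^ p.sensitivity * (1 - p.failureProb)) := by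
        have := p.decay.2.1
        gcongr
        exact p.exp_neg_le_one_sub_failureProb

theorem isEdgeDP_estimator : p.estimator.IsEdgeDP p.ε := by
  intro I₁ I₂ hI S
  have hle {I₁ I₂ : GraphInput n} (hI : EdgeNeighboring I₁.graph I₂.graph) :
      (numTriangles I₁.graph : ℝ) ≤ numTriangles I₂.graph + p.scale * p.offset := by
    rw [p.scale_mul_offset]
    exact_mod_cast numTriangles_le_add hI
  refine Program.prob_perturb_mixUniform_le (p.prob_sublinearEstimator_notMem_le I₁)
    (p.prob_sublinearEstimator_notMem_le I₂) (pow_nonneg p.decay.2.1 p.sensitivity)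
    (fun x hx y hy j => ?_) (Real.one_le_exp p.ε_pos.le) p.failureProb_pos.le p.failureProb_le_one
    p.one_le_exp_mul_decay_pow ?_ S
  · refine pow_mul_geometricWeight_le p.decay.2.1 p.decay.2.2 ?_ j
    have := p.scale_pos
    rw [sensitivity_eq]
    exact dist_gridIndex_le p.offset_pos p.step_pos (by positivity) (by linarith [p.scale_le])
      (Nat.cast_nonneg _) (Nat.cast_nonneg _) (hle hI) (hle hI.symm) p.scale_pos.le hx hy
  · rw [Nat.cast_add_one]
    exact p.failureProb_mul_le

theorem gridPoint_mem_approxInterval (I : GraphInput n) {x : ℝ} (hx : x ∈ p.goodEstimates I)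
    {j : ℕ} (hj : Nat.dist (gridIndex p.offset p.step p.gridSize x) j < p.radius) :
    gridPoint p.offset p.step j ∈ approxInterval (numTriangles I.graph)
      (p.α / 4 + 8 * p.scale) (p.offset * (p.α / 16)) := by
  have hα := p.α_pos; have hα1 := p.α_lt_one; have hν := p.scale_pos; have hν1 := p.scale_le
  have hN := p.offset_pos
  set t := (numTriangles I.graph : ℝ) with ht
  have ht0 : 0 ≤ t := Nat.cast_nonneg _
  have hx0 : 0 ≤ x := (mul_nonneg (by linarith) ht0).trans hx.1
  have htn : t ≤ (n : ℝ) ^ 3 := by rw [ht]; exact I.numTriangles_le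
  have hxK : x ≤ p.gridSize * p.step * p.offset := by
    refine hx.2.trans (le_trans ?_ p.two_mul_pow_three_le)
    gcongr
    linarith
  obtain ⟨hlow, hup⟩ := gridPoint_mem_Icc hN p.step_pos hx0 hxK hj
  have hexp_low : (p.offset + x) * (1 - p.α / 16) ≤
      (p.offset + x) * Real.exp (-(p.step * p.radius)) := by
    gcongr
    linarith [Real.one_sub_le_exp_neg (p.step * p.radius), p.step_mul_radius_le]
  have hexp_up : (p.offset + x) * Real.exp (p.step * p.radius) ≤
      (p.offset + x) * (1 + p.α / 16) := by
    gcongr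
    exact exp_le_one_add_div hα hα1 p.step_mul_radius_le
  have hx_low : (1 - p.scale / 40) * t * (1 - p.α / 16) ≤ x * (1 - p.α / 16) :=
    mul_le_mul_of_nonneg_right hx.1 (by linarith)
  have hx_up : x * (1 + p.α / 16) ≤ (1 + p.scale / 40) * t * (1 + p.α / 16) :=
    mul_le_mul_of_nonneg_right hx.2 (by linarith)
  have hαt : 0 ≤ p.α * t := by positivity
  have hνt : 0 ≤ p.scale * t := by positivity
  have hνtα : 0 ≤ p.scale * t * p.α := by positivity
  have hνtα_le : p.scale * t * p.α ≤ p.scale * t := mul_le_of_le_one_right hνt hα1.le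
  constructor <;> linarith

theorem le_prob_estimator_mem (I : GraphInput n) :
    1 - 1 / (n : ℝ) ^ p.c ≤ p.estimator.prob I fun x _ => x ∈ approxInterval (numTriangles I.graph)
      (p.α / 4 + p.α * p.ε / (4 * (p.c * Real.log n))) (2 * p.c / p.ε * (n * Real.log n)) := by
  have hα := p.α_pos.ne'; have hε := p.ε_pos.ne'; have hc := p.c_pos.ne'; have hl := p.log_pos.ne'
  have hβ : p.α / 4 + p.α * p.ε / (4 * (p.c * Real.log n)) = p.α / 4 + 8 * p.scale := by
    unfold scale; field_simp; ring
  have hη : 2 * p.c / p.ε * (n * Real.log n) = p.offset * (p.α / 16) := by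
    unfold offset scale; field_simp; ring
  have htail : 0 ≤ 2 * (p.decay : ℝ) ^ p.radius / (1 + p.decay) := by
    have := p.decay.2.1
    positivity
  rw [hβ, hη, sub_le_comm, ← Program.prob_not]
  refine (Program.prob_perturb_mixUniform_notMem_le htail (p.prob_sublinearEstimator_notMem_le I)
    fun x hx => ?_).trans p.failureProb_add_le
  refine (mass_mono _ fun j hj => ?_).trans
    (mass_geometricMechanism_setOf_le_dist_le p.decay _ _ p.radius_pos)
  exact not_lt.1 fun hdist => hj (p.gridPoint_mem_approxInterval I hx hdist)

/-- The factor whose sixth power multiplies `queryScale` in the bound for the number of queries of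
the private estimator. -/
noncomputable def costFactor : ℝ :=
  84 + 4 * Real.log n + p.c * Real.log n + 1280 * (p.c * Real.log n / (p.α * p.ε)) + 40 / p.ε +
    Real.log (1 / mixShare p.c) + Real.log (1 / p.α)

theorem le_prob_estimator_cost_le (I : GraphInput n) (ht : 0 < numTriangles I.graph) :
    1 - 1 / (n : ℝ) ^ p.c ≤ p.estimator.prob I fun _ k => (k : ℝ) ≤
      10 ^ 21 * queryScale n (numTriangles I.graph) (numEdges I.graph) * p.costFactor ^ 6 := by
  have hν := p.scale_pos; have hδ := p.failureProb_pos; have hδ1 := p.failureProb_le_one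
  have hα := p.α_pos; have hε := p.ε_pos; have hc := p.c_pos; have hl := p.log_pos
  have hlog : 0 ≤ Real.log (1 / p.failureProb) := Real.log_nonneg ((one_le_div hδ).2 hδ1)
  have hfactor : 1 + Real.log n + 1 / (p.scale / 40) + Real.log (1 / p.failureProb) ≤
      p.costFactor := by
    have hinv : 1 / (p.scale / 40) = 1280 * (p.c * Real.log n / (p.α * p.ε)) := by
      unfold scale; field_simp; norm_num
    rw [hinv, costFactor]
    linarith [p.log_one_div_failureProb_le]
  have hscale : 0 ≤ queryScale n (numTriangles I.graph) (numEdges I.graph) := by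
    unfold queryScale; positivity
  have hest := Program.prob_sublinearEstimator_not_le I (by exact_mod_cast p.natCast_pos)
    (div_pos hν (by norm_num)) (by linarith [p.scale_le] : p.scale / 40 ≤ 1 / 2) hδ hδ1
  rw [Program.prob_not] at hest
  have hfail : p.failureProb ≤ 1 / (n : ℝ) ^ p.c := by
    refine le_trans (le_add_of_nonneg_right ?_) p.failureProb_add_le
    have := p.decay.2.1; have := p.uniformWeight_pos
    positivity
  rw [estimator, Program.prob_perturb_cost _ _ _ _ fun k => (k : ℝ) ≤ _]
  refine (sub_le_comm.1 (hest.trans hfail)).trans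
    (Program.prob_mono I fun x k h => (h.2 ht).trans ?_)
  gcongr

end NoiseParameters

namespace NoiseParameters

variable {n : ℕ} (p : NoiseParameters n) {K : ℕ}

/-- The privacy beyond which the noise of the private estimator is below `1 / (K * n ^ 3)`. -/
noncomputable def privacyCap (K : ℕ) : ℝ := 2 * p.c * K * n ^ 4 * Real.log n

theorem privacyCap_pos (hK : 0 < K) : 0 < p.privacyCap K := by
  have := p.c_pos; have := p.natCast_pos; have := p.log_pos
  unfold privacyCap; positivity

theorem mul_log_le_privacyCap (hK : 0 < K) : p.c * Real.log n ≤ p.privacyCap K := by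
  have hone : 1 ≤ (K : ℝ) * n ^ 4 :=
    one_le_mul_of_one_le_of_one_le (by exact_mod_cast hK) (one_le_pow₀ p.one_lt_natCast.le)
  calc p.c * Real.log n ≤ p.c * Real.log n * (2 * (K * n ^ 4)) :=
        le_mul_of_one_le_right (mul_pos p.c_pos p.log_pos).le (by linarith)
    _ = p.privacyCap K := by unfold privacyCap; ring

/-- The parameters with the privacy `ε` lowered to `privacyCap` if it is larger. The accuracy `α`
is adapted so that `α * ε`, and hence the number of queries up to logarithms, does not change. -/
noncomputable def cap (hK : 0 < K) : NoiseParameters n where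
  c := p.c
  ε := min p.ε (p.privacyCap K)
  α := p.α * p.ε / min p.ε (p.privacyCap K)
  one_le_log := p.one_le_log
  c_pos := p.c_pos
  ε_pos := lt_min p.ε_pos (p.privacyCap_pos hK)
  α_pos := div_pos (mul_pos p.α_pos p.ε_pos) (lt_min p.ε_pos (p.privacyCap_pos hK))
  α_lt_one := (div_lt_one (lt_min p.ε_pos (p.privacyCap_pos hK))).2 <|
    lt_min (mul_lt_of_lt_one_left p.ε_pos p.α_lt_one)
      (p.mul_lt.trans_le (p.mul_log_le_privacyCap hK))
  mul_lt := by
    rw [div_mul_cancel₀ _ (lt_min p.ε_pos (p.privacyCap_pos hK)).ne']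
    exact p.mul_lt

variable (hK : 0 < K)

theorem cap_ε_le : (p.cap hK).ε ≤ p.ε := min_le_left _ _

theorem cap_ε_le_privacyCap : (p.cap hK).ε ≤ p.privacyCap K := min_le_right _ _

theorem cap_α_mul_ε : (p.cap hK).α * (p.cap hK).ε = p.α * p.ε :=
  div_mul_cancel₀ _ (p.cap hK).ε_pos.ne'

theorem cap_α_le : (p.cap hK).α ≤ p.α + p.α * p.ε / (p.c * Real.log n) := by
  have hα := p.α_pos; have hε := p.ε_pos; have hc := p.c_pos; have hl := p.log_pos
  dsimp only [cap]
  rcases min_choice p.ε (p.privacyCap K) with h | h <;> rw [h]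
  · rw [mul_div_cancel_right₀ _ hε.ne']
    exact le_add_of_nonneg_right (by positivity)
  · refine le_add_of_nonneg_of_le hα.le ?_
    gcongr
    exact p.mul_log_le_privacyCap hK

theorem noise_cap_le :
    2 * p.c / (p.cap hK).ε * (n * Real.log n) ≤
      2 * p.c / p.ε * (n * Real.log n) + 1 / (K * (n : ℝ) ^ 3) := by
  have hε := p.ε_pos; have hc := p.c_pos; have hl := p.log_pos; have hn := p.natCast_pos
  dsimp only [cap]
  rcases min_choice p.ε (p.privacyCap K) with h | h <;> rw [h]
  · exact le_add_of_nonneg_right (by positivity)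
  · refine le_add_of_nonneg_of_le (by positivity) (le_of_eq ?_)
    unfold privacyCap
    field_simp

theorem log_one_div_cap_α_le :
    Real.log (1 / (p.cap hK).α) ≤ 2 * p.c * K + 5 * Real.log n + 1 / (p.α * p.ε) := by
  have hα := p.α_pos; have hε := p.ε_pos; have hc := p.c_pos; have hn := p.natCast_pos
  have hα' := (p.cap hK).α_pos
  set u := 1 / (p.α * p.ε) with hu
  have hu0 : 0 < u := by positivity
  have hle : 1 / (p.cap hK).α ≤ 2 * p.c * K * (n : ℝ) ^ 5 * u :=
    calc 1 / (p.cap hK).α = (p.cap hK).ε * u := by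
          rw [hu, ← p.cap_α_mul_ε hK, mul_one_div, div_mul_cancel_right₀ (p.cap hK).ε_pos.ne',
            one_div]
      _ ≤ 2 * p.c * K * n ^ 4 * Real.log n * u := by gcongr; exact p.cap_ε_le_privacyCap hK
      _ ≤ 2 * p.c * K * n ^ 4 * n * u := by gcongr; exact Real.log_le_self hn.le
      _ = 2 * p.c * K * (n : ℝ) ^ 5 * u := by ring
  calc Real.log (1 / (p.cap hK).α) ≤ Real.log (2 * p.c * K * (n : ℝ) ^ 5 * u) := by gcongr
    _ = Real.log (2 * p.c * K) + 5 * Real.log n + Real.log u := by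
        rw [Real.log_mul (by positivity) hu0.ne', Real.log_mul (by positivity) (by positivity),
          Real.log_pow, Nat.cast_ofNat]
    _ ≤ 2 * p.c * K + 5 * Real.log n + u := by
        linarith [Real.log_le_self (by positivity : 0 ≤ 2 * p.c * K), Real.log_le_self hu0.le]

theorem forty_div_cap_ε_le : 40 / (p.cap hK).ε ≤ 40 * (1 / (p.α * p.ε)) := by
  have hα := p.α_pos; have hε := p.ε_pos
  rw [mul_one_div]
  gcongr
  exact p.cap_α_mul_ε hK ▸ mul_le_of_le_one_left (p.cap hK).ε_pos.le (p.cap hK).α_lt_one.le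

end NoiseParameters

/-- The constant in the bound for the number of queries of the private estimator. -/
noncomputable def costConstant (c : ℝ) (K : ℕ) : ℝ :=
  84 + 1281 * c + 2 * c * K + Real.log (1 / mixShare c)

theorem log_one_div_mixShare_nonneg {c : ℝ} (hc : 0 < c) : 0 ≤ Real.log (1 / mixShare c) :=
  Real.log_nonneg ((one_le_div (mixShare_pos hc)).2 (mixShare_le_one c))

theorem NoiseParameters.costFactor_nonneg {n : ℕ} (p : NoiseParameters n) : 0 ≤ p.costFactor := by
  have := p.c_pos; have := p.ε_pos; have := p.α_pos; have := p.log_pos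
  have := log_one_div_mixShare_nonneg p.c_pos
  have := Real.log_nonneg ((one_le_div p.α_pos).2 p.α_lt_one.le)
  unfold costFactor; positivity

theorem costConstant_pos {c : ℝ} (hc : 0 < c) (K : ℕ) : 0 < costConstant c K := by
  have := log_one_div_mixShare_nonneg hc
  unfold costConstant; positivity

theorem NoiseParameters.costFactor_cap_le {n : ℕ} (p : NoiseParameters n) {K : ℕ} (hK : 0 < K) :
    (p.cap hK).costFactor ≤
      costConstant p.c K * (1 + Real.log n + 1 / (p.α * p.ε)) ^ 2 := by
  have hc := p.c_pos; have hl := p.log_pos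
  have hε_cap := p.forty_div_cap_ε_le hK
  have hα_cap := p.log_one_div_cap_α_le hK
  have hM := log_one_div_mixShare_nonneg hc
  have hu : 0 < 1 / (p.α * p.ε) := one_div_pos.2 (mul_pos p.α_pos p.ε_pos)
  rw [NoiseParameters.costFactor, p.cap_α_mul_ε, div_eq_mul_one_div _ (p.α * p.ε)]
  change 84 + 4 * Real.log n + p.c * Real.log n + 1280 * (p.c * Real.log n * (1 / (p.α * p.ε))) +
    40 / (p.cap hK).ε + Real.log (1 / mixShare p.c) + Real.log (1 / (p.cap hK).α) ≤ _
  set l := Real.log n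
  set u := 1 / (p.α * p.ε)
  set M := Real.log (1 / mixShare p.c) with hM_def
  set W := (1 + l + u) ^ 2 with hW_def
  have : W = 1 + 2 * l + 2 * u + 2 * (l * u) + l ^ 2 + u ^ 2 := by rw [hW_def]; ring
  have hlu : 0 < l * u := mul_pos hl hu
  have hW_linear : 1 + 2 * l + 2 * u ≤ W := by linarith [sq_nonneg l, sq_nonneg u]
  have hl_W : p.c * l ≤ p.c * W := mul_le_mul_of_nonneg_left (by linarith) hc.le
  have hlu_W : p.c * (l * u) ≤ p.c * W :=
    mul_le_mul_of_nonneg_left (by linarith [sq_nonneg l, sq_nonneg u]) hc.le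
  have hM_W : M * 1 ≤ M * W := mul_le_mul_of_nonneg_left (by linarith) hM
  have hK_W : 2 * p.c * K * 1 ≤ 2 * p.c * K * W :=
    mul_le_mul_of_nonneg_left (by linarith) (by positivity)
  rw [costConstant, ← hM_def]
  linarith

theorem numTriangles_eq_zero {n : ℕ} (hn : n ≤ 2) (G : SimpleGraph (Fin n)) :
    numTriangles G = 0 := by
  suffices G.cliqueSet 3 = ∅ by rw [numTriangles, this, Set.ncard_empty]
  refine Set.eq_empty_of_forall_notMem fun s hs => ?_
  have hcard := s.card_le_univ
  rw [(G.mem_cliqueSet_iff.1 hs).card_eq, Fintype.card_fin] at hcard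
  omega

/-- `T` is an `ε`-private estimator of the number of triangles that, except with probability
`n ^ (-c)`, has relative error `β` and additional error `η` and, again except with probability
`n ^ (-c)`, makes few queries, in terms of a desired accuracy `α`. -/
structure Program.IsPrivateEstimator {n : ℕ} (T : Program n ℝ) (K : ℕ) (c ε α β η : ℝ) :
    Prop where
  isEdgeDP : T.IsEdgeDP ε
  le_prob_mem (I : GraphInput n) :
    1 - 1 / (n : ℝ) ^ c ≤ T.prob I fun x _ => x ∈ approxInterval (numTriangles I.graph) β η
  le_prob_cost_le (I : GraphInput n) : 0 < numTriangles I.graph →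
    1 - 1 / (n : ℝ) ^ c ≤ T.prob I fun _ k => (k : ℝ) ≤
      10 ^ 21 * queryScale n (numTriangles I.graph) (numEdges I.graph) *
        (costConstant c K * (1 + Real.log n + 1 / (α * ε)) ^ 2) ^ 6

section Existence

variable {n K : ℕ} {c ε α η : ℝ}

theorem NoiseParameters.isPrivateEstimator_estimator_cap (p : NoiseParameters n) (hK : 0 < K) :
    (p.cap hK).estimator.IsPrivateEstimator K p.c p.ε p.α
      (p.α * (1 + p.ε / (p.c * Real.log n)))
      (2 * p.c / p.ε * (n * Real.log n) + 1 / (K * (n : ℝ) ^ 3)) where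
  isEdgeDP := (p.cap hK).isEdgeDP_estimator.mono (p.cap_ε_le hK)
  le_prob_mem I := by
    have hβ : (p.cap hK).α / 4 + (p.cap hK).α * (p.cap hK).ε / (4 * (p.c * Real.log n)) ≤
        p.α * (1 + p.ε / (p.c * Real.log n)) := by
      have : 0 ≤ p.α * p.ε / (p.c * Real.log n) :=
        div_nonneg (mul_pos p.α_pos p.ε_pos).le (mul_pos p.c_pos p.log_pos).le
      rw [p.cap_α_mul_ε, mul_add, mul_one, mul_comm 4, ← div_div, ← mul_div_assoc]
      linarith [p.cap_α_le hK, p.α_pos]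
    exact ((p.cap hK).le_prob_estimator_mem I).trans <| Program.prob_mono I fun x _ hx =>
      approxInterval_subset (Nat.cast_nonneg _) hβ (p.noise_cap_le hK) hx
  le_prob_cost_le I ht := by
    refine ((p.cap hK).le_prob_estimator_cost_le I ht).trans <|
      Program.prob_mono I fun _ k hk => hk.trans ?_
    have hscale : 0 ≤ queryScale n (numTriangles I.graph) (numEdges I.graph) := by
      unfold queryScale; positivity
    have := (p.cap hK).costFactor_nonneg
    gcongr
    exact p.costFactor_cap_le hK

theorem Program.isPrivateEstimator_pure_zero (hc : 0 < c) (hε : 0 < ε) (hα : 0 < α) (hη : 0 ≤ η)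
    (h : n ≤ 2 ∨ c * Real.log n ≤ α * ε) :
    (pure 0 : Program n ℝ).IsPrivateEstimator K c ε α (α * (1 + ε / (c * Real.log n))) η where
  isEdgeDP := isEdgeDP_pure 0 hε.le
  le_prob_mem I := by
    classical
    have hmem : 0 ∈ approxInterval (numTriangles I.graph) (α * (1 + ε / (c * Real.log n))) η := by
      refine zero_mem_approxInterval (Nat.cast_nonneg _) hη ?_
      rcases le_or_gt n 2 with hn | hn
      · exact Or.inl (by rw [numTriangles_eq_zero hn, Nat.cast_zero])
      · have hlog : 0 < Real.log n := Real.log_pos (by exact_mod_cast one_lt_two.trans hn)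
        have hone : 1 ≤ α * ε / (c * Real.log n) :=
          (one_le_div (by positivity)).2 (h.resolve_left hn.not_ge)
        rw [mul_add, mul_one, ← mul_div_assoc]
        exact Or.inr (le_add_of_nonneg_of_le hα.le hone)
    rw [prob_pure, if_pos hmem]
    exact sub_le_self _ (by positivity)
  le_prob_cost_le I _ := by
    classical
    have hscale : 0 ≤ queryScale n (numTriangles I.graph) (numEdges I.graph) := by
      unfold queryScale; positivity
    rw [prob_pure, if_pos (by simpa using by positivity)]
    exact sub_le_self _ (by positivity)

theorem Program.exists_isPrivateEstimator (hK : 0 < K) (hc : 0 < c) (hε : 0 < ε) (hα : 0 < α)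
    (hα1 : α < 1) (n : ℕ) :
    ∃ T : Program n ℝ, T.IsPrivateEstimator K c ε α (α * (1 + ε / (c * Real.log n)))
      (2 * c / ε * (n * Real.log n) + 1 / (K * (n : ℝ) ^ 3)) := by
  by_cases htriv : n ≤ 2 ∨ c * Real.log n ≤ α * ε
  · have := Real.log_natCast_nonneg n
    exact ⟨pure 0, isPrivateEstimator_pure_zero hc hε hα (by positivity) htriv⟩
  · push Not at htriv
    have hlog : 1 ≤ Real.log n := by
      have hn : (3 : ℝ) ≤ n := by exact_mod_cast htriv.1
      rw [Real.le_log_iff_exp_le (by linarith)]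
      linarith [Real.exp_one_lt_d9]
    exact ⟨_, NoiseParameters.isPrivateEstimator_estimator_cap
      ⟨c, ε, α, hlog, hc, hε, hα, hα1, htriv.2⟩ hK⟩

end Existence

end TriangleDP

theorem mainTheorem5 (K : ℕ) (hK : 0 < K) (c : ℝ) (hc : 0 < c) :
    ∃ C' C : ℝ, 0 < C' ∧ 0 < C ∧ ∃ k : ℕ,
      ∀ ε : ℝ, 0 < ε → ∀ α : ℝ, 0 < α → α < 1 →
        ∃ A : (n : ℕ) → TriangleDP.RandomizedAlgorithm n,
          ∀ n : ℕ, 0 < n →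
            -- Privacy
            (A n).IsEdgeDP ε ∧
            ∀ I : TriangleDP.GraphInput n, ∀ t m α' err : ℝ,
              t = (TriangleDP.numTriangles I.graph : ℝ) →
              m = (TriangleDP.numEdges I.graph : ℝ) →
              α' = α * (1 + ε / (C' * Real.log n)) →
              err = 2 * c / ε * (n * Real.log n) + 1 / (K * (n : ℝ) ^ 3) →
              -- Accuracy
              1 - 1 / (n : ℝ) ^ c - 1 / ((n : ℝ) ^ (c - 3) * (Real.exp ε - 1) / K + 1) ≤
                (A n).probOutput I (Set.Icc ((1 - α') * t - err) ((1 + α') * t + err)) ∧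
              -- Queries
              (0 < t →
                1 - 1 / (n : ℝ) ^ c ≤
                  (A n).probQueriesLE I
                    (C * (n / t ^ (1 / 3 : ℝ) + m ^ (3 / 2 : ℝ) / t) *
                      (1 + Real.log n + 1 / (α * ε)) ^ k)) := by
  have hB := TriangleDP.costConstant_pos hc K
  refine ⟨c, 10 ^ 21 * TriangleDP.costConstant c K ^ 6, hc, by positivity, 12,
    fun ε hε α hα hα1 => ?_⟩
  choose T hT using fun n => TriangleDP.Program.exists_isPrivateEstimator hK hc hε hα hα1 n
  choose A hA using fun n => TriangleDP.Program.exists_isRealizedBy (T n)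
  refine ⟨A, fun n _ => ⟨(hA n).isEdgeDP (hT n).isEdgeDP, ?_⟩⟩
  rintro I t m α' err rfl rfl rfl rfl
  rw [(hA n).probOutput_eq I measurableSet_Icc, (hA n).probQueriesLE_eq]
  refine ⟨(sub_le_self _ ?_).trans ((hT n).le_prob_mem I), fun ht =>
    ((hT n).le_prob_cost_le I (by exact_mod_cast ht)).trans_eq ?_⟩
  · have : 0 ≤ Real.exp ε - 1 := sub_nonneg.2 (Real.one_le_exp hε.le)
    positivity
  · rw [mul_pow, ← pow_mul, TriangleDP.queryScale]
    congr! 4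
    ring
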